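/- Let $N\ge 2$, let $H$ be a real symmetric positive-definite $N\times N$ matrix and $M$ a real $N\times N$ matrix. Consider the quadratic potential $V(x)=\tfrac12\langle x,Hx\rangle$ and the linear vector field $b(x)=Mx$ on $\mathbb R^N$, so that $D^2V=H$ and $Db=M$. Let $$\mathcal A=\bigcup_{\ell\in(0,1)}\operatorname{int}\Big\{\alpha\in\mathbb R:\ \ell\,\tfrac14|\nabla V(x)|^2-\tfrac12\langle b(x),\nabla V(x)\rangle+\alpha(1-\alpha)|b(x)|^2\ge 0\ \text{ for all }x\in\mathbb R^N\Big\}.$$ For $\alpha\in\mathbb R$ put $$B^{(\alpha)}=(1-2\alpha)M,\qquad K^{(\alpha)}=\tfrac14H^2-\tfrac14(M^{\mathsf T}H+HM)+\alpha(1-\alpha)M^{\mathsf T}M,$$ $$\mathcal K^{(\alpha)}_{\rm Ham}=\begin{bmatrix}-\tfrac12B^{(\alpha)}&\mathbf 1\\ K^{(\alpha)}&\tfrac12(B^{(\alpha)})^{\mathsf T}\end{bmatrix},$$ and let $Q^\alpha$ be the operator $$Q^\alpha f=\Delta f+\langle B^{(\alpha)}x,\nabla f\rangle-\langle x,K^{(\alpha)}x\rangle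 f+\big(\tfrac12\operatorname{tr}H-\alpha\operatorname{tr}M\big)f$$ in the complex space $L^2(\mathbb R^N)$, with domain $\{f\in W^{2,2}(\mathbb R^N): |\nabla V|^2f\in L^2(\mathbb R^N)\}$. Then, for every $\alpha\in\mathcal A$, the algebraic Riccati equation $$X^2-\tfrac12(B^{(\alpha)})^{\mathsf T}X-\tfrac12XB^{(\alpha)}-K^{(\alpha)}=0$$ has a maximal real symmetric solution $X^{(\alpha)}$ (a symmetric solution such that $X^{(\alpha)}-Y$ is positive semidefinite for every symmetric solution $Y$), and the spectral bound of $Q^\alpha$ is $$\sup\{\operatorname{Re}z: z\in\operatorname{sp}Q^\alpha\}=-\operatorname{tr}X^{(\alpha)}+\tfrac12\operatorname{tr}H-\alpha\operatorname{tr}M .$$ Moreover, $\alpha\mapsto\operatorname{tr}X^{(\alpha)}$ is real-analytic on $\mathcal A$, and for every $\alpha\in\mathcal A$ $$\operatorname{tr}X^{(\alpha)}=\frac12\Big(\operatorname{tr}B^{(\alpha)}+\sum_{\lambda\in\operatorname{sp}\mathcal K^{(\alpha)}_{\rm Ham}}|\operatorname{Re}\lambda|\Big),$$ where the sum runs over the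 complex eigenvalues of $\mathcal K^{(\alpha)}_{\rm Ham}$ repeated according to algebraic multiplicity. -/

import Mathlib

open MeasureTheory TemperedDistribution
open scoped SchwartzMap Laplacian LineDeriv Gradient InnerProductSpace ENNReal

noncomputable section

namespace LinearDiffusion

/-- The Euclidean space `ℝ^N`. -/
abbrev Euc (N : ℕ) : Type := EuclideanSpace ℝ (Fin N)

/-- The complex Hilbert space `L²(ℝ^N, dx)`. -/
abbrev L2 (N : ℕ) : Type := Lp ℂ 2 (volume : Measure (Euc N))

/-! ### The set of admissible parameters -/

/-- `𝒜 = ⋃_{ℓ ∈ (0,1)} int {α : ℓ ¼ |∇V|² - ½ ⟨b, ∇V⟩ + α (1 - α) |b|² ≥ 0 on ℝ^N}`. -/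
def admissibleSet {N : ℕ} (V : Euc N → ℝ) (b : Euc N → Euc N) : Set ℝ :=
  ⋃ ℓ ∈ Set.Ioo (0 : ℝ) 1, interior {α : ℝ | ∀ x : Euc N,
    0 ≤ ℓ * ((1 / 4) * ‖∇ V x‖ ^ 2) - (1 / 2) * ⟪b x, ∇ V x⟫_ℝ + α * (1 - α) * ‖b x‖ ^ 2}

/-- The linear vector field `x ↦ M x`. -/
def linearField {N : ℕ} (M : Matrix (Fin N) (Fin N) ℝ) (x : Euc N) : Euc N :=
  Matrix.toEuclideanLin M x

/-- The quadratic form `x ↦ ⟨x, K x⟩`. -/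
def quadForm {N : ℕ} (K : Matrix (Fin N) (Fin N) ℝ) (x : Euc N) : ℝ :=
  ⟪x, linearField K x⟫_ℝ

/-- The quadratic potential `x ↦ ½ ⟨x, H x⟩`, whose Hessian is `H` when `H` is symmetric. -/
def quadPotential {N : ℕ} (H : Matrix (Fin N) (Fin N) ℝ) (x : Euc N) : ℝ :=
  (1 / 2) * quadForm H x

/-! ### The matrices attached to `H = D²V`, `M = Db` and the parameter `α` -/

/-- `B = (1 - 2α) M`. -/
def matB {N : ℕ} (M : Matrix (Fin N) (Fin N) ℝ) (α : ℝ) : Matrix (Fin N) (Fin N) ℝ :=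
  (1 - 2 * α) • M

/-- `K = ¼ H² - ¼ (Mᵀ H + H M) + α (1 - α) Mᵀ M`. -/
def matK {N : ℕ} (H M : Matrix (Fin N) (Fin N) ℝ) (α : ℝ) : Matrix (Fin N) (Fin N) ℝ :=
  (1 / 4 : ℝ) • H ^ 2 - (1 / 4 : ℝ) • (M.transpose * H + H * M)
    + (α * (1 - α)) • (M.transpose * M)

/-- `X` is a symmetric solution of `X² - ½ Bᵀ X - ½ X B - K = 0`. -/
def IsRiccatiSolution {N : ℕ} (B K X : Matrix (Fin N) (Fin N) ℝ) : Prop :=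
  X.IsSymm ∧ X ^ 2 - (1 / 2 : ℝ) • (B.transpose * X) - (1 / 2 : ℝ) • (X * B) - K = 0

/-- `X` is the maximal symmetric solution: every symmetric solution `Y` satisfies `Y ≤ X`, that is,
`X - Y` is positive semidefinite. -/
def IsMaximalRiccatiSolution {N : ℕ} (B K X : Matrix (Fin N) (Fin N) ℝ) : Prop :=
  IsRiccatiSolution B K X ∧ ∀ Y, IsRiccatiSolution B K Y → (X - Y).PosSemidef

/-- The Hamiltonian matrix with blocks `-½ B`, `1`, `K`, `½ Bᵀ`. -/
def hamiltonianMatrix {N : ℕ} (B K : Matrix (Fin N) (Fin N) ℝ) :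
    Matrix (Fin N ⊕ Fin N) (Fin N ⊕ Fin N) ℝ :=
  Matrix.fromBlocks (-((1 / 2 : ℝ) • B)) 1 K ((1 / 2 : ℝ) • B.transpose)

/-- `∑ |Re λ|` over the complex eigenvalues `λ` of a real matrix, repeated according to their
algebraic multiplicities. -/
def sumAbsReEigenvalues {ι : Type*} [Fintype ι] [DecidableEq ι] (A : Matrix ι ι ℝ) : ℝ :=
  ((A.map Complex.ofReal).charpoly.roots.map fun z => |z.re|).sum

/-! ### Spectrum and spectral bound of an unbounded operator -/

/-- `z` is in the resolvent set of `A` if `z - A : dom A → E` is a bijection with bounded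
inverse `R`. -/
def resolventSetOf {E : Type*} [NormedAddCommGroup E] [NormedSpace ℂ E] (A : E →ₗ.[ℂ] E) :
    Set ℂ :=
  {z | ∃ R : E →L[ℂ] E,
    (∀ h : E, ∃ hR : R h ∈ A.domain, z • R h - A ⟨R h, hR⟩ = h) ∧
    ∀ f : A.domain, R (z • (f : E) - A f) = f}

/-- The spectrum of an unbounded operator. -/
def spectrumOf {E : Type*} [NormedAddCommGroup E] [NormedSpace ℂ E] (A : E →ₗ.[ℂ] E) : Set ℂ :=
  (resolventSetOf A)ᶜ

/-- The spectral bound `sup {Re z : z ∈ sp A}`, as an extended real number. -/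
def spectralBound {E : Type*} [NormedAddCommGroup E] [NormedSpace ℂ E] (A : E →ₗ.[ℂ] E) : EReal :=
  ⨆ z ∈ spectrumOf A, ((z.re : ℝ) : EReal)

/-! ### The quadratic operator -/

/-- `u ↦ Δu + ⟨B x, ∇u⟩ - ⟨x, K x⟩ u + c u` on tempered distributions. -/
def quadOpDist {N : ℕ} (B K : Matrix (Fin N) (Fin N) ℝ) (c : ℝ) (u : 𝓢'(Euc N, ℂ)) :
    𝓢'(Euc N, ℂ) :=
  Δ u
    + ∑ i, smulLeftCLM ℂ (fun x : Euc N => ((linearField B x i : ℝ) : ℂ))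
        (∂_{(EuclideanSpace.single i (1 : ℝ) : Euc N)} u)
    - smulLeftCLM ℂ (fun x : Euc N => ((quadForm K x : ℝ) : ℂ)) u
    + (c : ℂ) • u

theorem quadOpDist_add {N : ℕ} (B K : Matrix (Fin N) (Fin N) ℝ) (c : ℝ) (u v : 𝓢'(Euc N, ℂ)) :
    quadOpDist B K c (u + v) = quadOpDist B K c u + quadOpDist B K c v := by
  simp only [quadOpDist, ← laplacianCLM_apply, LineDeriv.lineDerivOp_add, map_add, Finset.sum_add_distrib,
    smul_add]
  abel

theorem quadOpDist_smul {N : ℕ} (B K : Matrix (Fin N) (Fin N) ℝ) (c : ℝ) (a : ℂ)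
    (u : 𝓢'(Euc N, ℂ)) : quadOpDist B K c (a • u) = a • quadOpDist B K c u := by
  simp only [quadOpDist, ← laplacianCLM_apply, LineDeriv.lineDerivOp_smul, map_smul, smul_add, smul_sub,
    Finset.smul_sum, smul_comm (c : ℂ) a]

theorem toTemperedDistribution_add {N : ℕ} (f g : L2 N) :
    ((f + g : L2 N) : 𝓢'(Euc N, ℂ)) = (f : 𝓢'(Euc N, ℂ)) + (g : 𝓢'(Euc N, ℂ)) :=
  map_add (Lp.toTemperedDistributionCLM ℂ (volume : Measure (Euc N)) 2) f g

theorem toTemperedDistribution_smul {N : ℕ} (a : ℂ) (f : L2 N) :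
    ((a • f : L2 N) : 𝓢'(Euc N, ℂ)) = a • (f : 𝓢'(Euc N, ℂ)) :=
  map_smul (Lp.toTemperedDistributionCLM ℂ (volume : Measure (Euc N)) 2) a f

theorem eq_of_toTemperedDistribution_eq {N : ℕ} {g h : L2 N}
    (e : (g : 𝓢'(Euc N, ℂ)) = (h : 𝓢'(Euc N, ℂ))) : g = h := by
  have hker := Lp.ker_toTemperedDistributionCLM_eq_bot (E := Euc N) (F := ℂ)
    (μ := (volume : Measure (Euc N))) (p := 2)
  exact (LinearMap.ker_eq_bot.mp hker) e

/-- The domain of the quadratic operator: all `f ∈ W^{2,2}(ℝ^N)` with `|∇V|² f ∈ L²(ℝ^N)`, where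
`∇V(x) = H x`. The last clause says that the distribution `Q f` is an `L²` function; for `H`
positive definite it follows from the first two, because then `|x| |∇f| ∈ L²(ℝ^N)`. -/
def quadOpDomain {N : ℕ} (H B K : Matrix (Fin N) (Fin N) ℝ) (c : ℝ) : Submodule ℂ (L2 N) where
  carrier := {f | MemSobolev 2 2 (f : 𝓢'(Euc N, ℂ)) ∧
    MemLp (fun x : Euc N => ((‖linearField H x‖ ^ 2 : ℝ) : ℂ) * f x) 2 volume ∧
    ∃ g : L2 N, quadOpDist B K c (f : 𝓢'(Euc N, ℂ)) = (g : 𝓢'(Euc N, ℂ))}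
  zero_mem' := by
    refine ⟨?_, ?_, 0, ?_⟩
    · rw [← Lp.toTemperedDistributionCLM_apply, map_zero]
      exact memSobolev_fun_zero _ _ _ _
    · refine (MemLp.zero : MemLp (0 : Euc N → ℂ) 2 volume).ae_eq ?_
      filter_upwards [Lp.coeFn_zero ℂ 2 (volume : Measure (Euc N))] with x hx
      rw [hx]
      simp
    · rw [← Lp.toTemperedDistributionCLM_apply, map_zero]
      have h := quadOpDist_add B K c 0 0
      rwa [add_zero, left_eq_add] at h
  add_mem' := by
    rintro f₁ f₂ ⟨s₁, m₁, g₁, h₁⟩ ⟨s₂, m₂, g₂, h₂⟩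
    refine ⟨?_, ?_, g₁ + g₂, ?_⟩
    · rw [toTemperedDistribution_add]
      exact s₁.add s₂
    · refine (m₁.add m₂).ae_eq ?_
      filter_upwards [Lp.coeFn_add f₁ f₂] with x hx
      rw [Pi.add_apply, ← mul_add, ← Pi.add_apply (f₁ : Euc N → ℂ), ← hx]
    · rw [toTemperedDistribution_add, toTemperedDistribution_add, quadOpDist_add, h₁, h₂]
  smul_mem' := by
    rintro a f ⟨s, m, g, h⟩
    refine ⟨?_, ?_, a • g, ?_⟩
    · rw [toTemperedDistribution_smul]
      exact s.smul a
    · refine (m.const_smul a).ae_eq ?_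
      filter_upwards [Lp.coeFn_smul a f] with x hx
      simp only [Pi.smul_apply, hx, smul_eq_mul]
      ring
    · rw [toTemperedDistribution_smul, toTemperedDistribution_smul, quadOpDist_smul, h]

/-- The operator `Δ + ⟨B x, ∇⟩ - ⟨x, K x⟩ + c` in `L²(ℝ^N)`: `Q f` is the unique `L²` function
that represents the distribution `Δf + ⟨B x, ∇f⟩ - ⟨x, K x⟩ f + c f`. -/
def quadOp {N : ℕ} (H B K : Matrix (Fin N) (Fin N) ℝ) (c : ℝ) : L2 N →ₗ.[ℂ] L2 N where
  domain := quadOpDomain H B K c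
  toFun :=
    { toFun := fun f => f.2.2.2.choose
      map_add' := fun f₁ f₂ => by
        apply eq_of_toTemperedDistribution_eq
        rw [toTemperedDistribution_add, ← (f₁ + f₂).2.2.2.choose_spec, ← f₁.2.2.2.choose_spec,
          ← f₂.2.2.2.choose_spec, ← quadOpDist_add, ← toTemperedDistribution_add]
        rfl
      map_smul' := fun a f => by
        apply eq_of_toTemperedDistribution_eq
        rw [RingHom.id_apply, toTemperedDistribution_smul, ← (a • f).2.2.2.choose_spec,
          ← f.2.2.2.choose_spec, ← quadOpDist_smul, ← toTemperedDistribution_smul]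
        rfl }

/-- The operator
`Q^α = Δ + ⟨B x, ∇⟩ - ⟨x, K x⟩ + ½ tr H - α tr M`, with `B = (1 - 2α) M` and
`K = ¼ H² - ¼ (Mᵀ H + H M) + α (1 - α) Mᵀ M`. -/
def deformedOp {N : ℕ} (H M : Matrix (Fin N) (Fin N) ℝ) (α : ℝ) : L2 N →ₗ.[ℂ] L2 N :=
  quadOp H (matB M α) (matK H M α) ((1 / 2) * H.trace - α * M.trace)

end LinearDiffusion

end

open LinearDiffusion

/-! Admissibility with some ℓ < 1 gives ⟨x, K x⟩ ≥ ¼ (1 - ℓ) |H x|², so K is positive definite on 𝒜.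
From then on B is an arbitrary matrix and only K > 0 matters.

Algebra. Write F for the Riccati expression and A = X - ½ B for the closed loop. The identity Aᵀ X +
X A = X² + K + F(X) makes X a Lyapunov function for A when X ≥ 0 and F(X) ≥ 0. Then D ↦ Aᵀ D + D A
is a bijection of the symmetric matrices with a positive inverse (`posSemidef_of_lyapunov`,
`exists_lyapunov`). It is also the derivative of F at X, with exact remainder D² (`riccati_add`). A
solution X > 0 comes from minimising the trace on {X ≥ 0, F(X) ≥ 0}, because a Newton step lowers
the trace unless F(X) = 0. Maximality, uniqueness among positive definite solutions, and analyticity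
in α (inverse function theorem) follow from the same two facts. The graph of X is invariant under
the Hamiltonian matrix, which is therefore similar to a block triangular matrix with diagonal blocks
A and -Aᵀ. As the spectrum of A lies in Re > 0, the sum of |Re λ| is 2 tr A.

Analysis. Put L = Δ + ⟨B x, ∇⟩ - ⟨x, K x⟩. The Gaussian exp(-½ ⟨x, X x⟩) is an eigenfunction of L
for -tr X, and conjugating by it turns L into Δ - 2 ⟨A x, ∇⟩ - tr X on polynomials
(`schwOp_polyGauss`). The Laplacian lowers degrees and the drift 2 ⟨A x, ∇⟩ has eigenvalues with
nonnegative real part, so z - L maps polynomials times the Gaussian onto themselves whenever Re z >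
-tr X. These functions are dense in L². For large real ω, energy estimates bound the inverse of ω -
L, and it extends to an operator R whose range lies in the domain (`exists_resolvent`).

For other z with Re z > -tr X no such bound is at hand; the Fredholm alternative for R replaces it.
R is compact because the energy controls the distance to polynomials of degree at most n times the
Gaussian. L² eigenfunctions are excluded by duality: the formal adjoint has drift -B, its positive
definite Riccati solution Y satisfies tr Y + tr B = tr X, and so its range contains another dense
set of polynomials times a Gaussian (`eq_zero_of_quadOpDist_eq_smul`). -/

namespace LinearDiffusion

open Matrix Filter Topology

/-- The space of symmetric matrices. -/
def symmMatrices (n : Type*) : Submodule ℝ (Matrix n n ℝ) where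
  carrier := {Z | Z.IsSymm}
  zero_mem' := isSymm_zero
  add_mem' := fun ha hb => ha.add hb
  smul_mem' := fun c _ h => h.smul c

theorem mem_symmMatrices {n : Type*} {Z : Matrix n n ℝ} : Z ∈ symmMatrices n ↔ Z.IsSymm := Iff.rfl

/-! ### Quadratic forms and the Lyapunov equation -/

section QuadraticForms

variable {n : Type*} [Fintype n]

/-- The ratio of the two forms is homogeneous of degree zero, so a minimiser on the compact unit
sphere is global. The cross-multiplied form also covers w = 0. -/
theorem exists_min_quadraticForm_ratio {P : Matrix n n ℝ} (hP : P.PosDef)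
    (S : Matrix n n ℝ) {u : n → ℝ} (hu : u ≠ 0) :
    ∃ v : n → ℝ, v ≠ 0 ∧ ∀ w : n → ℝ,
      (v ⬝ᵥ S *ᵥ v) * (w ⬝ᵥ P *ᵥ w) ≤ (w ⬝ᵥ S *ᵥ w) * (v ⬝ᵥ P *ᵥ v) := by
  have hpos : ∀ w : n → ℝ, w ≠ 0 → 0 < w ⬝ᵥ P *ᵥ w := fun w hw => by
    simpa using hP.dotProduct_mulVec_pos hw
  have hne : ∀ w ∈ Metric.sphere (0 : n → ℝ) 1, w ≠ 0 := fun w hw h => by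
    simp [h] at hw
  have hcont : ∀ T : Matrix n n ℝ, Continuous fun w : n → ℝ => w ⬝ᵥ T *ᵥ w := fun T =>
    continuous_id.dotProduct (Continuous.matrix_mulVec continuous_const continuous_id)
  obtain ⟨v, hv, hmin⟩ := (isCompact_sphere (0 : n → ℝ) 1).exists_isMinOn
    ⟨‖u‖⁻¹ • u, by simp [norm_smul, hu]⟩
    (f := fun w => (w ⬝ᵥ S *ᵥ w) / (w ⬝ᵥ P *ᵥ w))
    ((hcont S).continuousOn.div (hcont P).continuousOn fun w hw => (hpos w (hne w hw)).ne')
  refine ⟨v, hne v hv, fun w => ?_⟩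
  rcases eq_or_ne w 0 with rfl | hw
  · simp
  have h := hmin (show ‖w‖⁻¹ • w ∈ Metric.sphere (0 : n → ℝ) 1 by simp [norm_smul, hw])
  have hw' : ‖w‖⁻¹ ≠ 0 := by simpa using hw
  simp only [Set.mem_ofPred_eq, mulVec_smul, smul_dotProduct, dotProduct_smul, smul_eq_mul] at h
  rw [mul_div_mul_left _ _ hw', mul_div_mul_left _ _ hw',
    div_le_div_iff₀ (hpos v (hne v hv)) (hpos w hw)] at h
  exact h

theorem posSemidef_of_isSymm {S : Matrix n n ℝ} (hS : S.IsSymm)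
    (h : ∀ w : n → ℝ, 0 ≤ w ⬝ᵥ S *ᵥ w) : S.PosSemidef :=
  posSemidef_iff_dotProduct_mulVec.2 ⟨by
    rw [IsHermitian, conjTranspose_eq_transpose_of_trivial]; exact hS, fun w => by
      simpa using h w⟩

theorem posDef_of_isSymm {S : Matrix n n ℝ} (hS : S.IsSymm)
    (h : ∀ w : n → ℝ, w ≠ 0 → 0 < w ⬝ᵥ S *ᵥ w) : S.PosDef :=
  posDef_iff_dotProduct_mulVec.2 ⟨by
    rw [IsHermitian, conjTranspose_eq_transpose_of_trivial]; exact hS, fun w hw => by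
      simpa using h w hw⟩

theorem _root_.Matrix.PosSemidef.quadratic_nonneg {S : Matrix n n ℝ} (hS : S.PosSemidef)
    (w : n → ℝ) : 0 ≤ w ⬝ᵥ S *ᵥ w := by
  simpa using hS.dotProduct_mulVec_nonneg w

theorem _root_.Matrix.PosDef.quadratic_pos {S : Matrix n n ℝ} (hS : S.PosDef)
    {w : n → ℝ} (hw : w ≠ 0) : 0 < w ⬝ᵥ S *ᵥ w := by
  simpa using hS.dotProduct_mulVec_pos hw

theorem _root_.Matrix.PosSemidef.isSymm {m : Type*} {S : Matrix m m ℝ} (hS : S.PosSemidef) : S.IsSymm := by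
  have h := hS.isHermitian
  rwa [IsHermitian, conjTranspose_eq_transpose_of_trivial] at h

/-- A positive definite form dominates a multiple of any other positive definite form. -/
theorem _root_.Matrix.PosDef.exists_coercive {P S : Matrix n n ℝ} (hP : P.PosDef)
    (hS : S.PosDef) : ∃ c > 0, ∀ w : n → ℝ, c * (w ⬝ᵥ P *ᵥ w) ≤ w ⬝ᵥ S *ᵥ w := by
  by_cases h : ∃ u : n → ℝ, u ≠ 0
  · obtain ⟨u, hu⟩ := h
    obtain ⟨v, hv, hmin⟩ := exists_min_quadraticForm_ratio hP S hu
    have hPv := hP.quadratic_pos hv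
    refine ⟨(v ⬝ᵥ S *ᵥ v) / (v ⬝ᵥ P *ᵥ v), div_pos (hS.quadratic_pos hv) hPv, fun w => ?_⟩
    rw [div_mul_eq_mul_div, div_le_iff₀ hPv]
    exact hmin w
  · push Not at h
    exact ⟨1, one_pos, fun w => by simp [h w]⟩

theorem dotProduct_transpose_mul_mulVec (A Z : Matrix n n ℝ) (v : n → ℝ) :
    v ⬝ᵥ (Aᵀ * Z) *ᵥ v = (A *ᵥ v) ⬝ᵥ (Z *ᵥ v) := by
  rw [← mulVec_mulVec, dotProduct_mulVec, vecMul_transpose]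

theorem dotProduct_lyapunov {A Z : Matrix n n ℝ} (hZ : Z.IsSymm) (v : n → ℝ) :
    v ⬝ᵥ (Aᵀ * Z + Z * A) *ᵥ v = 2 * ((A *ᵥ v) ⬝ᵥ (Z *ᵥ v)) := by
  rw [add_mulVec, dotProduct_add, dotProduct_transpose_mul_mulVec, ← mulVec_mulVec,
    dotProduct_mulVec v, ← mulVec_transpose, hZ.eq, dotProduct_comm (Z *ᵥ v), two_mul]

/-- Positivity of solutions of the Lyapunov equation. -/
theorem posSemidef_of_lyapunov {A P Z : Matrix n n ℝ} (hP : P.PosDef)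
    (hL : (Aᵀ * P + P * A).PosDef) (hZ : Z.IsSymm) (hQ : (Aᵀ * Z + Z * A).PosSemidef) :
    Z.PosSemidef := by
  refine posSemidef_of_isSymm hZ fun u => ?_
  by_contra! hneg
  have hu : u ≠ 0 := by rintro rfl; simp at hneg
  obtain ⟨v, hv, hmin⟩ := exists_min_quadraticForm_ratio hP Z hu
  have hPv := hP.quadratic_pos hv
  -- Minus the least ratio of Z to P: Z + tP is then positive semidefinite with null vector v. Its
  -- Lyapunov form vanishes at v, yet equals a nonnegative term plus t times a positive one.
  set t : ℝ := -(v ⬝ᵥ Z *ᵥ v) / (v ⬝ᵥ P *ᵥ v) with ht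
  have htpos : 0 < t := by
    refine div_pos ?_ hPv
    have h1 := hmin u
    have h2 := hP.quadratic_pos hu
    nlinarith [mul_neg_of_neg_of_pos hneg hPv]
  have hsymm : (Z + t • P).IsSymm := hZ.add (hP.posSemidef.isSymm.smul t)
  have hquad : ∀ w, w ⬝ᵥ (Z + t • P) *ᵥ w = w ⬝ᵥ Z *ᵥ w + t * (w ⬝ᵥ P *ᵥ w) := fun w => by
    simp [add_mulVec, smul_mulVec, dotProduct_add, dotProduct_smul]
  have hpsd : (Z + t • P).PosSemidef := by
    refine posSemidef_of_isSymm hsymm fun w => ?_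
    rw [hquad, ht, div_mul_eq_mul_div, ← sub_nonneg, sub_zero]
    have := hmin w
    rw [← mul_le_mul_iff_left₀ hPv, zero_mul, add_mul, div_mul_cancel₀ _ hPv.ne']
    linarith
  have hzero : (Z + t • P) *ᵥ v = 0 := by
    refine (hpsd.dotProduct_mulVec_zero_iff v).1 ?_
    rw [star_trivial, hquad, ht, div_mul_cancel₀ _ hPv.ne', add_neg_cancel]
  have h1 := dotProduct_lyapunov (A := A) hsymm v
  rw [hzero, dotProduct_zero, mul_zero] at h1
  have h2 : Aᵀ * (Z + t • P) + (Z + t • P) * A = (Aᵀ * Z + Z * A) + t • (Aᵀ * P + P * A) := by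
    simp only [mul_add, add_mul, Matrix.mul_smul, Matrix.smul_mul, smul_add]
    abel
  rw [h2, add_mulVec, dotProduct_add, smul_mulVec, dotProduct_smul, smul_eq_mul] at h1
  have h3 := hQ.quadratic_nonneg v
  have h4 := mul_pos htpos (hL.quadratic_pos hv)
  linarith

/-- Both Z and -Z are positive semidefinite. The Lyapunov function P takes the place of any
assumption on the eigenvalues of A. -/
theorem eq_zero_of_lyapunov {A P Z : Matrix n n ℝ} (hP : P.PosDef)
    (hL : (Aᵀ * P + P * A).PosDef) (hZ : Z.IsSymm) (hQ : Aᵀ * Z + Z * A = 0) : Z = 0 := by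
  have h1 := posSemidef_of_lyapunov hP hL hZ (by rw [hQ]; exact PosSemidef.zero)
  have h2 := posSemidef_of_lyapunov (Z := -Z) hP hL hZ.neg
    (by rw [mul_neg, neg_mul, ← neg_add, hQ, neg_zero]; exact PosSemidef.zero)
  have h3 : ∀ v : n → ℝ, Z *ᵥ v = 0 := fun v => by
    refine (h1.dotProduct_mulVec_zero_iff v).1 ?_
    have h4 := h1.quadratic_nonneg v
    have h5 := h2.quadratic_nonneg v
    rw [neg_mulVec, dotProduct_neg] at h5
    rw [star_trivial]
    linarith
  classical
  ext i j
  simpa using congrFun (h3 (Pi.single j 1)) i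

/-- The Lyapunov operator `Z ↦ Aᵀ Z + Z A` on symmetric matrices. -/
def lyapunovMap (A : Matrix n n ℝ) : symmMatrices n →ₗ[ℝ] symmMatrices n where
  toFun Z := ⟨Aᵀ * Z + Z * A, by
    rw [mem_symmMatrices, IsSymm, transpose_add, transpose_mul, transpose_mul, transpose_transpose,
      (mem_symmMatrices.1 Z.2).eq, add_comm]⟩
  map_add' Z W := Subtype.ext (by simp only [Submodule.coe_add, mul_add, add_mul]; abel)
  map_smul' c Z := Subtype.ext (by simp [smul_add])

theorem lyapunovMap_injective {A P : Matrix n n ℝ} (hP : P.PosDef)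
    (hL : (Aᵀ * P + P * A).PosDef) : Function.Injective (lyapunovMap A) := by
  rw [injective_iff_map_eq_zero]
  intro Z hZ
  exact Subtype.ext (eq_zero_of_lyapunov hP hL Z.2 (congrArg Subtype.val hZ))

theorem exists_lyapunov {A P Q : Matrix n n ℝ} (hP : P.PosDef)
    (hL : (Aᵀ * P + P * A).PosDef) (hQ : Q.IsSymm) :
    ∃ Z : Matrix n n ℝ, Z.IsSymm ∧ Aᵀ * Z + Z * A = Q := by
  obtain ⟨Z, hZ⟩ := (LinearMap.injective_iff_surjective.1 (lyapunovMap_injective hP hL)) ⟨Q, hQ⟩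
  exact ⟨Z, Z.2, congrArg Subtype.val hZ⟩

end QuadraticForms

/-! ### The algebraic Riccati equation -/

section Riccati

variable {N : ℕ} {B K X : Matrix (Fin N) (Fin N) ℝ}

/-- The Riccati expression `X² - ½ Bᵀ X - ½ X B - K`. -/
noncomputable def riccati (B K X : Matrix (Fin N) (Fin N) ℝ) : Matrix (Fin N) (Fin N) ℝ :=
  X ^ 2 - (1 / 2 : ℝ) • (B.transpose * X) - (1 / 2 : ℝ) • (X * B) - K

/-- The closed loop matrix `X - ½ B`. -/
noncomputable def closedLoop (B X : Matrix (Fin N) (Fin N) ℝ) : Matrix (Fin N) (Fin N) ℝ :=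
  X - (1 / 2 : ℝ) • B

theorem transpose_closedLoop (hX : X.IsSymm) : (closedLoop B X)ᵀ = X - (1 / 2 : ℝ) • Bᵀ := by
  rw [closedLoop, transpose_sub, transpose_smul, hX.eq]

/-- Exact second-order Taylor expansion: the derivative at X is the Lyapunov operator of the closed
loop. Newton's step, maximality and the implicit function argument all rest on it. -/
theorem riccati_add (hX : X.IsSymm) (D : Matrix (Fin N) (Fin N) ℝ) :
    riccati B K (X + D) =
      riccati B K X + ((closedLoop B X)ᵀ * D + D * closedLoop B X) + D * D := by
  rw [transpose_closedLoop hX]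
  simp only [riccati, closedLoop, sq, add_mul, mul_add, sub_mul, mul_sub, smul_mul, Matrix.mul_smul,
    smul_add]
  abel

/-- Shows that X is a Lyapunov function for its own closed loop once K > 0 and the Riccati
expression is nonnegative. -/
theorem lyapunov_closedLoop (hX : X.IsSymm) :
    (closedLoop B X)ᵀ * X + X * closedLoop B X = X * X + K + riccati B K X := by
  rw [transpose_closedLoop hX]
  simp only [riccati, closedLoop, sq, sub_mul, mul_sub, smul_mul, Matrix.mul_smul]
  abel

theorem isSymm_riccati (hK : K.IsSymm) (hX : X.IsSymm) : (riccati B K X).IsSymm := by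
  rw [IsSymm, riccati]
  simp only [sq, transpose_sub, transpose_smul, transpose_mul, transpose_transpose, hX.eq, hK.eq]
  abel

theorem posSemidef_mul_self (hX : X.IsSymm) : (X * X).PosSemidef := by
  have h := posSemidef_conjTranspose_mul_self X
  rwa [conjTranspose_eq_transpose_of_trivial, hX.eq] at h

/-- On a null vector v of X every term containing X drops out, leaving -⟨v, K v⟩ ≥ 0, which
contradicts K > 0. -/
theorem posDef_of_riccati (hK : K.PosDef) (hX : X.PosSemidef) (hF : (riccati B K X).PosSemidef) :
    X.PosDef := by
  refine posDef_of_isSymm hX.isSymm fun v hv => ?_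
  refine lt_of_le_of_ne (hX.quadratic_nonneg v) fun h0 => ?_
  have hXv : X *ᵥ v = 0 := (hX.dotProduct_mulVec_zero_iff v).1 (by rw [star_trivial]; exact h0.symm)
  have h1 := hF.quadratic_nonneg v
  have h2 : v ⬝ᵥ (X * B) *ᵥ v = 0 := by
    rw [← mulVec_mulVec, dotProduct_mulVec, ← mulVec_transpose, hX.isSymm.eq, hXv,
      zero_dotProduct]
  rw [riccati, sub_mulVec, sub_mulVec, sub_mulVec, dotProduct_sub, dotProduct_sub,
    dotProduct_sub, smul_mulVec, smul_mulVec, dotProduct_smul, dotProduct_smul, h2, sq,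
    ← mulVec_mulVec, ← mulVec_mulVec, hXv] at h1
  have h3 := hK.quadratic_pos hv
  simp at h1
  linarith

theorem posDef_lyapunov_closedLoop (hK : K.PosDef) (hX : X.PosSemidef)
    (hF : (riccati B K X).PosSemidef) :
    ((closedLoop B X)ᵀ * X + X * closedLoop B X).PosDef := by
  rw [lyapunov_closedLoop (K := K) hX.isSymm, add_assoc]
  exact PosDef.posSemidef_add (posSemidef_mul_self hX.isSymm) (hK.add_posSemidef hF)

theorem exists_quadraticForm_le (S : Matrix (Fin N) (Fin N) ℝ) :
    ∃ β ≥ 0, ∀ w : Fin N → ℝ, w ⬝ᵥ S *ᵥ w ≤ β * (w ⬝ᵥ w) := by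
  by_cases h : ∃ u : Fin N → ℝ, u ≠ 0
  · obtain ⟨u, hu⟩ := h
    obtain ⟨v, hv, hmin⟩ := exists_min_quadraticForm_ratio (PosDef.one (n := Fin N) (R := ℝ)) (-S) hu
    have hPv : 0 < v ⬝ᵥ v := by simpa using (PosDef.one (n := Fin N) (R := ℝ)).quadratic_pos hv
    refine ⟨max ((v ⬝ᵥ S *ᵥ v) / (v ⬝ᵥ v)) 0, le_max_right _ _, fun w => ?_⟩
    have h1 : 0 ≤ w ⬝ᵥ w := by simpa using dotProduct_star_self_nonneg w
    refine le_trans ?_ (mul_le_mul_of_nonneg_right (le_max_left _ _) h1)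
    have h2 := hmin w
    simp only [neg_mulVec, dotProduct_neg, one_mulVec] at h2
    rw [div_mul_eq_mul_div, le_div_iff₀ hPv]
    linarith
  · push Not at h
    exact ⟨0, le_rfl, fun w => by simp [h w]⟩

theorem exists_scalar_riccati_nonneg (hK : K.IsSymm) :
    ∃ c : ℝ, 0 ≤ c ∧ (riccati B K (c • 1)).PosSemidef := by
  obtain ⟨β, hβ, hB⟩ := exists_quadraticForm_le B
  obtain ⟨k, hk, hKk⟩ := exists_quadraticForm_le K
  -- With c = β + k + 1 one has c² - cβ - k = (β + k + 1)(k + 1) - k ≥ 0.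
  refine ⟨β + k + 1, by positivity, posSemidef_of_isSymm
    (isSymm_riccati hK (isSymm_one.smul _)) fun w => ?_⟩
  have h0 : 0 ≤ w ⬝ᵥ w := by simpa using dotProduct_star_self_nonneg w
  have h1 : w ⬝ᵥ Bᵀ *ᵥ w = w ⬝ᵥ B *ᵥ w := by
    rw [mulVec_transpose, dotProduct_comm, ← dotProduct_mulVec]
  have h2 : w ⬝ᵥ riccati B K ((β + k + 1) • 1) *ᵥ w =
      (β + k + 1) ^ 2 * (w ⬝ᵥ w) - (β + k + 1) * (w ⬝ᵥ B *ᵥ w) - w ⬝ᵥ K *ᵥ w := by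
    simp only [riccati, sq, sub_mulVec, dotProduct_sub, smul_mul, Matrix.mul_smul, smul_mulVec,
      dotProduct_smul, mul_one, one_mul, one_mulVec, h1, smul_eq_mul]
    ring
  rw [h2]
  nlinarith [hB w, hKk w, mul_nonneg hβ h0, mul_nonneg hk h0,
    mul_le_mul_of_nonneg_left (hB w) (show 0 ≤ β + k + 1 by positivity), mul_nonneg hk (mul_nonneg hk h0),
    mul_nonneg hk (mul_nonneg hβ h0)]

/-- Testing on eᵢ ± eⱼ gives |S i j| ≤ ½ (S i i + S j j). Hence a trace bound makes a closed set of
positive semidefinite matrices compact. -/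
theorem abs_apply_le_trace {n : Type*} [Fintype n] {S : Matrix n n ℝ}
    (hS : S.PosSemidef) (i j : n) : |S i j| ≤ S.trace := by
  classical
  have hd : ∀ i, 0 ≤ S i i := fun i => by
    simpa using hS.quadratic_nonneg (Pi.single i 1)
  have htr : ∀ i, S i i ≤ S.trace := fun i =>
    Finset.single_le_sum (f := fun i => S i i) (fun i _ => hd i) (Finset.mem_univ i)
  have hsym : S j i = S i j := hS.isSymm.apply i j
  have h1 := hS.quadratic_nonneg (Pi.single i 1 + Pi.single j 1)
  have h2 := hS.quadratic_nonneg (Pi.single i 1 - Pi.single j 1)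
  simp [mulVec_add, mulVec_sub, add_dotProduct, sub_dotProduct] at h1 h2
  rw [abs_le]
  constructor <;> linarith [htr i, htr j]

/-- Minimise the trace over the X ≥ 0 with nonnegative Riccati expression; the scalar supersolution
shows that the set is nonempty and bounds the trace. A Newton step from the minimiser stays in the
set and does not raise the trace, so it must be trivial. -/
theorem exists_posDef_riccati (hK : K.PosDef) : ∃ X, X.PosDef ∧ riccati B K X = 0 := by
  have hKs := hK.posSemidef.isSymm
  obtain ⟨c, hc, hc2⟩ := exists_scalar_riccati_nonneg (B := B) hKs
  set T : ℝ := (c • (1 : Matrix (Fin N) (Fin N) ℝ)).trace with hT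
  have hcont : ∀ w : Fin N → ℝ, ∀ f : Matrix (Fin N) (Fin N) ℝ → Matrix (Fin N) (Fin N) ℝ,
      Continuous f → Continuous fun X => w ⬝ᵥ f X *ᵥ w := fun w f hf =>
    continuous_const.dotProduct (hf.matrix_mulVec continuous_const)
  have hric : Continuous (riccati B K) := by unfold riccati; fun_prop
  let S : Set (Matrix (Fin N) (Fin N) ℝ) :=
    {X | X.PosSemidef ∧ (riccati B K X).PosSemidef ∧ X.trace ≤ T}
  have hSeq : S = {X | X.IsSymm} ∩ (⋂ w : Fin N → ℝ, {X | 0 ≤ w ⬝ᵥ X *ᵥ w}) ∩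
      (⋂ w : Fin N → ℝ, {X | 0 ≤ w ⬝ᵥ riccati B K X *ᵥ w}) ∩ {X | X.trace ≤ T} := by
    ext X
    simp only [S, Set.mem_ofPred_eq, Set.mem_inter_iff, Set.mem_iInter]
    constructor
    · rintro ⟨h1, h2, h3⟩
      exact ⟨⟨⟨h1.isSymm, h1.quadratic_nonneg⟩, h2.quadratic_nonneg⟩, h3⟩
    · rintro ⟨⟨⟨h0, h1⟩, h2⟩, h3⟩
      exact ⟨posSemidef_of_isSymm h0 h1, posSemidef_of_isSymm (isSymm_riccati hKs h0) h2, h3⟩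
  have hclosed : IsClosed S := by
    rw [hSeq]
    refine ((IsClosed.inter ?_ (isClosed_iInter fun w => ?_)).inter
      (isClosed_iInter fun w => ?_)).inter ?_
    · exact isClosed_eq (continuous_id.matrix_transpose) continuous_id
    · exact isClosed_le continuous_const (hcont w id continuous_id)
    · exact isClosed_le continuous_const (hcont w _ hric)
    · exact isClosed_le (continuous_id.matrix_trace) continuous_const
  have hcomp : IsCompact S := by
    have hbox : IsCompact (Set.univ.pi fun _ : Fin N => Set.univ.pi fun _ : Fin N =>
        Set.Icc (-T) T) :=
      isCompact_univ_pi fun _ => isCompact_univ_pi fun _ => isCompact_Icc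
    refine hbox.of_isClosed_subset hclosed ?_
    rintro X ⟨h1, -, h3⟩ i - j -
    exact abs_le.1 ((abs_apply_le_trace h1 i j).trans h3)
  obtain ⟨X, ⟨hX, hF, hXT⟩, hmin⟩ := hcomp.exists_isMinOn
    ⟨c • 1, (PosSemidef.one).smul hc, hc2, le_rfl⟩
    (f := fun X => X.trace) (continuous_id.matrix_trace).continuousOn
  have hXd := posDef_of_riccati hK hX hF
  have hL := posDef_lyapunov_closedLoop hK hX hF
  -- The Newton correction. It satisfies D ≤ 0, the new Riccati expression is D² ≥ 0, and X + D ≥ 0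
  -- because its Lyapunov image is X² + K.
  obtain ⟨D, hD, hDeq⟩ := exists_lyapunov hXd hL (hF.isSymm.neg)
  have hDneg : (-D).PosSemidef := posSemidef_of_lyapunov hXd hL hD.neg (by
    rw [mul_neg, neg_mul, ← neg_add, hDeq, neg_neg]; exact hF)
  have hnew : (X + D).PosSemidef := posSemidef_of_lyapunov hXd hL (hX.isSymm.add hD) (by
    have : (closedLoop B X)ᵀ * (X + D) + (X + D) * closedLoop B X = X * X + K := by
      rw [mul_add, add_mul, add_add_add_comm, lyapunov_closedLoop (K := K) hX.isSymm, hDeq,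
        add_neg_cancel_right]
    rw [this]
    exact (posSemidef_mul_self hX.isSymm).add hK.posSemidef)
  have hFnew : (riccati B K (X + D)).PosSemidef := by
    rw [riccati_add hX.isSymm, hDeq, add_neg_cancel, zero_add]
    exact posSemidef_mul_self hD
  have htrD : D.trace ≤ 0 := by
    have := hDneg.trace_nonneg
    rw [trace_neg] at this
    linarith
  have h1 : X.trace ≤ (X + D).trace := hmin ⟨hnew, hFnew, by rw [trace_add]; linarith⟩
  rw [trace_add] at h1
  -- Minimality forces tr D = 0, and a positive semidefinite matrix of trace zero vanishes.
  have hD0 : -D = 0 := hDneg.trace_eq_zero_iff.1 (by rw [trace_neg]; linarith)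
  rw [neg_eq_zero] at hD0
  refine ⟨X, hXd, ?_⟩
  rw [hD0, mul_zero, zero_mul, add_zero] at hDeq
  exact neg_eq_zero.1 hDeq.symm

theorem posDef_lyapunov_of_riccati_eq_zero (hK : K.PosDef) (hX : X.PosDef)
    (hF : riccati B K X = 0) : ((closedLoop B X)ᵀ * X + X * closedLoop B X).PosDef :=
  posDef_lyapunov_closedLoop hK hX.posSemidef (by rw [hF]; exact PosSemidef.zero)

/-- Expanding at X, a second solution Y satisfies Aᵀ(X - Y) + (X - Y)A = (X - Y)² ≥ 0, and the
Lyapunov operator reflects positivity. -/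
theorem isMaximalRiccatiSolution_of_posDef (hK : K.PosDef) (hX : X.PosDef)
    (hF : riccati B K X = 0) : IsMaximalRiccatiSolution B K X := by
  refine ⟨⟨hX.posSemidef.isSymm, hF⟩, fun Y ⟨hY, hFY⟩ => ?_⟩
  have hXs := hX.posSemidef.isSymm
  refine posSemidef_of_lyapunov hX (posDef_lyapunov_of_riccati_eq_zero hK hX hF) (hXs.sub hY) ?_
  have h := riccati_add (B := B) (K := K) hXs (Y - X)
  rw [add_sub_cancel, hF, zero_add, show riccati B K Y = 0 from hFY] at h
  have h2 : (closedLoop B X)ᵀ * (X - Y) + (X - Y) * closedLoop B X = (X - Y) * (X - Y) := by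
    rw [← neg_sub Y X, mul_neg, neg_mul, ← neg_add, neg_mul_neg]
    exact (eq_neg_of_add_eq_zero_right h.symm).symm
  rw [h2]
  exact posSemidef_mul_self (hXs.sub hY)

/-- Both are maximal, so X - Y and Y - X are positive semidefinite. -/
theorem eq_of_posDef_riccati {Y : Matrix (Fin N) (Fin N) ℝ} (hK : K.PosDef) (hX : X.PosDef)
    (hF : riccati B K X = 0) (hY : Y.PosDef) (hFY : riccati B K Y = 0) : X = Y := by
  have h1 := (isMaximalRiccatiSolution_of_posDef hK hX hF).2 Y ⟨hY.posSemidef.isSymm, hFY⟩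
  have h2 := (isMaximalRiccatiSolution_of_posDef hK hY hFY).2 X ⟨hX.posSemidef.isSymm, hF⟩
  have h3 := h1.trace_nonneg
  have h4 := h2.trace_nonneg
  rw [trace_sub] at h3 h4
  exact sub_eq_zero.1 (h1.trace_eq_zero_iff.1 (by rw [trace_sub]; linarith))

/-- The traces of the positive definite solutions for the drifts `B` and `-B`. -/
theorem trace_riccati_neg {Y : Matrix (Fin N) (Fin N) ℝ} (hX : X.PosDef)
    (hF : riccati B K X = 0) (hY : Y.PosDef) (hFY : riccati (-B) K Y = 0) :
    Y.trace + B.trace = X.trace := by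
  have hXs := hX.posSemidef.isSymm
  have hD : (X + Y).PosDef := hX.add hY
  have hu : IsUnit (X + Y).det := (isUnit_iff_isUnit_det _).1 hD.isUnit
  -- The difference of the two Riccati equations factors as an intertwining relation. Since X + Y is
  -- invertible, the two closed loops have equal traces.
  have h1 : (closedLoop B X)ᵀ * (X + Y) = (X + Y) * closedLoop (-B) Y := by
    rw [transpose_closedLoop hXs, ← sub_eq_zero]
    have : riccati B K X - riccati (-B) K Y = 0 := by rw [hF, hFY, sub_zero]
    rw [← this]
    simp only [riccati, closedLoop, sq, sub_mul, mul_sub, smul_mul, Matrix.mul_smul, mul_add, add_mul,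
      transpose_neg, neg_mul, mul_neg, smul_neg]
    abel
  have h2 : (closedLoop B X).trace = (closedLoop (-B) Y).trace := by
    rw [← trace_transpose, ← mul_one (closedLoop B X)ᵀ, ← mul_nonsing_inv _ hu, ← mul_assoc, h1,
      trace_mul_comm, ← mul_assoc, nonsing_inv_mul _ hu, one_mul]
  simp only [closedLoop, trace_sub, trace_smul, trace_neg, smul_eq_mul] at h2
  linarith

end Riccati

/-! ### Eigenvalues of matrices with a Lyapunov function -/

section Spectrum

variable {n : Type*} [Fintype n] [DecidableEq n]

/-- Split an eigenvector as a + ib and add the Lyapunov identities at a and b: the Im z terms cancel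
by symmetry of P, leaving Re z times a positive number. -/
theorem re_pos_of_lyapunov {A P : Matrix n n ℝ} (hP : P.PosDef) (hL : (Aᵀ * P + P * A).PosDef)
    {z : ℂ} (hz : (A.map Complex.ofReal).charpoly.IsRoot z) : 0 < z.re := by
  rw [Polynomial.IsRoot.def, eval_charpoly] at hz
  obtain ⟨v, hv, hv0⟩ := exists_mulVec_eq_zero_iff.2 hz
  have hPs := hP.posSemidef.isSymm
  set a : n → ℝ := fun i => (v i).re
  set b : n → ℝ := fun i => (v i).im
  have hAv : ∀ i, ∑ j, (A i j : ℂ) * v j = z * v i := fun i => by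
    have := congrFun hv0 i
    rw [sub_mulVec, Pi.sub_apply, Pi.zero_apply, sub_eq_zero, scalar_apply, mulVec_diagonal] at this
    simpa [mulVec, dotProduct] using this.symm
  have ha : A *ᵥ a = z.re • a - z.im • b := by
    ext i
    simpa [mulVec, dotProduct, a, b] using congrArg Complex.re (hAv i)
  have hb : A *ᵥ b = z.re • b + z.im • a := by
    ext i
    simpa [mulVec, dotProduct, a, b] using congrArg Complex.im (hAv i)
  have hab : a ≠ 0 ∨ b ≠ 0 := by
    by_contra! h
    refine hv (funext fun i => Complex.ext ?_ ?_)
    · exact congrFun h.1 i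
    · exact congrFun h.2 i
  have hcomm : a ⬝ᵥ P *ᵥ b = b ⬝ᵥ P *ᵥ a := by
    rw [dotProduct_mulVec, ← mulVec_transpose, hPs.eq, dotProduct_comm]
  have h1 := dotProduct_lyapunov (A := A) hPs a
  have h2 := dotProduct_lyapunov (A := A) hPs b
  rw [ha, sub_dotProduct, smul_dotProduct, smul_dotProduct, smul_eq_mul, smul_eq_mul] at h1
  rw [hb, add_dotProduct, smul_dotProduct, smul_dotProduct, smul_eq_mul, smul_eq_mul, hcomm] at h2
  have h3 : 0 < z.re * (a ⬝ᵥ P *ᵥ a + b ⬝ᵥ P *ᵥ b) := by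
    rcases hab with h | h
    · have := hL.quadratic_pos h
      have := hL.posSemidef.quadratic_nonneg b
      linarith
    · have := hL.quadratic_pos h
      have := hL.posSemidef.quadratic_nonneg a
      linarith
  have h4 := hP.posSemidef.quadratic_nonneg a
  have h5 := hP.posSemidef.quadratic_nonneg b
  exact pos_of_mul_pos_left h3 (add_nonneg h4 h5)

/-- When no root crosses the imaginary axis the absolute values have one sign, and the roots sum to
the trace. -/
theorem sum_abs_re_roots_of_re_nonneg {A : Matrix n n ℝ}
    (h : ∀ z, (A.map Complex.ofReal).charpoly.IsRoot z → 0 ≤ z.re) :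
    ((A.map Complex.ofReal).charpoly.roots.map fun z => |z.re|).sum = A.trace := by
  have h1 : ((A.map Complex.ofReal).charpoly.roots.map fun z => |z.re|) =
      (A.map Complex.ofReal).charpoly.roots.map Complex.reAddGroupHom :=
    Multiset.map_congr rfl fun z hz => abs_of_nonneg (h z (Polynomial.isRoot_of_mem_roots hz))
  rw [h1, ← map_multiset_sum, ← trace_eq_sum_roots_charpoly]
  simp [trace]

theorem sum_abs_re_roots_of_re_nonpos {A : Matrix n n ℝ}
    (h : ∀ z, (A.map Complex.ofReal).charpoly.IsRoot z → z.re ≤ 0) :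
    ((A.map Complex.ofReal).charpoly.roots.map fun z => |z.re|).sum = -A.trace := by
  have h1 : ((A.map Complex.ofReal).charpoly.roots.map fun z => |z.re|) =
      (A.map Complex.ofReal).charpoly.roots.map (-Complex.reAddGroupHom) :=
    Multiset.map_congr rfl fun z hz => abs_of_nonpos (h z (Polynomial.isRoot_of_mem_roots hz))
  rw [h1, ← map_multiset_sum, ← trace_eq_sum_roots_charpoly]
  simp [trace]

theorem isRoot_charpoly_neg_transpose {A : Matrix n n ℝ} {z : ℂ}
    (h : ((-Aᵀ).map Complex.ofReal).charpoly.IsRoot z) :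
    (A.map Complex.ofReal).charpoly.IsRoot (-z) := by
  have e : (-Aᵀ).map Complex.ofReal = (-(A.map Complex.ofReal))ᵀ := by ext; simp
  rw [e, charpoly_transpose] at h
  rw [Polynomial.IsRoot.def, eval_charpoly] at h ⊢
  have e2 : scalar n (-z) - A.map Complex.ofReal = -(scalar n z - -(A.map Complex.ofReal)) := by
    rw [map_neg]; abel
  rw [e2, det_neg, h, mul_zero]

end Spectrum

/-! ### The Hamiltonian matrix -/

section Hamiltonian

variable {N : ℕ} {B K X : Matrix (Fin N) (Fin N) ℝ}

/-- The Riccati equation says that the graph {(v, X v)} is invariant. Conjugation by the shear with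
lower-left block X makes the matrix block upper triangular. -/
theorem charpoly_hamiltonianMatrix (hX : X.IsSymm) (hF : riccati B K X = 0) :
    (hamiltonianMatrix B K).charpoly =
      (closedLoop B X).charpoly * (-(closedLoop B X)ᵀ).charpoly := by
  have h1 : fromBlocks (1 : Matrix (Fin N) (Fin N) ℝ) 0 X 1 * fromBlocks 1 0 (-X) 1 =
      (1 : Matrix (Fin N ⊕ Fin N) (Fin N ⊕ Fin N) ℝ) := by
    rw [fromBlocks_multiply, ← fromBlocks_one]
    simp
  have h2 : fromBlocks (1 : Matrix (Fin N) (Fin N) ℝ) 0 (-X) 1 * fromBlocks 1 0 X 1 =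
      (1 : Matrix (Fin N ⊕ Fin N) (Fin N ⊕ Fin N) ℝ) := by
    rw [fromBlocks_multiply, ← fromBlocks_one]
    simp
  let U : (Matrix (Fin N ⊕ Fin N) (Fin N ⊕ Fin N) ℝ)ˣ := ⟨_, _, h1, h2⟩
  have hconj : hamiltonianMatrix B K =
      U * fromBlocks (closedLoop B X) 1 0 (-(closedLoop B X)ᵀ) * (U⁻¹ : _ˣ).1 := by
    change hamiltonianMatrix B K = fromBlocks 1 0 X 1 *
      fromBlocks (closedLoop B X) 1 0 (-(closedLoop B X)ᵀ) * fromBlocks 1 0 (-X) 1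
    rw [fromBlocks_multiply, fromBlocks_multiply, transpose_closedLoop hX, hamiltonianMatrix]
    have hK : K = X * X - (1 / 2 : ℝ) • (Bᵀ * X) - (1 / 2 : ℝ) • (X * B) := by
      rw [riccati, sub_eq_zero, sq] at hF
      exact hF.symm
    congr 1
    · simp only [closedLoop, Matrix.one_mul, zero_mul, add_zero, mul_one, Matrix.mul_neg]
      abel
    · simp
    · rw [hK]
      simp only [closedLoop, mul_sub, Matrix.mul_smul, one_mul, mul_zero, add_zero, mul_one,
        mul_neg, neg_sub, add_mul, sub_mul, smul_mul]
      abel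
    · simp
  rw [hconj, coe_units_inv, charpoly_units_conj, charpoly_fromBlocks_zero₂₁]

/-- The blocks A and -Aᵀ have spectra in opposite open half-planes, so the sum is 2 tr A = 2 tr X -
tr B. -/
theorem sumAbsReEigenvalues_hamiltonianMatrix (hK : K.PosDef) (hX : X.PosDef)
    (hF : riccati B K X = 0) :
    X.trace = (1 / 2) * (B.trace + sumAbsReEigenvalues (hamiltonianMatrix B K)) := by
  have hL := posDef_lyapunov_of_riccati_eq_zero hK hX hF
  have h1 : ((hamiltonianMatrix B K).map Complex.ofReal).charpoly =
      ((closedLoop B X).map Complex.ofReal).charpoly *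
        ((-(closedLoop B X)ᵀ).map Complex.ofReal).charpoly := by
    have e : ∀ {m : Type} [Fintype m] [DecidableEq m] (A : Matrix m m ℝ),
        (A.map Complex.ofReal).charpoly = A.charpoly.map Complex.ofRealHom := fun A =>
      charpoly_map A Complex.ofRealHom
    rw [e, e, e, charpoly_hamiltonianMatrix hX.posSemidef.isSymm hF, Polynomial.map_mul]
  have h2 : sumAbsReEigenvalues (hamiltonianMatrix B K) =
      (closedLoop B X).trace + -(-(closedLoop B X)ᵀ).trace := by
    rw [sumAbsReEigenvalues, h1, Polynomial.roots_mul
      (mul_ne_zero (charpoly_monic _).ne_zero (charpoly_monic _).ne_zero), Multiset.map_add,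
      Multiset.sum_add, sum_abs_re_roots_of_re_nonneg fun z hz => (re_pos_of_lyapunov hX hL hz).le,
      sum_abs_re_roots_of_re_nonpos fun z hz => ?_]
    have := re_pos_of_lyapunov hX hL (isRoot_charpoly_neg_transpose hz)
    rw [Complex.neg_re] at this
    linarith
  rw [h2, trace_neg, trace_transpose, closedLoop, trace_sub, trace_smul, smul_eq_mul]
  ring

end Hamiltonian

/-! ### Analytic dependence on the parameter -/

section Analyticity

attribute [local instance] Matrix.linftyOpNormedRing Matrix.linftyOpNormedAlgebra

variable {N : ℕ}

/-- The projection of a square matrix onto its symmetric part. -/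
noncomputable def symmPart (N : ℕ) :
    Matrix (Fin N) (Fin N) ℝ →L[ℝ] symmMatrices (Fin N) :=
  LinearMap.toContinuousLinearMap
    { toFun Z := ⟨(1 / 2 : ℝ) • (Z + Zᵀ), by
        rw [mem_symmMatrices, IsSymm, transpose_smul, transpose_add, transpose_transpose, add_comm]⟩
      map_add' Z W := Subtype.ext (by
        simp only [Submodule.coe_add, transpose_add, smul_add]; abel)
      map_smul' c Z := Subtype.ext (by
        simp only [Submodule.coe_smul, RingHom.id_apply, transpose_smul, ← smul_add]
        rw [smul_comm]) }

theorem coe_symmPart {Z : Matrix (Fin N) (Fin N) ℝ} (hZ : Z.IsSymm) :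
    (symmPart N Z : Matrix (Fin N) (Fin N) ℝ) = Z := by
  change (1 / 2 : ℝ) • (Z + Zᵀ) = Z
  rw [hZ.eq, ← two_smul ℝ, smul_smul]
  norm_num

theorem isSymm_matK {H : Matrix (Fin N) (Fin N) ℝ} (hH : H.IsSymm)
    (M : Matrix (Fin N) (Fin N) ℝ) (α : ℝ) : (matK H M α).IsSymm := by
  rw [IsSymm, matK]
  simp only [sq, transpose_add, transpose_sub, transpose_smul, transpose_mul, transpose_transpose,
    hH.eq]
  rw [add_comm (H * M)]

/-- Coercivity of X absorbs a small symmetric perturbation. An entrywise error below c/(N + 1) costs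
at most cN/(N + 1) < c in the form, and N + 1 avoids a division by zero. -/
theorem eventually_posDef {X : Matrix (Fin N) (Fin N) ℝ} (hX : X.PosDef) :
    ∀ᶠ Z in 𝓝 X, Z.IsSymm → Z.PosDef := by
  obtain ⟨c, hc, hcX⟩ := (PosDef.one (n := Fin N) (R := ℝ)).exists_coercive hX
  have hev : ∀ᶠ Z in 𝓝 X, ∀ i j, |Z i j - X i j| < c / (N + 1) := by
    refine eventually_all.2 fun i => eventually_all.2 fun j => ?_
    have hcont : Continuous fun Z : Matrix (Fin N) (Fin N) ℝ => |Z i j - X i j| :=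
      ((continuous_id.matrix_elem i j).sub continuous_const).abs
    have := hcont.tendsto X
    simp only [sub_self, abs_zero] at this
    exact this.eventually_lt_const (by positivity)
  filter_upwards [hev] with Z hZ hZs
  refine posDef_of_isSymm hZs fun w hw => ?_
  have h0 : 0 < w ⬝ᵥ w := by simpa using (PosDef.one (n := Fin N) (R := ℝ)).quadratic_pos hw
  have h1 := hcX w
  rw [one_mulVec] at h1
  have h2 : w ⬝ᵥ (X - Z) *ᵥ w ≤ c / (N + 1) * (N * (w ⬝ᵥ w)) := by
    calc w ⬝ᵥ (X - Z) *ᵥ w = ∑ i, ∑ j, w i * ((X i j - Z i j) * w j) := by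
          simp [dotProduct, mulVec, Finset.mul_sum]
      _ ≤ ∑ i, ∑ j, c / (N + 1) * ((w i * w i + w j * w j) / 2) := by
          refine Finset.sum_le_sum fun i _ => Finset.sum_le_sum fun j _ => ?_
          have h3 := (hZ i j).le
          rw [abs_sub_comm] at h3
          calc w i * ((X i j - Z i j) * w j) ≤ |w i * ((X i j - Z i j) * w j)| := le_abs_self _
            _ = |X i j - Z i j| * (|w i| * |w j|) := by rw [abs_mul, abs_mul]; ring
            _ ≤ _ := by
              gcongr
              nlinarith [sq_nonneg (|w i| - |w j|), abs_mul_abs_self (w i), abs_mul_abs_self (w j)]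
      _ = _ := by
          simp only [← Finset.mul_sum, ← Finset.sum_div, Finset.sum_add_distrib, Finset.sum_const,
            Finset.card_univ, Fintype.card_fin, nsmul_eq_mul, dotProduct]
          simp only [mul_left_comm (w _) (N : ℝ), ← Finset.mul_sum]
          ring
  rw [sub_mulVec, dotProduct_sub] at h2
  have h4 : c / (N + 1) * (N * (w ⬝ᵥ w)) < c * (w ⬝ᵥ w) := by
    rw [← mul_assoc]
    refine mul_lt_mul_of_pos_right ?_ h0
    rw [div_mul_eq_mul_div, div_lt_iff₀ (by positivity)]
    nlinarith
  linarith

/-- The positive definite solution of the Riccati equation depends analytically on `α`. -/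
theorem analyticAt_trace_riccati {H M : Matrix (Fin N) (Fin N) ℝ} (hH : H.IsSymm)
    {X : ℝ → Matrix (Fin N) (Fin N) ℝ} {α₀ : ℝ} (hK : ∀ᶠ α in 𝓝 α₀, (matK H M α).PosDef)
    (hX : ∀ᶠ α in 𝓝 α₀, (X α).PosDef ∧ riccati (matB M α) (matK H M α) (X α) = 0) :
    AnalyticAt ℝ (fun α => (X α).trace) α₀ := by
  obtain ⟨hX₀, hF₀⟩ := hX.self_of_nhds
  have hK₀ := hK.self_of_nhds
  set E := symmMatrices (Fin N)
  let x₀ : E := ⟨X α₀, hX₀.posSemidef.isSymm⟩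
  -- Working inside the symmetric matrices makes the partial derivative injective. The
  -- symmetrisation changes no value and only provides the codomain.
  let F : ℝ × E → E := fun p => symmPart N (riccati (matB M p.1) (matK H M p.1) p.2)
  -- In `WithTop ℕ∞` the order `⊤` means analytic, so the local inverse below is analytic too.
  have hF : ContDiff ℝ ⊤ F := by
    refine (symmPart N).contDiff.comp ?_
    have h2 : ContDiff ℝ ⊤ fun p : ℝ × E => (p.2 : Matrix (Fin N) (Fin N) ℝ) :=
      E.subtypeL.contDiff.comp contDiff_snd
    have h1 : ContDiff ℝ ⊤ fun p : ℝ × E => p.1 := contDiff_fst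
    have hB : ContDiff ℝ ⊤ fun p : ℝ × E => matB M p.1 := by unfold matB; fun_prop
    have hBt : ContDiff ℝ ⊤ fun p : ℝ × E => (matB M p.1)ᵀ := by
      unfold matB; simp only [transpose_smul]; fun_prop
    have hKc : ContDiff ℝ ⊤ fun p : ℝ × E => matK H M p.1 := by unfold matK; fun_prop
    unfold riccati
    exact (((h2.pow 2).sub ((hBt.mul h2).const_smul _)).sub ((h2.mul hB).const_smul _)).sub hKc
  have hFeq : ∀ p : ℝ × E, (F p : Matrix (Fin N) (Fin N) ℝ) =
      riccati (matB M p.1) (matK H M p.1) p.2 := fun p =>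
    coe_symmPart (isSymm_riccati (isSymm_matK hH M p.1) p.2.2)
  have hF' : HasFDerivAt F (fderiv ℝ F (α₀, x₀)) (α₀, x₀) :=
    (hF.differentiable (by simp)).differentiableAt.hasFDerivAt
  -- Along the line x₀ + tW the expansion of F is exactly t L W + t² W², so its derivative at 0 is
  -- the Lyapunov operator.
  have hpart : ∀ W : E, fderiv ℝ F (α₀, x₀) (0, W) =
      lyapunovMap (closedLoop (matB M α₀) (X α₀)) W := by
    intro W
    set L := lyapunovMap (closedLoop (matB M α₀) (X α₀))
    have hline : HasDerivAt (fun t : ℝ => ((α₀, x₀ + t • W) : ℝ × E)) (0, W) 0 := by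
      refine (hasDerivAt_const _ _).prodMk ?_
      simpa using ((hasDerivAt_id (0 : ℝ)).smul_const W).const_add x₀
    have h1 : HasDerivAt (fun t : ℝ => F (α₀, x₀ + t • W)) (fderiv ℝ F (α₀, x₀) (0, W)) 0 := by
      refine HasFDerivAt.comp_hasDerivAt (x := (0 : ℝ)) (l := F) ?_ hline
      have h0 : ((α₀, x₀ + (0 : ℝ) • W) : ℝ × E) = (α₀, x₀) := by simp
      rw [h0]
      exact hF'
    have h2 : (fun t : ℝ => F (α₀, x₀ + t • W)) = fun t : ℝ =>
        t • L W + (t ^ 2) • (symmPart N (W * W : Matrix (Fin N) (Fin N) ℝ)) := by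
      funext t
      have hWW : ((W : Matrix (Fin N) (Fin N) ℝ) * W).IsSymm := by
        rw [IsSymm, transpose_mul, (mem_symmMatrices.1 W.2).eq]
      refine Subtype.ext ?_
      rw [hFeq, Submodule.coe_add, Submodule.coe_add, Submodule.coe_smul, Submodule.coe_smul,
        Submodule.coe_smul, coe_symmPart hWW]
      rw [riccati_add hX₀.posSemidef.isSymm, hF₀, zero_add]
      change _ = t • (_ᵀ * (W : Matrix (Fin N) (Fin N) ℝ) + (W : Matrix (Fin N) (Fin N) ℝ) * _) + _
      rw [Matrix.mul_smul, Matrix.smul_mul, Matrix.smul_mul, Matrix.mul_smul, smul_smul, smul_add,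
        sq]
    rw [h2] at h1
    refine h1.unique ?_
    have h3 := ((hasDerivAt_id (0 : ℝ)).smul_const (L W)).add
      ((hasDerivAt_pow 2 (0 : ℝ)).smul_const (symmPart N (W * W : Matrix (Fin N) (Fin N) ℝ)))
    exact h3.congr_deriv (by simp)
  -- Implicit function theorem by way of the inverse function theorem: the local inverse of Φ along
  -- (α, 0) is an analytic branch of solutions.
  let Φ : ℝ × E → ℝ × E := fun p => (p.1, F p)
  have hΦ : ContDiff ℝ ⊤ Φ := contDiff_fst.prodMk hF
  let Φ' : (ℝ × E) →L[ℝ] (ℝ × E) := (ContinuousLinearMap.fst ℝ ℝ E).prod (fderiv ℝ F (α₀, x₀))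
  have hinj : Function.Injective Φ' := by
    rw [injective_iff_map_eq_zero]
    rintro ⟨s, W⟩ h
    have hs : s = 0 := congrArg Prod.fst h
    subst hs
    have hW : fderiv ℝ F (α₀, x₀) (0, W) = 0 := congrArg Prod.snd h
    rw [hpart] at hW
    have := lyapunovMap_injective hX₀ (posDef_lyapunov_of_riccati_eq_zero hK₀ hX₀ hF₀)
      (hW.trans (map_zero _).symm)
    rw [this]
    rfl
  let e : (ℝ × E) ≃L[ℝ] (ℝ × E) :=
    (LinearEquiv.ofInjectiveEndo (Φ' : (ℝ × E) →ₗ[ℝ] (ℝ × E)) hinj).toContinuousLinearEquiv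
  have he : (e : (ℝ × E) →L[ℝ] (ℝ × E)) = Φ' := by
    ext x <;> rfl
  have hΦ' : HasFDerivAt Φ (e : (ℝ × E) →L[ℝ] (ℝ × E)) (α₀, x₀) := by
    rw [he]
    exact hasFDerivAt_fst.prodMk hF'
  have hn : (⊤ : WithTop ℕ∞) ≠ 0 := by simp
  have hΦa : ContDiffAt ℝ ⊤ Φ (α₀, x₀) := hΦ.contDiffAt
  set g := hΦa.localInverse hΦ' hn with hg
  have hΦ₀ : Φ (α₀, x₀) = (α₀, 0) := Prod.ext rfl (Subtype.ext (by rw [hFeq]; exact hF₀))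
  have hgc : ContDiffAt ℝ ⊤ g (α₀, 0) := by
    rw [← hΦ₀]
    exact hΦa.to_localInverse hΦ' hn
  have hg₀ : g (α₀, 0) = (α₀, x₀) := by
    rw [← hΦ₀]
    exact hΦa.localInverse_apply_image hΦ' hn
  have hright : ∀ᶠ y in 𝓝 (α₀, (0 : E)), Φ (g y) = y := by
    rw [← hΦ₀]
    exact (hΦa.hasStrictFDerivAt' hΦ' hn).eventually_right_inverse
  have hpath : ContDiff ℝ ⊤ fun α : ℝ => (α, (0 : E)) := contDiff_id.prodMk contDiff_const
  have hZ : ContDiffAt ℝ ⊤ (fun α : ℝ => (g (α, 0)).2) α₀ :=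
    (hgc.comp α₀ hpath.contDiffAt).snd
  have htrace : ContDiffAt ℝ ⊤ (fun α : ℝ => ((g (α, 0)).2 : Matrix (Fin N) (Fin N) ℝ).trace) α₀ :=
    (LinearMap.toContinuousLinearMap
      ((traceLinearMap (Fin N) ℝ ℝ).comp E.subtype)).contDiff.contDiffAt.comp α₀ hZ
  refine htrace.analyticAt.congr ?_
  -- No continuity of X is assumed. The branch stays positive definite near α₀, and uniqueness then
  -- identifies it with X.
  have hpd : ∀ᶠ α in 𝓝 α₀, ((g (α, 0)).2 : Matrix (Fin N) (Fin N) ℝ).PosDef := by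
    have h1 : Tendsto (fun α : ℝ => ((g (α, 0)).2 : Matrix (Fin N) (Fin N) ℝ)) (𝓝 α₀)
        (𝓝 (X α₀)) := by
      have := (continuous_subtype_val.continuousAt.comp hZ.continuousAt).tendsto
      rw [Function.comp_apply, hg₀] at this
      exact this
    filter_upwards [h1.eventually (eventually_posDef hX₀)] with α hα
    exact hα (g (α, 0)).2.2
  filter_upwards [hpd, hX, hK, hpath.continuous.continuousAt.tendsto.eventually hright]
    with α h1 h2 h3 h4
  have h5 : (g (α, 0)).1 = α := congrArg Prod.fst h4
  have h6 : riccati (matB M α) (matK H M α) (g (α, 0)).2 = 0 := by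
    have h7 : (F (g (α, 0)) : Matrix (Fin N) (Fin N) ℝ) = 0 :=
      congrArg (fun p : ℝ × E => (p.2 : Matrix (Fin N) (Fin N) ℝ)) h4
    rw [hFeq, h5] at h7
    exact h7
  rw [eq_of_posDef_riccati h3 h1 h6 h2.1 h2.2]

end Analyticity

/-! ### Schwartz functions of exponential type -/

section Gaussian

variable {E : Type*} [NormedAddCommGroup E] [NormedSpace ℝ E]

/-- Apply yᵐ/m! ≤ eʸ at y = c(1 + r), then use r ≤ 1 + r². -/
theorem one_add_pow_le_exp_sq {c : ℝ} (hc : 0 < c) (m : ℕ) {r : ℝ} (hr : 0 ≤ r) :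
    (1 + r) ^ m ≤ (m.factorial / c ^ m * Real.exp (2 * c)) * Real.exp (c * r ^ 2) := by
  have h1 := Real.pow_div_factorial_le_exp (c * (1 + r)) (by positivity) m
  have h2 : Real.exp (c * (1 + r)) ≤ Real.exp (2 * c) * Real.exp (c * r ^ 2) := by
    rw [← Real.exp_add]
    refine Real.exp_le_exp.2 ?_
    nlinarith [mul_nonneg hc.le (sq_nonneg (r - 1)), mul_nonneg hc.le hr, mul_nonneg hc.le (sq_nonneg r)]
  have h3 : (c * (1 + r)) ^ m ≤ Real.exp (2 * c) * Real.exp (c * r ^ 2) * m.factorial :=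
    (div_le_iff₀ (by positivity)).1 (h1.trans h2)
  rw [mul_pow] at h3
  calc (1 + r) ^ m = (c ^ m * (1 + r) ^ m) / c ^ m := by field_simp
    _ ≤ (Real.exp (2 * c) * Real.exp (c * r ^ 2) * m.factorial) / c ^ m := by gcongr
    _ = _ := by ring

/-- The exponential of a function of temperate growth which is bounded above by a negative
quadratic is a Schwartz function. -/
theorem exists_schwartz_exp {f : E → ℝ} (hf : f.HasTemperateGrowth) {c C₀ : ℝ} (hc : 0 < c)
    (hle : ∀ x, f x ≤ C₀ - c * ‖x‖ ^ 2) :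
    ∃ γ : 𝓢(E, ℂ), ∀ x, γ x = Real.exp (f x) := by
  have hsmooth : ContDiff ℝ (⊤ : ℕ∞) (Real.exp ∘ f) := Real.contDiff_exp.comp hf.1
  have hdecay : ∀ k n : ℕ, ∃ C : ℝ, ∀ x, ‖x‖ ^ k * ‖iteratedFDeriv ℝ n (Real.exp ∘ f) x‖ ≤ C := by
    intro k n
    obtain ⟨m, C, hC, hbound⟩ := hf.norm_iteratedFDeriv_le_uniform n
    refine ⟨n.factorial * Real.exp C₀ * (1 + C) ^ n *
      ((k + m * n).factorial / c ^ (k + m * n) * Real.exp (2 * c)), fun x => ?_⟩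
    have hx : 0 ≤ ‖x‖ := norm_nonneg x
    -- The constant 1 + C, rather than C, makes the base at least 1, so that it is bounded by its
    -- i-th power in the estimate for derivatives of a composition.
    have hD1 : 1 ≤ (1 + C) * (1 + ‖x‖) ^ m :=
      one_le_mul_of_one_le_of_one_le (by linarith) (one_le_pow₀ (by linarith))
    have h1 : ‖iteratedFDeriv ℝ n (Real.exp ∘ f) x‖ ≤
        n.factorial * Real.exp (f x) * ((1 + C) * (1 + ‖x‖) ^ m) ^ n := by
      refine norm_iteratedFDeriv_comp_le (N := (⊤ : ℕ∞)) Real.contDiff_exp hf.1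
        (by exact_mod_cast le_top) x (fun i _ => ?_) (fun i hi hin => ?_)
      · rw [norm_iteratedFDeriv_eq_norm_iteratedDeriv, iteratedDeriv_eq_iterate,
          Real.iter_deriv_exp, Real.norm_eq_abs, Real.abs_exp]
      · calc ‖iteratedFDeriv ℝ i f x‖ ≤ C * (1 + ‖x‖) ^ m := hbound i hin x
          _ ≤ (1 + C) * (1 + ‖x‖) ^ m := by gcongr; linarith
          _ ≤ _ := le_self_pow₀ hD1 (by omega)
    have h2 : ‖x‖ ^ k ≤ (1 + ‖x‖) ^ k := by gcongr; linarith
    have h3 : Real.exp (f x) ≤ Real.exp C₀ * Real.exp (-(c * ‖x‖ ^ 2)) := by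
      rw [← Real.exp_add]
      exact Real.exp_le_exp.2 (by linarith [hle x])
    have h4 := one_add_pow_le_exp_sq hc (k + m * n) hx
    calc ‖x‖ ^ k * ‖iteratedFDeriv ℝ n (Real.exp ∘ f) x‖
        ≤ (1 + ‖x‖) ^ k * (n.factorial * (Real.exp C₀ * Real.exp (-(c * ‖x‖ ^ 2))) *
          ((1 + C) * (1 + ‖x‖) ^ m) ^ n) := by
          refine mul_le_mul h2 (h1.trans ?_) (norm_nonneg _) (by positivity)
          gcongr
      _ = n.factorial * Real.exp C₀ * (1 + C) ^ n * Real.exp (-(c * ‖x‖ ^ 2)) *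
          (1 + ‖x‖) ^ (k + m * n) := by rw [mul_pow, ← pow_mul, pow_add]; ring
      _ ≤ n.factorial * Real.exp C₀ * (1 + C) ^ n * Real.exp (-(c * ‖x‖ ^ 2)) *
          (((k + m * n).factorial / c ^ (k + m * n) * Real.exp (2 * c)) *
            Real.exp (c * ‖x‖ ^ 2)) := by gcongr
      _ = _ := by
          have : Real.exp (-(c * ‖x‖ ^ 2)) * Real.exp (c * ‖x‖ ^ 2) = 1 := by
            rw [← Real.exp_add]; simp
          linear_combination (n.factorial * Real.exp C₀ * (1 + C) ^ n *
            ((k + m * n).factorial / c ^ (k + m * n) * Real.exp (2 * c))) * this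
  let g : 𝓢(E, ℝ) := ⟨Real.exp ∘ f, hsmooth, hdecay⟩
  exact ⟨g.postcompCLM (𝕜 := ℝ) Complex.ofRealCLM, fun x => rfl⟩

end Gaussian

/-! ### Coordinates, temperate growth and Gaussians -/

section Coordinates

variable {N : ℕ}

theorem linearField_apply (A : Matrix (Fin N) (Fin N) ℝ) (x : Euc N) (i : Fin N) :
    linearField A x i = ∑ j, A i j * x j := by
  simp [linearField, Matrix.toLpLin_apply, mulVec, dotProduct]

theorem quadForm_eq (A : Matrix (Fin N) (Fin N) ℝ) (x : Euc N) :
    quadForm A x = ∑ i, ∑ j, A i j * x i * x j := by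
  simp only [quadForm, PiLp.inner_apply, linearField_apply, RCLike.inner_apply, conj_trivial,
    Finset.sum_mul]
  exact Finset.sum_congr rfl fun i _ => Finset.sum_congr rfl fun j _ => by ring

theorem quadForm_eq_dotProduct (A : Matrix (Fin N) (Fin N) ℝ) (x : Euc N) :
    quadForm A x = x.ofLp ⬝ᵥ A *ᵥ x.ofLp := by
  rw [quadForm_eq]
  simp only [dotProduct, mulVec, Finset.mul_sum]
  exact Finset.sum_congr rfl fun i _ => Finset.sum_congr rfl fun j _ => by ring

theorem norm_sq_eq_dotProduct (x : Euc N) : ‖x‖ ^ 2 = x.ofLp ⬝ᵥ x.ofLp := by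
  rw [EuclideanSpace.norm_sq_eq]
  simp [dotProduct, sq]

theorem hasTemperateGrowth_coord (i : Fin N) : (fun x : Euc N => x i).HasTemperateGrowth :=
  (EuclideanSpace.proj (𝕜 := ℝ) i : Euc N →L[ℝ] ℝ).hasTemperateGrowth

theorem hasTemperateGrowth_ofReal_comp {f : Euc N → ℝ} (hf : f.HasTemperateGrowth) :
    (fun x : Euc N => (f x : ℂ)).HasTemperateGrowth := by fun_prop

theorem hasTemperateGrowth_linearField (A : Matrix (Fin N) (Fin N) ℝ) (i : Fin N) :
    (fun x : Euc N => linearField A x i).HasTemperateGrowth := by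
  simp only [linearField_apply]
  have := hasTemperateGrowth_coord (N := N)
  fun_prop

theorem hasTemperateGrowth_quadForm (A : Matrix (Fin N) (Fin N) ℝ) :
    (quadForm A).HasTemperateGrowth := by
  have h : quadForm A = fun x => ∑ i, ∑ j, A i j * x i * x j := funext (quadForm_eq A)
  rw [h]
  have := hasTemperateGrowth_coord (N := N)
  fun_prop

/-- Half of the Gaussian decay absorbs the linear term by Young's inequality. The factor e^l is
needed for the majorants in the density proof. -/
theorem exists_gaussian_mul_exp {S : Matrix (Fin N) (Fin N) ℝ} (hS : S.PosDef) {l : Euc N → ℝ}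
    (hl : l.HasTemperateGrowth) {a : ℝ} (hla : ∀ x, l x ≤ a * ‖x‖) :
    ∃ γ : 𝓢(Euc N, ℂ), ∀ x, γ x = Real.exp (-(1 / 2) * quadForm S x + l x) := by
  obtain ⟨c, hc, hcS⟩ := (PosDef.one (n := Fin N) (R := ℝ)).exists_coercive hS
  refine exists_schwartz_exp (c := c / 4) (C₀ := a ^ 2 / c) ?_ (by positivity) fun x => ?_
  · have := hasTemperateGrowth_quadForm S
    fun_prop
  · have h1 := hcS x.ofLp
    rw [one_mulVec, ← norm_sq_eq_dotProduct, ← quadForm_eq_dotProduct] at h1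
    have h2 : a * ‖x‖ ≤ a ^ 2 / c + c / 4 * ‖x‖ ^ 2 := by
      rw [← sub_nonneg]
      have : a ^ 2 / c + c / 4 * ‖x‖ ^ 2 - a * ‖x‖ = (a - c / 2 * ‖x‖) ^ 2 / c := by
        field_simp; ring
      rw [this]
      positivity
    linarith [hla x]

open Classical in
/-- The Gaussian `x ↦ exp (-½ ⟨x, S x⟩)` as a Schwartz function (for positive definite `S`). -/
noncomputable def gaussian (S : Matrix (Fin N) (Fin N) ℝ) : 𝓢(Euc N, ℂ) :=
  -- The default 0 is not taken for positive definite S, by `gaussian_apply`.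
  if h : ∃ γ : 𝓢(Euc N, ℂ), ∀ x, γ x = Real.exp (-(1 / 2) * quadForm S x) then h.choose else 0

theorem gaussian_apply {S : Matrix (Fin N) (Fin N) ℝ} (hS : S.PosDef) (x : Euc N) :
    gaussian S x = Real.exp (-(1 / 2) * quadForm S x) := by
  have h : ∃ γ : 𝓢(Euc N, ℂ), ∀ x, γ x = Real.exp (-(1 / 2) * quadForm S x) := by
    simpa using exists_gaussian_mul_exp hS (l := fun _ => 0) (a := 0) (by fun_prop) (by simp)
  rw [gaussian, dif_pos h]
  exact h.choose_spec x

end Coordinates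

/-! ### Position and derivative operators on Schwartz functions -/

section Operators

variable {N : ℕ}

/-- Multiplication by the `i`-th coordinate on Schwartz functions. -/
noncomputable def mulX (i : Fin N) : 𝓢(Euc N, ℂ) →L[ℂ] 𝓢(Euc N, ℂ) :=
  SchwartzMap.smulLeftCLM ℂ fun x : Euc N => ((x i : ℝ) : ℂ)

/-- The `i`-th partial derivative on Schwartz functions. -/
noncomputable def partialD (i : Fin N) : 𝓢(Euc N, ℂ) →L[ℂ] 𝓢(Euc N, ℂ) :=
  LineDeriv.lineDerivOpCLM ℂ 𝓢(Euc N, ℂ) (EuclideanSpace.single i (1 : ℝ) : Euc N)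

theorem hasTemperateGrowth_coord_ofReal (i : Fin N) :
    (fun x : Euc N => ((x i : ℝ) : ℂ)).HasTemperateGrowth :=
  hasTemperateGrowth_ofReal_comp (hasTemperateGrowth_coord i)

@[simp]
theorem mulX_apply (i : Fin N) (u : 𝓢(Euc N, ℂ)) (x : Euc N) : mulX i u x = (x i : ℂ) * u x :=
  SchwartzMap.smulLeftCLM_apply_apply (hasTemperateGrowth_coord_ofReal i) u x

theorem partialD_apply (i : Fin N) (u : 𝓢(Euc N, ℂ)) (x : Euc N) :
    partialD i u x = lineDeriv ℝ u x (EuclideanSpace.single i (1 : ℝ) : Euc N) := by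
  rw [partialD, LineDeriv.lineDerivOpCLM_apply, SchwartzMap.lineDerivOp_apply]

theorem partialD_eq_of_hasDerivAt {i : Fin N} {u : 𝓢(Euc N, ℂ)} {x : Euc N} {y : ℂ}
    (h : HasDerivAt (fun t : ℝ => u (x + t • (EuclideanSpace.single i (1 : ℝ) : Euc N))) y 0) :
    partialD i u x = y :=
  (partialD_apply i u x).trans (HasLineDerivAt.lineDeriv h)

theorem hasDerivAt_line (i : Fin N) (u : 𝓢(Euc N, ℂ)) (x : Euc N) :
    HasDerivAt (fun t : ℝ => u (x + t • (EuclideanSpace.single i (1 : ℝ) : Euc N)))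
      (partialD i u x) 0 := by
  rw [partialD_apply]
  exact (u.differentiableAt.hasFDerivAt.hasLineDerivAt _).lineDifferentiableAt.hasLineDerivAt

theorem hasDerivAt_line_coord (x y : Euc N) (j : Fin N) :
    HasDerivAt (fun t : ℝ => (((x + t • y) j : ℝ) : ℂ)) ((y j : ℝ) : ℂ) 0 := by
  have h : HasDerivAt (fun t : ℝ => x j + t * y j) (y j) 0 := by
    simpa using ((hasDerivAt_id (0 : ℝ)).mul_const (y j)).const_add (x j)
  exact h.ofReal_comp

/-- The canonical commutation relations. -/
theorem partialD_mulX (i j : Fin N) (u : 𝓢(Euc N, ℂ)) :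
    partialD i (mulX j u) = mulX j (partialD i u) + if j = i then u else 0 := by
  ext x
  refine partialD_eq_of_hasDerivAt ?_
  simp only [mulX_apply]
  refine ((hasDerivAt_line_coord x _ j).mul (hasDerivAt_line i u x)).congr_deriv ?_
  simp only [zero_smul, add_zero, FunLike.coe_add, Pi.add_apply, mulX_apply, PiLp.single_apply]
  split_ifs <;> simp [add_comm]

theorem mulX_comm (i j : Fin N) (u : 𝓢(Euc N, ℂ)) : mulX i (mulX j u) = mulX j (mulX i u) := by
  ext x
  simp only [mulX_apply]
  ring

/-- The operator `Δ + ⟨B x, ∇⟩ - ⟨x, K x⟩` on Schwartz functions. -/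
noncomputable def schwOp (B K : Matrix (Fin N) (Fin N) ℝ) : 𝓢(Euc N, ℂ) →ₗ[ℂ] 𝓢(Euc N, ℂ) where
  toFun u := ∑ i, partialD i (partialD i u) + ∑ i, ∑ j, (B i j : ℂ) • mulX j (partialD i u)
    - ∑ i, ∑ j, (K i j : ℂ) • mulX i (mulX j u)
  map_add' u v := by
    simp only [map_add, smul_add, Finset.sum_add_distrib]
    abel
  map_smul' c u := by
    simp only [map_smul, smul_sub, smul_add, Finset.smul_sum, RingHom.id_apply, smul_comm c]

theorem schwOp_apply (B K : Matrix (Fin N) (Fin N) ℝ) (u : 𝓢(Euc N, ℂ)) :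
    schwOp B K u = ∑ i, partialD i (partialD i u)
      + ∑ i, ∑ j, (B i j : ℂ) • mulX j (partialD i u)
      - ∑ i, ∑ j, (K i j : ℂ) • mulX i (mulX j u) := rfl

end Operators

/-! ### Conjugation by the ground state -/

section PolynomialGaussian

variable {N : ℕ}

/-- A polynomial as a function on `ℝ^N`. -/
noncomputable def polyFun (p : MvPolynomial (Fin N) ℂ) (x : Euc N) : ℂ :=
  MvPolynomial.eval (fun i => ((x i : ℝ) : ℂ)) p

theorem hasTemperateGrowth_polyFun (p : MvPolynomial (Fin N) ℂ) :
    (polyFun p).HasTemperateGrowth := by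
  induction p using MvPolynomial.induction_on with
  | C a =>
    have h : polyFun (MvPolynomial.C a : MvPolynomial (Fin N) ℂ) = fun _ => a := by
      funext x; simp [polyFun]
    rw [h]
    fun_prop
  | add p q hp hq =>
    have h : polyFun (p + q) = polyFun p + polyFun q := by
      funext x; simp [polyFun]
    rw [h]
    exact hp.add hq
  | mul_X p i hp =>
    have h : polyFun (p * MvPolynomial.X i) = polyFun p * fun x => ((x i : ℝ) : ℂ) := by
      funext x; simp [polyFun]
    rw [h]
    exact hp.mul (hasTemperateGrowth_coord_ofReal i)

theorem hasDerivAt_line_polyFun (p : MvPolynomial (Fin N) ℂ) (x y : Euc N) :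
    HasDerivAt (fun t : ℝ => polyFun p (x + t • y))
      (∑ i, ((y i : ℝ) : ℂ) * polyFun (MvPolynomial.pderiv i p) x) 0 := by
  induction p using MvPolynomial.induction_on with
  | C a => simpa [polyFun] using hasDerivAt_const (0 : ℝ) a
  | add p q hp hq =>
    simp only [polyFun, map_add, mul_add, Finset.sum_add_distrib] at hp hq ⊢
    exact hp.add hq
  | mul_X p j hp =>
    have h := hp.mul (hasDerivAt_line_coord x y j)
    simp only [polyFun, map_mul, MvPolynomial.eval_X, Derivation.leibniz,
      MvPolynomial.pderiv_X, map_add, smul_eq_mul] at h ⊢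
    refine h.congr_deriv ?_
    simp only [zero_smul, add_zero, Finset.sum_mul, mul_add, Finset.sum_add_distrib, Pi.single_apply,
      apply_ite (MvPolynomial.eval _), map_one, map_zero, mul_ite, mul_one, mul_zero,
      Finset.sum_ite_eq, Finset.mem_univ, if_true]
    rw [add_comm, mul_comm]
    congr 1
    exact Finset.sum_congr rfl fun i _ => by ring

theorem hasDerivAt_line_single_polyFun (p : MvPolynomial (Fin N) ℂ) (x : Euc N) (i : Fin N) :
    HasDerivAt (fun t : ℝ => polyFun p (x + t • (EuclideanSpace.single i (1 : ℝ) : Euc N)))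
      (polyFun (MvPolynomial.pderiv i p) x) 0 := by
  refine (hasDerivAt_line_polyFun p x _).congr_deriv ?_
  simp [PiLp.single_apply, apply_ite Complex.ofReal]

/-- The Schwartz function `p · exp (-½ ⟨x, S x⟩)`. -/
noncomputable def polyGauss (S : Matrix (Fin N) (Fin N) ℝ) :
    MvPolynomial (Fin N) ℂ →ₗ[ℂ] 𝓢(Euc N, ℂ) where
  toFun p := SchwartzMap.smulLeftCLM ℂ (polyFun p) (gaussian S)
  map_add' p q := by
    have h : polyFun (p + q) = polyFun p + polyFun q := by funext x; simp [polyFun]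
    rw [h, SchwartzMap.smulLeftCLM_add (hasTemperateGrowth_polyFun p) (hasTemperateGrowth_polyFun q)]
    rfl
  map_smul' c p := by
    have h : polyFun (c • p) = c • polyFun p := by funext x; simp [polyFun]
    rw [h, SchwartzMap.smulLeftCLM_smul (hasTemperateGrowth_polyFun p)]
    rfl

@[simp]
theorem polyGauss_apply (S : Matrix (Fin N) (Fin N) ℝ) (p : MvPolynomial (Fin N) ℂ) (x : Euc N) :
    polyGauss S p x = polyFun p x * gaussian S x :=
  SchwartzMap.smulLeftCLM_apply_apply (hasTemperateGrowth_polyFun p) _ x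

/-- The linear form `∑ j, S i j X_j`. -/
noncomputable def linPoly (S : Matrix (Fin N) (Fin N) ℝ) (i : Fin N) : MvPolynomial (Fin N) ℂ :=
  ∑ j, MvPolynomial.C (S i j : ℂ) * MvPolynomial.X j

/-- The quadratic form `∑ i j, S i j X_i X_j`. -/
noncomputable def quadPoly (S : Matrix (Fin N) (Fin N) ℝ) : MvPolynomial (Fin N) ℂ :=
  ∑ i, ∑ j, MvPolynomial.C (S i j : ℂ) * (MvPolynomial.X i * MvPolynomial.X j)

theorem polyFun_linPoly (S : Matrix (Fin N) (Fin N) ℝ) (i : Fin N) (x : Euc N) :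
    polyFun (linPoly S i) x = ((linearField S x i : ℝ) : ℂ) := by
  simp [polyFun, linPoly, linearField_apply]

theorem mulX_polyGauss (S : Matrix (Fin N) (Fin N) ℝ) (i : Fin N) (p : MvPolynomial (Fin N) ℂ) :
    mulX i (polyGauss S p) = polyGauss S (MvPolynomial.X i * p) := by
  ext x
  simp [polyFun, mul_assoc]

theorem hasDerivAt_line_gaussian {S : Matrix (Fin N) (Fin N) ℝ} (hS : S.PosDef) (x : Euc N)
    (i : Fin N) :
    HasDerivAt (fun t : ℝ => gaussian S (x + t • (EuclideanSpace.single i (1 : ℝ) : Euc N)))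
      (-(linearField S x i : ℂ) * gaussian S x) 0 := by
  set e : Euc N := EuclideanSpace.single i (1 : ℝ) with he
  have hquad : ∀ t : ℝ, quadForm S (x + t • e) =
      quadForm S x + t * (2 * linearField S x i) + t ^ 2 * quadForm S e := by
    intro t
    have hlin : linearField S (x + t • e) = linearField S x + t • linearField S e := by
      simp [linearField]
    have h1 : ⟪x, linearField S e⟫_ℝ = linearField S x i := by
      simp only [PiLp.inner_apply, linearField_apply, RCLike.inner_apply, conj_trivial, he]
      simp [hS.posSemidef.isSymm.apply]
    have h2 : ⟪e, linearField S x⟫_ℝ = linearField S x i := by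
      simp [he, EuclideanSpace.inner_single_left]
    simp only [quadForm]
    rw [hlin, inner_add_left, inner_add_right, inner_add_right, inner_smul_left, inner_smul_right,
      inner_smul_left, inner_smul_right, h1, h2]
    simp only [conj_trivial]
    ring
  have h3 : HasDerivAt (fun t : ℝ => Real.exp (-(1 / 2) * quadForm S (x + t • e)))
      (-(linearField S x i) * Real.exp (-(1 / 2) * quadForm S x)) 0 := by
    simp only [hquad]
    have h4 : HasDerivAt (fun t : ℝ => -(1 / 2) * (quadForm S x + t * (2 * linearField S x i) +
        t ^ 2 * quadForm S e)) (-(linearField S x i)) 0 := by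
      have h5 := ((((hasDerivAt_id (0 : ℝ)).mul_const (2 * linearField S x i)).const_add
        (quadForm S x)).add ((hasDerivAt_pow 2 (0 : ℝ)).mul_const (quadForm S e))).const_mul
        (-(1 / 2) : ℝ)
      refine h5.congr_deriv ?_
      simp
    refine h4.exp.congr_deriv ?_
    simp
    ring
  have h6 := h3.ofReal_comp
  simp only [gaussian_apply hS]
  refine h6.congr_deriv ?_
  push_cast
  ring

theorem partialD_polyGauss {S : Matrix (Fin N) (Fin N) ℝ} (hS : S.PosDef) (i : Fin N)
    (p : MvPolynomial (Fin N) ℂ) :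
    partialD i (polyGauss S p) =
      polyGauss S (MvPolynomial.pderiv i p - linPoly S i * p) := by
  ext x
  refine partialD_eq_of_hasDerivAt ?_
  simp only [polyGauss_apply]
  refine ((hasDerivAt_line_single_polyFun p x i).mul (hasDerivAt_line_gaussian hS x i)).congr_deriv ?_
  have h : polyFun (MvPolynomial.pderiv i p - linPoly S i * p) x =
      polyFun (MvPolynomial.pderiv i p) x - (linearField S x i : ℂ) * polyFun p x := by
    rw [← polyFun_linPoly]; simp [polyFun]
  rw [h]
  simp only [zero_smul, add_zero]
  ring

/-- The Laplacian on polynomials. -/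
noncomputable def polyLaplacian : MvPolynomial (Fin N) ℂ →ₗ[ℂ] MvPolynomial (Fin N) ℂ :=
  ∑ i, (MvPolynomial.pderiv i : Derivation ℂ _ (MvPolynomial (Fin N) ℂ)).toLinearMap ∘ₗ
    (MvPolynomial.pderiv i : Derivation ℂ _ (MvPolynomial (Fin N) ℂ)).toLinearMap

/-- The linear vector field `⟨A x, ∇⟩` on polynomials. -/
noncomputable def polyDrift (A : Matrix (Fin N) (Fin N) ℝ) :
    MvPolynomial (Fin N) ℂ →ₗ[ℂ] MvPolynomial (Fin N) ℂ :=
  ∑ i, LinearMap.mulLeft ℂ (linPoly A i) ∘ₗ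
    (MvPolynomial.pderiv i : Derivation ℂ _ (MvPolynomial (Fin N) ℂ)).toLinearMap

theorem polyLaplacian_apply (p : MvPolynomial (Fin N) ℂ) :
    polyLaplacian p = ∑ i, MvPolynomial.pderiv i (MvPolynomial.pderiv i p) := by
  simp [polyLaplacian]

theorem polyDrift_apply (A : Matrix (Fin N) (Fin N) ℝ) (p : MvPolynomial (Fin N) ℂ) :
    polyDrift A p = ∑ i, linPoly A i * MvPolynomial.pderiv i p := by
  simp [polyDrift]

/-- A quadratic form sees only the symmetric part of its matrix. -/
theorem quadPoly_eq_zero {S : Matrix (Fin N) (Fin N) ℝ} (h : S + Sᵀ = 0) : quadPoly S = 0 := by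
  have h1 : quadPoly S = quadPoly Sᵀ := by
    rw [quadPoly, Finset.sum_comm, quadPoly]
    refine Finset.sum_congr rfl fun i _ => Finset.sum_congr rfl fun j _ => ?_
    rw [transpose_apply, mul_comm (MvPolynomial.X i)]
  have h2 : quadPoly S + quadPoly Sᵀ = quadPoly (S + Sᵀ) := by
    simp only [quadPoly, ← Finset.sum_add_distrib, ← add_mul, ← map_add, Matrix.add_apply,
      Complex.ofReal_add]
  rw [← h1, h, ← two_mul] at h2
  have h3 : quadPoly (0 : Matrix (Fin N) (Fin N) ℝ) = 0 := by simp [quadPoly]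
  rw [h3] at h2
  exact (mul_eq_zero.1 h2).resolve_left two_ne_zero

theorem pderiv_linPoly (S : Matrix (Fin N) (Fin N) ℝ) (i k : Fin N) :
    MvPolynomial.pderiv k (linPoly S i) = MvPolynomial.C (S i k : ℂ) := by
  simp [linPoly, MvPolynomial.pderiv_X, Pi.single_apply]

theorem sum_linPoly_mul_linPoly (S T : Matrix (Fin N) (Fin N) ℝ) :
    ∑ i, linPoly S i * linPoly T i = quadPoly (Sᵀ * T) := by
  simp only [linPoly, quadPoly, Finset.sum_mul_sum, Matrix.mul_apply, transpose_apply]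
  rw [Finset.sum_comm]
  refine Finset.sum_congr rfl fun j _ => ?_
  rw [Finset.sum_comm]
  refine Finset.sum_congr rfl fun k _ => ?_
  push_cast
  rw [map_sum, Finset.sum_mul]
  refine Finset.sum_congr rfl fun i _ => ?_
  rw [map_mul]
  ring

/-- The quadratic operator on polynomials times the ground state. -/
theorem schwOp_polyGauss {B K X : Matrix (Fin N) (Fin N) ℝ} (hX : X.PosDef)
    (hF : riccati B K X = 0) (p : MvPolynomial (Fin N) ℂ) :
    schwOp B K (polyGauss X p) =
      polyGauss X (polyLaplacian p - (2 : ℂ) • polyDrift (closedLoop B X) p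
        - (X.trace : ℂ) • p) := by
  have hXs := hX.posSemidef.isSymm
  have hsum : ∀ i, ∑ j, (B i j : ℂ) • mulX j (partialD i (polyGauss X p)) =
      polyGauss X (linPoly B i * (MvPolynomial.pderiv i p - linPoly X i * p)) := by
    intro i
    simp only [partialD_polyGauss hX, mulX_polyGauss, ← map_smul, ← map_sum]
    congr 1
    rw [show linPoly B i = ∑ j, MvPolynomial.C (B i j : ℂ) * MvPolynomial.X j from rfl,
      Finset.sum_mul]
    refine Finset.sum_congr rfl fun j _ => ?_
    rw [MvPolynomial.smul_eq_C_mul, mul_assoc]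
  have hquad : ∑ i, ∑ j, (K i j : ℂ) • mulX i (mulX j (polyGauss X p)) =
      polyGauss X (quadPoly K * p) := by
    simp only [mulX_polyGauss, ← map_smul, ← map_sum]
    congr 1
    rw [quadPoly, Finset.sum_mul]
    refine Finset.sum_congr rfl fun i _ => ?_
    rw [Finset.sum_mul]
    refine Finset.sum_congr rfl fun j _ => ?_
    rw [MvPolynomial.smul_eq_C_mul]
    ring
  rw [schwOp_apply, hquad]
  simp only [hsum]
  simp only [partialD_polyGauss hX, ← map_sum, ← map_add, ← map_sub]
  congr 1
  -- The quadratic potential left after conjugation. Symmetrising its matrix gives twice the Riccati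
  -- expression, hence zero.
  have hzero : quadPoly (Xᵀ * X) - quadPoly (Bᵀ * X) - quadPoly K = 0 := by
    have h1 : quadPoly (Xᵀ * X) - quadPoly (Bᵀ * X) - quadPoly K =
        quadPoly (Xᵀ * X - Bᵀ * X - K) := by
      simp only [quadPoly, ← Finset.sum_sub_distrib]
      refine Finset.sum_congr rfl fun i _ => Finset.sum_congr rfl fun j _ => ?_
      rw [← sub_mul, ← sub_mul, ← map_sub, ← map_sub, Matrix.sub_apply, Matrix.sub_apply,
        Complex.ofReal_sub, Complex.ofReal_sub]
    rw [h1]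
    refine quadPoly_eq_zero ?_
    have hKs : Kᵀ = K := by
      have h2 : K = X ^ 2 - (1 / 2 : ℝ) • (Bᵀ * X) - (1 / 2 : ℝ) • (X * B) :=
        (sub_eq_zero.1 hF).symm
      rw [h2]
      simp only [sq, transpose_sub, transpose_smul, transpose_mul, transpose_transpose, hXs.eq]
      abel
    have h3 : X * X - Bᵀ * X - K + (X * X - X * B - K) = (2 : ℝ) • riccati B K X := by
      rw [riccati, sq]
      module
    simp only [transpose_sub, transpose_mul, transpose_transpose, hXs.eq, hKs]
    rw [h3, hF, smul_zero]
  have hlin : ∀ i, linPoly (closedLoop B X) i =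
      linPoly X i - MvPolynomial.C (1 / 2 : ℂ) * linPoly B i := by
    intro i
    simp only [linPoly, closedLoop, Finset.mul_sum, ← Finset.sum_sub_distrib]
    refine Finset.sum_congr rfl fun j _ => ?_
    rw [← mul_assoc, ← map_mul, ← sub_mul, ← map_sub]
    simp
  -- On the polynomial factor ∂ᵢ acts as ∂ᵢ - (X x)ᵢ. The cross terms form the closed-loop drift,
  -- and differentiating (X x)ᵢ leaves the trace entry.
  have hterm : ∀ i, MvPolynomial.pderiv i (MvPolynomial.pderiv i p - linPoly X i * p) -
      linPoly X i * (MvPolynomial.pderiv i p - linPoly X i * p) +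
      linPoly B i * (MvPolynomial.pderiv i p - linPoly X i * p) =
      MvPolynomial.pderiv i (MvPolynomial.pderiv i p)
        - MvPolynomial.C (2 : ℂ) * (linPoly (closedLoop B X) i * MvPolynomial.pderiv i p)
        - MvPolynomial.C (X i i : ℂ) * p
        + (linPoly X i * linPoly X i - linPoly B i * linPoly X i) * p := by
    intro i
    have h2 : (MvPolynomial.C (2 : ℂ) * MvPolynomial.C (1 / 2 : ℂ) : MvPolynomial (Fin N) ℂ) = 1 := by
      rw [← map_mul]; norm_num
    have h3 : (MvPolynomial.C (2 : ℂ) : MvPolynomial (Fin N) ℂ) = 2 := map_ofNat _ 2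
    rw [map_sub, Derivation.leibniz, pderiv_linPoly, hlin, smul_eq_mul, smul_eq_mul]
    linear_combination (-(linPoly B i * MvPolynomial.pderiv i p)) * h2 +
      (linPoly X i * MvPolynomial.pderiv i p) * h3
  rw [← Finset.sum_add_distrib, Finset.sum_congr rfl fun i _ => hterm i]
  simp only [Finset.sum_add_distrib, Finset.sum_sub_distrib, ← Finset.sum_mul, ← Finset.mul_sum,
    sum_linPoly_mul_linPoly, polyLaplacian_apply, polyDrift_apply, MvPolynomial.smul_eq_C_mul]
  rw [← map_sum, ← Complex.ofReal_sum]
  change _ = _ - _ - MvPolynomial.C ((∑ i, X i i : ℝ) : ℂ) * p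
  linear_combination p * hzero

end PolynomialGaussian

/-! ### The Ornstein-Uhlenbeck operator on polynomials -/

section PolynomialDegree

variable {N : ℕ}

theorem polyFun_smul {q : MvPolynomial (Fin N) ℂ} {k : ℕ} (hq : q.IsHomogeneous k) (t : ℝ)
    (x : Euc N) : polyFun q (t • x) = (t : ℂ) ^ k * polyFun q x := by
  simp only [polyFun, MvPolynomial.eval_eq, Finset.mul_sum]
  refine Finset.sum_congr rfl fun d hd => ?_
  have hdeg : ∑ i ∈ d.support, d i = k := (hq.degree_eq_sum_deg_support hd).symm
  rw [← hdeg, ← Finset.prod_pow_eq_pow_sum]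
  simp only [PiLp.smul_apply, smul_eq_mul, Complex.ofReal_mul, mul_pow, Finset.prod_mul_distrib]
  ring

/-- The real points form a product of infinite sets, on which a nonzero complex polynomial cannot
vanish identically. -/
theorem exists_polyFun_ne_zero {p : MvPolynomial (Fin N) ℂ} (hp : p ≠ 0) :
    ∃ x : Euc N, polyFun p x ≠ 0 := by
  by_contra! h
  refine hp (MvPolynomial.funext_set (fun _ => Set.range ((↑) : ℝ → ℂ))
    (fun _ => Set.infinite_range_of_injective Complex.ofReal_injective) fun y hy => ?_)
  choose z hz using fun i => hy i (Set.mem_univ i)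
  have h1 := h (WithLp.toLp 2 z)
  simp only [polyFun, hz] at h1
  rw [h1, map_zero]

theorem polyFun_polyDrift (A : Matrix (Fin N) (Fin N) ℝ) (p : MvPolynomial (Fin N) ℂ)
    (x : Euc N) : polyFun (polyDrift A p) x =
      ∑ i, ((linearField A x i : ℝ) : ℂ) * polyFun (MvPolynomial.pderiv i p) x := by
  simp only [← polyFun_linPoly]
  simp [polyFun, polyDrift_apply]

/-- Homogeneous eigenfunctions of a linear vector field which expands the norm of `X`. -/
theorem le_re_of_polyDrift_eq_smul [NeZero N] {X A : Matrix (Fin N) (Fin N) ℝ} (hX : X.PosDef)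
    {δ : ℝ} (hδ : ∀ v : Fin N → ℝ, δ * (v ⬝ᵥ X *ᵥ v) ≤ (A *ᵥ v) ⬝ᵥ (X *ᵥ v))
    {q : MvPolynomial (Fin N) ℂ} (hq0 : q ≠ 0) {k : ℕ} (hq : q.IsHomogeneous k) {w : ℂ}
    (h : polyDrift A q = w • q) : k * δ ≤ w.re := by
  have hXs := hX.posSemidef.isSymm
  have hpos : ∀ x : Euc N, x ≠ 0 → 0 < quadForm X x := fun x hx => by
    rw [quadForm_eq_dotProduct]
    exact hX.quadratic_pos fun h0 => hx (by ext i; exact congrFun h0 i)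
  have hcontq : Continuous fun x : Euc N => ‖polyFun q x‖ ^ 2 :=
    ((hasTemperateGrowth_polyFun q).1.continuous.norm).pow 2
  have hcontX : Continuous (quadForm X) := (hasTemperateGrowth_quadForm X).1.continuous
  obtain ⟨e, he⟩ := exists_ne (0 : Euc N)
  have hne : ∀ x ∈ Metric.sphere (0 : Euc N) 1, x ≠ 0 := fun x hx h0 => by simp [h0] at hx
  -- The ratio |q|²/⟨x, X x⟩ᵏ is homogeneous of degree zero, so its maximum on the sphere is global.
  obtain ⟨x₀, hx₀, hmax⟩ := (isCompact_sphere (0 : Euc N) 1).exists_isMaxOn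
    ⟨‖e‖⁻¹ • e, by simp [norm_smul, he]⟩
    (f := fun x => ‖polyFun q x‖ ^ 2 / quadForm X x ^ k)
    (hcontq.continuousOn.div (hcontX.pow k).continuousOn fun x hx =>
      (pow_pos (hpos x (hne x hx)) k).ne')
  have hφ₀ : 0 < quadForm X x₀ := hpos x₀ (hne x₀ hx₀)
  have hquad : ∀ (t : ℝ) (x : Euc N), quadForm X (t • x) = t ^ 2 * quadForm X x := fun t x => by
    simp only [quadForm_eq, PiLp.smul_apply, smul_eq_mul, Finset.mul_sum]
    exact Finset.sum_congr rfl fun i _ => Finset.sum_congr rfl fun j _ => by ring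
  have hsphere : ∀ x ∈ Metric.sphere (0 : Euc N) 1,
      ‖polyFun q x‖ ^ 2 * quadForm X x₀ ^ k ≤ ‖polyFun q x₀‖ ^ 2 * quadForm X x ^ k :=
    fun x hx => (div_le_div_iff₀ (pow_pos (hpos x (hne x hx)) k) (pow_pos hφ₀ k)).1 (hmax hx)
  have hle : ∀ x : Euc N,
      ‖polyFun q x‖ ^ 2 * quadForm X x₀ ^ k ≤ ‖polyFun q x₀‖ ^ 2 * quadForm X x ^ k := by
    intro x
    have key : ∀ (t : ℝ) (y : Euc N), y ∈ Metric.sphere (0 : Euc N) 1 → x = t • y →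
        ‖polyFun q x‖ ^ 2 * quadForm X x₀ ^ k ≤ ‖polyFun q x₀‖ ^ 2 * quadForm X x ^ k := by
      rintro t y hy rfl
      have e1 : ‖polyFun q (t • y)‖ ^ 2 * quadForm X x₀ ^ k =
          (t ^ 2) ^ k * (‖polyFun q y‖ ^ 2 * quadForm X x₀ ^ k) := by
        rw [polyFun_smul hq, norm_mul, norm_pow, Complex.norm_real, Real.norm_eq_abs, mul_pow,
          ← pow_mul, mul_comm k 2, pow_mul, sq_abs, mul_assoc]
      have e2 : ‖polyFun q x₀‖ ^ 2 * quadForm X (t • y) ^ k =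
          (t ^ 2) ^ k * (‖polyFun q x₀‖ ^ 2 * quadForm X y ^ k) := by
        rw [hquad, mul_pow, mul_left_comm]
      rw [e1, e2]
      exact mul_le_mul_of_nonneg_left (hsphere y hy) (by positivity)
    rcases eq_or_ne x 0 with hx | hx
    · exact key 0 x₀ hx₀ (by rw [hx, zero_smul])
    · exact key ‖x‖ (‖x‖⁻¹ • x) (by simp [norm_smul, hx])
        (by rw [smul_smul, mul_inv_cancel₀ (norm_ne_zero_iff.2 hx), one_smul])
  have hq₀ : 0 < ‖polyFun q x₀‖ ^ 2 := by
    obtain ⟨y, hy⟩ := exists_polyFun_ne_zero hq0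
    have h1 : 0 < ‖polyFun q y‖ ^ 2 * quadForm X x₀ ^ k := by positivity
    have h2 := h1.trans_le (hle y)
    by_contra! h3
    have h4 : ‖polyFun q x₀‖ ^ 2 = 0 := le_antisymm h3 (sq_nonneg _)
    rw [h4, zero_mul] at h2
    exact lt_irrefl _ h2
  set y : Euc N := linearField A x₀ with hy
  have hdq : HasDerivAt (fun t : ℝ => ‖polyFun q (x₀ + t • y)‖ ^ 2)
      (2 * (w.re * ‖polyFun q x₀‖ ^ 2)) 0 := by
    have h1 := hasDerivAt_line_polyFun q x₀ y
    have h2 : (∑ i, ((y i : ℝ) : ℂ) * polyFun (MvPolynomial.pderiv i q) x₀) =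
        w * polyFun q x₀ := by
      rw [hy, ← polyFun_polyDrift, h]
      simp [polyFun]
    rw [h2] at h1
    refine h1.norm_sq.congr_deriv ?_
    simp only [zero_smul, add_zero]
    rw [Complex.inner, mul_assoc, Complex.mul_conj, Complex.normSq_eq_norm_sq, Complex.re_mul_ofReal]
  have hdX : HasDerivAt (fun t : ℝ => quadForm X (x₀ + t • y))
      (2 * ((A *ᵥ x₀.ofLp) ⬝ᵥ (X *ᵥ x₀.ofLp))) 0 := by
    have h1 : ∀ t : ℝ, quadForm X (x₀ + t • y) =
        quadForm X x₀ + t * (2 * ((A *ᵥ x₀.ofLp) ⬝ᵥ (X *ᵥ x₀.ofLp))) + t ^ 2 * quadForm X y := by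
      intro t
      have h2 : y.ofLp = A *ᵥ x₀.ofLp := by
        funext i
        simp [hy, linearField_apply, mulVec, dotProduct]
      have h3 : x₀.ofLp ⬝ᵥ X *ᵥ y.ofLp = y.ofLp ⬝ᵥ X *ᵥ x₀.ofLp := by
        rw [dotProduct_mulVec, ← mulVec_transpose, hXs.eq, dotProduct_comm]
      simp only [quadForm_eq_dotProduct, WithLp.ofLp_add, WithLp.ofLp_smul, mulVec_add, mulVec_smul,
        add_dotProduct, dotProduct_add, smul_dotProduct, dotProduct_smul, smul_eq_mul, h3]
      rw [h2]
      ring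
    simp only [h1]
    refine ((((hasDerivAt_id (0 : ℝ)).mul_const _).const_add _).add
      ((hasDerivAt_pow 2 (0 : ℝ)).mul_const (quadForm X y))).congr_deriv ?_
    simp
  -- Stationarity at x₀ in the direction A x₀: there |q|² has derivative 2 Re w |q|², and ⟨x, X x⟩
  -- has derivative 2 ⟨A x, X x⟩ ≥ 2δ ⟨x, X x⟩. Comparing the two gives kδ ≤ Re w.
  have hmin : IsLocalMin (fun t : ℝ => ‖polyFun q x₀‖ ^ 2 * quadForm X (x₀ + t • y) ^ k -
      ‖polyFun q (x₀ + t • y)‖ ^ 2 * quadForm X x₀ ^ k) 0 := by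
    refine Filter.Eventually.of_forall fun t => ?_
    simp only [zero_smul, add_zero, sub_self]
    exact sub_nonneg.2 (hle _)
  have hder := hmin.hasDerivAt_eq_zero
    (((hdX.pow k).const_mul (‖polyFun q x₀‖ ^ 2)).sub (hdq.mul_const (quadForm X x₀ ^ k)))
  simp only [zero_smul, add_zero] at hder
  have hA := hδ x₀.ofLp
  rw [← quadForm_eq_dotProduct] at hA
  have hmain : w.re * quadForm X x₀ ^ k =
      k * quadForm X x₀ ^ (k - 1) * ((A *ᵥ x₀.ofLp) ⬝ᵥ (X *ᵥ x₀.ofLp)) := by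
    have h5 := hq₀.ne'
    have h6 : ‖polyFun q x₀‖ ^ 2 * (2 * (k * quadForm X x₀ ^ (k - 1) *
        ((A *ᵥ x₀.ofLp) ⬝ᵥ (X *ᵥ x₀.ofLp)) - w.re * quadForm X x₀ ^ k)) = 0 := by
      rw [← hder]; ring
    have h7 := (mul_eq_zero.1 h6).resolve_left h5
    linarith
  -- For k = 0 the exponent k - 1 is truncated, and the identity just says Re w = 0.
  rcases Nat.eq_zero_or_pos k with rfl | hk
  · simp at hmain
    simp [hmain]
  · have h8 : k * δ * quadForm X x₀ ^ k ≤ w.re * quadForm X x₀ ^ k := by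
      rw [hmain]
      obtain ⟨m, rfl⟩ : ∃ m, k = m + 1 := ⟨k - 1, by omega⟩
      rw [Nat.add_sub_cancel, pow_succ]
      have h9 : 0 ≤ ((m + 1 : ℕ) : ℝ) * quadForm X x₀ ^ m := by positivity
      nlinarith [mul_le_mul_of_nonneg_left hA h9]
    exact le_of_mul_le_mul_right h8 (pow_pos hφ₀ k)

theorem totalDegree_pderiv_le (p : MvPolynomial (Fin N) ℂ) (i : Fin N) :
    (MvPolynomial.pderiv i p).totalDegree ≤ p.totalDegree - 1 := by
  conv_lhs => rw [← MvPolynomial.sum_homogeneousComponent p, map_sum]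
  refine MvPolynomial.totalDegree_finsetSum_le fun j hj => ?_
  refine ((MvPolynomial.homogeneousComponent_isHomogeneous j p).pderiv).totalDegree_le.trans ?_
  have := Finset.mem_range.1 hj
  omega

theorem pderiv_eq_zero_of_totalDegree {p : MvPolynomial (Fin N) ℂ} (hp : p.totalDegree = 0)
    (i : Fin N) : MvPolynomial.pderiv i p = 0 := by
  rw [MvPolynomial.totalDegree_eq_zero_iff_eq_C.1 hp, MvPolynomial.pderiv_C]

theorem isHomogeneous_linPoly (A : Matrix (Fin N) (Fin N) ℝ) (i : Fin N) :
    (linPoly A i).IsHomogeneous 1 :=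
  MvPolynomial.IsHomogeneous.sum _ _ _ fun j _ => MvPolynomial.isHomogeneous_C_mul_X _ j

theorem isHomogeneous_polyDrift (A : Matrix (Fin N) (Fin N) ℝ) {q : MvPolynomial (Fin N) ℂ}
    {k : ℕ} (hq : q.IsHomogeneous k) : (polyDrift A q).IsHomogeneous k := by
  rw [polyDrift_apply]
  refine MvPolynomial.IsHomogeneous.sum _ _ _ fun i _ => ?_
  rcases Nat.eq_zero_or_pos k with rfl | hk
  · rw [pderiv_eq_zero_of_totalDegree (Nat.le_zero.1 hq.totalDegree_le), mul_zero]
    exact MvPolynomial.isHomogeneous_zero _ _ _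
  · have := (isHomogeneous_linPoly A i).mul (hq.pderiv (i := i))
    rwa [Nat.add_sub_cancel' hk] at this

theorem totalDegree_polyDrift_le (A : Matrix (Fin N) (Fin N) ℝ) (p : MvPolynomial (Fin N) ℂ) :
    (polyDrift A p).totalDegree ≤ p.totalDegree := by
  conv_lhs => rw [← MvPolynomial.sum_homogeneousComponent p, map_sum]
  refine MvPolynomial.totalDegree_finsetSum_le fun j hj => ?_
  refine (isHomogeneous_polyDrift A
    (MvPolynomial.homogeneousComponent_isHomogeneous j p)).totalDegree_le.trans ?_
  have := Finset.mem_range.1 hj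
  omega

theorem totalDegree_polyLaplacian_le (p : MvPolynomial (Fin N) ℂ) :
    (polyLaplacian p).totalDegree ≤ p.totalDegree - 1 := by
  rw [polyLaplacian_apply]
  refine MvPolynomial.totalDegree_finsetSum_le fun i _ => ?_
  have h1 := totalDegree_pderiv_le p i
  have h2 := totalDegree_pderiv_le (MvPolynomial.pderiv i p) i
  omega

theorem homogeneousComponent_polyDrift (A : Matrix (Fin N) (Fin N) ℝ)
    (p : MvPolynomial (Fin N) ℂ) (k : ℕ) :
    MvPolynomial.homogeneousComponent k (polyDrift A p) =
      polyDrift A (MvPolynomial.homogeneousComponent k p) := by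
  have h : ∀ j, MvPolynomial.homogeneousComponent k
      (polyDrift A (MvPolynomial.homogeneousComponent j p)) =
      if k = j then polyDrift A (MvPolynomial.homogeneousComponent j p) else 0 := fun j => by
    rw [MvPolynomial.homogeneousComponent_of_mem (isHomogeneous_polyDrift A
      (MvPolynomial.homogeneousComponent_isHomogeneous j p))]
  conv_lhs => rw [← MvPolynomial.sum_homogeneousComponent p]
  simp only [map_sum, h]
  rw [Finset.sum_ite_eq]
  split_ifs with hk
  · rfl
  · rw [MvPolynomial.homogeneousComponent_eq_zero _ _ (by
      rw [Finset.mem_range] at hk; omega), map_zero]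

theorem homogeneousComponent_polyLaplacian (p : MvPolynomial (Fin N) ℂ) :
    MvPolynomial.homogeneousComponent p.totalDegree (polyLaplacian p) = 0 := by
  rcases Nat.eq_zero_or_pos p.totalDegree with h0 | hpos
  · simp [polyLaplacian_apply, pderiv_eq_zero_of_totalDegree h0]
  · refine MvPolynomial.homogeneousComponent_eq_zero _ _ ?_
    have := totalDegree_polyLaplacian_le p
    omega

theorem homogeneousComponent_totalDegree_ne_zero {p : MvPolynomial (Fin N) ℂ} (hp : p ≠ 0) :
    MvPolynomial.homogeneousComponent p.totalDegree p ≠ 0 := by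
  obtain ⟨d, hd, hdeg⟩ := Finset.exists_mem_eq_sup p.support (MvPolynomial.support_nonempty.2 hp)
    (fun s => s.sum fun _ e => e)
  intro h
  have h1 := congrArg (MvPolynomial.coeff d) h
  rw [MvPolynomial.coeff_homogeneousComponent, if_pos, MvPolynomial.coeff_zero] at h1
  · exact MvPolynomial.mem_support_iff.1 hd h1
  · rw [MvPolynomial.totalDegree, hdeg]
    rfl

/-- Eigenvalues of the Ornstein-Uhlenbeck operator on polynomials. -/
theorem le_re_of_ornsteinUhlenbeck [NeZero N] {X A : Matrix (Fin N) (Fin N) ℝ} (hX : X.PosDef)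
    {δ : ℝ} (hδ : ∀ v : Fin N → ℝ, δ * (v ⬝ᵥ X *ᵥ v) ≤ (A *ᵥ v) ⬝ᵥ (X *ᵥ v))
    {p : MvPolynomial (Fin N) ℂ} (hp : p ≠ 0) {w : ℂ}
    (h : (2 : ℂ) • polyDrift A p - polyLaplacian p = w • p) :
    2 * (p.totalDegree * δ) ≤ w.re := by
  -- The Laplacian lowers the degree, so the leading component is an eigenvector of the drift alone,
  -- with eigenvalue w/2.
  have h1 := congrArg (MvPolynomial.homogeneousComponent p.totalDegree) h
  rw [map_sub, map_smul, homogeneousComponent_polyDrift, homogeneousComponent_polyLaplacian,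
    sub_zero, map_smul] at h1
  have h2 : polyDrift A (MvPolynomial.homogeneousComponent p.totalDegree p) =
      (w / 2) • MvPolynomial.homogeneousComponent p.totalDegree p := by
    rw [div_eq_inv_mul, ← smul_smul, ← h1, smul_smul]
    norm_num
  have h3 := le_re_of_polyDrift_eq_smul hX hδ (homogeneousComponent_totalDegree_ne_zero hp)
    (MvPolynomial.homogeneousComponent_isHomogeneous _ p) h2
  have h4 : (w / 2).re = w.re / 2 := by simp
  rw [h4] at h3
  linarith

/-- Solvability of the Ornstein-Uhlenbeck resolvent equation in polynomials. -/
theorem exists_ornsteinUhlenbeck [NeZero N] {X A : Matrix (Fin N) (Fin N) ℝ} (hX : X.PosDef)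
    (hA : (Aᵀ * X + X * A).PosDef) {w : ℂ} (hw : 0 < w.re) (r : MvPolynomial (Fin N) ℂ) :
    ∃ p : MvPolynomial (Fin N) ℂ,
      w • p + (2 : ℂ) • polyDrift A p - polyLaplacian p = r := by
  have hδ : ∀ v : Fin N → ℝ, 0 * (v ⬝ᵥ X *ᵥ v) ≤ (A *ᵥ v) ⬝ᵥ (X *ᵥ v) := fun v => by
    have h1 := hA.posSemidef.quadratic_nonneg v
    rw [dotProduct_lyapunov hX.posSemidef.isSymm] at h1
    linarith
  let G : MvPolynomial (Fin N) ℂ →ₗ[ℂ] MvPolynomial (Fin N) ℂ :=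
    w • LinearMap.id + (2 : ℂ) • polyDrift A - polyLaplacian
  have hG : ∀ p ∈ MvPolynomial.restrictTotalDegree (Fin N) ℂ r.totalDegree,
      G p ∈ MvPolynomial.restrictTotalDegree (Fin N) ℂ r.totalDegree := by
    intro p hp
    refine Submodule.sub_mem _ (Submodule.add_mem _ (Submodule.smul_mem _ _ hp)
      (Submodule.smul_mem _ _ ?_)) ?_
    · rw [MvPolynomial.mem_restrictTotalDegree] at hp ⊢
      exact (totalDegree_polyDrift_le A p).trans hp
    · rw [MvPolynomial.mem_restrictTotalDegree] at hp ⊢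
      have := totalDegree_polyLaplacian_le p
      omega
  -- A kernel element would have eigenvalue -w with negative real part. Polynomials of degree at
  -- most deg r form a finite-dimensional invariant space, so injectivity gives surjectivity.
  have hinj : Function.Injective (G.restrict hG) := by
    rw [injective_iff_map_eq_zero]
    rintro ⟨p, hp⟩ h
    have h1 : w • p + (2 : ℂ) • polyDrift A p - polyLaplacian p = 0 := congrArg Subtype.val h
    by_contra hne
    have hp0 : p ≠ 0 := fun h0 => hne (Subtype.ext h0)
    have h2 := le_re_of_ornsteinUhlenbeck hX hδ hp0 (w := -w) (by
      rw [neg_smul, ← sub_eq_zero, ← h1]; abel)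
    simp at h2
    linarith
  obtain ⟨p, hp⟩ := LinearMap.injective_iff_surjective.1 hinj
    ⟨r, (MvPolynomial.mem_restrictTotalDegree _ _ _).2 le_rfl⟩
  exact ⟨p, congrArg Subtype.val hp⟩

end PolynomialDegree

/-! ### Energy identities and coercivity -/

section Energy

variable {N : ℕ}

/-- The embedding of Schwartz functions into `L²`. -/
noncomputable def toL2 : 𝓢(Euc N, ℂ) →L[ℂ] L2 N :=
  SchwartzMap.toLpCLM ℂ ℂ 2 (volume : Measure (Euc N))

theorem toL2_apply (u : 𝓢(Euc N, ℂ)) : toL2 u = u.toLp 2 volume := rfl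

theorem toL2_smul (a : ℂ) (u : 𝓢(Euc N, ℂ)) : toL2 (a • u) = a • toL2 u :=
  toL2.map_smul a u

theorem toL2_injective : Function.Injective (toL2 (N := N)) :=
  SchwartzMap.injective_toLp 2 volume

theorem inner_toL2 (u v : 𝓢(Euc N, ℂ)) :
    ⟪toL2 u, toL2 v⟫_ℂ = ∫ x, v x * starRingEnd ℂ (u x) := by
  exact SchwartzMap.inner_toL2_toL2_eq u v volume

theorem inner_mulX_left (i : Fin N) (u v : 𝓢(Euc N, ℂ)) :
    ⟪toL2 (mulX i u), toL2 v⟫_ℂ = ⟪toL2 u, toL2 (mulX i v)⟫_ℂ := by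
  rw [inner_toL2, inner_toL2]
  refine integral_congr_ae (Eventually.of_forall fun x => ?_)
  simp only [mulX_apply, map_mul, Complex.conj_ofReal]
  ring

theorem inner_partialD_left (i : Fin N) (u v : 𝓢(Euc N, ℂ)) :
    ⟪toL2 (partialD i u), toL2 v⟫_ℂ = -⟪toL2 u, toL2 (partialD i v)⟫_ℂ := by
  have h := SchwartzMap.integral_bilinear_lineDerivOp_right_eq_neg_left (μ := volume) u v
    ((ContinuousLinearMap.mul ℝ ℂ).comp (Complex.conjCLE : ℂ →L[ℝ] ℂ))
    (EuclideanSpace.single i (1 : ℝ) : Euc N)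
  rw [eq_neg_iff_add_eq_zero, add_comm, ← eq_neg_iff_add_eq_zero, inner_toL2, inner_toL2]
  simpa [partialD, mul_comm] using h

/-- The operator xⱼ∂ᵢ is skew-adjoint up to the commutator -δᵢⱼ; half of that constant survives in
the real part. -/
theorem re_inner_mulX_partialD (i j : Fin N) (v : 𝓢(Euc N, ℂ)) :
    (⟪toL2 v, toL2 (mulX j (partialD i v))⟫_ℂ).re =
      if j = i then -(1 / 2) * ‖toL2 v‖ ^ 2 else 0 := by
  have h1 : ⟪toL2 v, toL2 (mulX j (partialD i v))⟫_ℂ =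
      -⟪toL2 (mulX j (partialD i v)), toL2 v⟫_ℂ -
        if j = i then ⟪toL2 v, toL2 v⟫_ℂ else 0 := by
    rw [← inner_mulX_left, ← neg_neg ⟪toL2 (mulX j v), _⟫_ℂ, ← inner_partialD_left,
      partialD_mulX, map_add, inner_add_left, neg_add]
    split_ifs <;> simp [sub_eq_add_neg]
  have h2 : (⟪toL2 (mulX j (partialD i v)), toL2 v⟫_ℂ).re =
      (⟪toL2 v, toL2 (mulX j (partialD i v))⟫_ℂ).re := inner_re_symm (𝕜 := ℂ) _ _
  have h3 : (⟪toL2 v, toL2 v⟫_ℂ).re = ‖toL2 v‖ ^ 2 := inner_self_eq_norm_sq (𝕜 := ℂ) _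
  have h4 := congrArg Complex.re h1
  rw [Complex.sub_re, Complex.neg_re, h2, apply_ite Complex.re, h3] at h4
  split_ifs at h4 ⊢ <;> simp at h4 ⊢ <;> linarith

/-- Write S as a sum of rank-one matrices v vᵀ; each contributes the square of ‖∑ vᵢ wᵢ‖. -/
theorem re_sum_inner_nonneg {E : Type*} [NormedAddCommGroup E] [InnerProductSpace ℂ E]
    {S : Matrix (Fin N) (Fin N) ℝ} (hS : S.PosSemidef) (w : Fin N → E) :
    0 ≤ ∑ i, ∑ j, S i j * (⟪w i, w j⟫_ℂ).re := by
  obtain ⟨m, v, hv⟩ := Matrix.posSemidef_iff_eq_sum_vecMulVec.1 hS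
  have hS' : ∀ i j, S i j = ∑ l, v l i * v l j := fun i j => by
    rw [hv, Matrix.sum_apply]
    simp [vecMulVec_apply]
  have h : ∑ i, ∑ j, S i j * (⟪w i, w j⟫_ℂ).re =
      ∑ l, (⟪∑ i, (v l i : ℂ) • w i, ∑ j, (v l j : ℂ) • w j⟫_ℂ).re := by
    simp only [sum_inner, inner_sum, inner_smul_left, inner_smul_right, Complex.conj_ofReal,
      Complex.re_sum, Complex.re_ofReal_mul, hS', Finset.sum_mul]
    rw [Finset.sum_comm' (t' := Finset.univ) (s' := fun _ => Finset.univ) (by simp)]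
    rw [Finset.sum_congr rfl fun j _ => Finset.sum_comm, Finset.sum_comm]
    simp only [mul_assoc, mul_left_comm, Finset.mul_sum]
  rw [h]
  exact Finset.sum_nonneg fun l _ => inner_self_nonneg (𝕜 := ℂ)

/-- The energy `∑ ‖∂ᵢ v‖² + ∑ ‖xᵢ v‖² + ‖v‖²`. -/
noncomputable def energy (v : 𝓢(Euc N, ℂ)) : ℝ :=
  ∑ i, ‖toL2 (partialD i v)‖ ^ 2 + ∑ i, ‖toL2 (mulX i v)‖ ^ 2 + ‖toL2 v‖ ^ 2

theorem energy_nonneg (v : 𝓢(Euc N, ℂ)) : 0 ≤ energy v := by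
  unfold energy; positivity

theorem norm_partialD_le_energy (i : Fin N) (v : 𝓢(Euc N, ℂ)) :
    ‖toL2 (partialD i v)‖ ^ 2 ≤ energy v := by
  have h1 := Finset.single_le_sum (f := fun i => ‖toL2 (partialD i v)‖ ^ 2)
    (fun _ _ => sq_nonneg _) (Finset.mem_univ i)
  have h2 : 0 ≤ ∑ i, ‖toL2 (mulX i v)‖ ^ 2 := by positivity
  unfold energy
  nlinarith [sq_nonneg ‖toL2 v‖]

theorem norm_mulX_le_energy (i : Fin N) (v : 𝓢(Euc N, ℂ)) :
    ‖toL2 (mulX i v)‖ ^ 2 ≤ energy v := by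
  have h1 := Finset.single_le_sum (f := fun i => ‖toL2 (mulX i v)‖ ^ 2)
    (fun _ _ => sq_nonneg _) (Finset.mem_univ i)
  have h2 : 0 ≤ ∑ i, ‖toL2 (partialD i v)‖ ^ 2 := by positivity
  unfold energy
  nlinarith [sq_nonneg ‖toL2 v‖]

theorem norm_le_energy (v : 𝓢(Euc N, ℂ)) : ‖toL2 v‖ ^ 2 ≤ energy v := by
  have h2 : 0 ≤ ∑ i, ‖toL2 (partialD i v)‖ ^ 2 := by positivity
  have h3 : 0 ≤ ∑ i, ‖toL2 (mulX i v)‖ ^ 2 := by positivity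
  unfold energy
  linarith

/-- The real part of the quadratic form of `-(Δ + ⟨B x, ∇⟩ - ⟨x, K x⟩)`. -/
theorem re_inner_schwOp (B K : Matrix (Fin N) (Fin N) ℝ) (v : 𝓢(Euc N, ℂ)) :
    (⟪toL2 v, toL2 (schwOp B K v)⟫_ℂ).re =
      -∑ i, ‖toL2 (partialD i v)‖ ^ 2 - (1 / 2) * B.trace * ‖toL2 v‖ ^ 2
        - ∑ i, ∑ j, K i j * (⟪toL2 (mulX i v), toL2 (mulX j v)⟫_ℂ).re := by
  have h1 : ∀ i, (⟪toL2 v, toL2 (partialD i (partialD i v))⟫_ℂ).re =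
      -‖toL2 (partialD i v)‖ ^ 2 := fun i => by
    rw [← neg_neg ⟪toL2 v, _⟫_ℂ, ← inner_partialD_left, Complex.neg_re]
    congr 1
    exact inner_self_eq_norm_sq (𝕜 := ℂ) _
  have h2 : ∀ i j, (⟪toL2 v, toL2 (mulX i (mulX j v))⟫_ℂ).re =
      (⟪toL2 (mulX i v), toL2 (mulX j v)⟫_ℂ).re := fun i j => by rw [inner_mulX_left]
  simp only [schwOp_apply, map_add, map_sub, map_sum, map_smul, inner_add_right, inner_sub_right,
    inner_sum, inner_smul_right, Complex.add_re, Complex.sub_re, Complex.re_sum,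
    Complex.re_ofReal_mul, h1, h2, re_inner_mulX_partialD]
  simp only [mul_ite, mul_zero, Finset.sum_ite_eq', Finset.mem_univ, if_true,
    Finset.sum_neg_distrib, ← Finset.sum_mul, trace, diag_apply]
  ring

/-- After integration by parts the drift contributes only the constant ½ tr B, which a large ω
compensates; K > 0 controls the weights xᵢ. -/
theorem exists_energy_le {B K : Matrix (Fin N) (Fin N) ℝ} (hK : K.PosDef) :
    ∃ κ > 0, ∃ ω₀ : ℝ, ∀ ω ≥ ω₀, ∀ v : 𝓢(Euc N, ℂ),
      κ * energy v ≤ (⟪toL2 v, toL2 ((ω : ℂ) • v - schwOp B K v)⟫_ℂ).re := by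
  obtain ⟨c, hc, hcK⟩ := (PosDef.one (n := Fin N) (R := ℝ)).exists_coercive hK
  refine ⟨min 1 c, lt_min one_pos hc, min 1 c - (1 / 2) * B.trace, fun ω hω v => ?_⟩
  have hpsd : (K - c • (1 : Matrix (Fin N) (Fin N) ℝ)).PosSemidef := by
    refine posSemidef_of_isSymm (hK.posSemidef.isSymm.sub (isSymm_one.smul c)) fun w => ?_
    have := hcK w
    simp only [sub_mulVec, smul_mulVec, dotProduct_sub, dotProduct_smul, smul_eq_mul]
    linarith
  have h1 : c * ∑ i, ‖toL2 (mulX i v)‖ ^ 2 ≤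
      ∑ i, ∑ j, K i j * (⟪toL2 (mulX i v), toL2 (mulX j v)⟫_ℂ).re := by
    have h := re_sum_inner_nonneg hpsd fun i => toL2 (mulX i v)
    have h2 : ∀ i, (⟪toL2 (mulX i v), toL2 (mulX i v)⟫_ℂ).re = ‖toL2 (mulX i v)‖ ^ 2 :=
      fun i => inner_self_eq_norm_sq (𝕜 := ℂ) _
    simp only [← h2]
    generalize (fun i j => (⟪toL2 (mulX i v), toL2 (mulX j v)⟫_ℂ).re) = r at h
    simp only [Matrix.sub_apply, Matrix.smul_apply, Matrix.one_apply, smul_eq_mul, sub_mul,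
      mul_ite, mul_one, mul_zero, ite_mul, zero_mul, Finset.sum_sub_distrib, Finset.sum_ite_eq,
      Finset.mem_univ, if_true, ← Finset.mul_sum] at h
    linarith
  have h3 : (⟪toL2 v, toL2 v⟫_ℂ).re = ‖toL2 v‖ ^ 2 := inner_self_eq_norm_sq (𝕜 := ℂ) _
  have h9 : toL2 ((ω : ℂ) • v - schwOp B K v) = (ω : ℂ) • toL2 v - toL2 (schwOp B K v) := by
    rw [map_sub, toL2_smul]
  rw [h9, inner_sub_right, inner_smul_right, Complex.sub_re, re_inner_schwOp,
    Complex.re_ofReal_mul, h3, energy]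
  have h4 : 0 ≤ ∑ i, ‖toL2 (partialD i v)‖ ^ 2 := Finset.sum_nonneg fun _ _ => sq_nonneg _
  have h5 : 0 ≤ ∑ i, ‖toL2 (mulX i v)‖ ^ 2 := Finset.sum_nonneg fun _ _ => sq_nonneg _
  have h6 := mul_le_mul_of_nonneg_right (min_le_left 1 c) h4
  have h7 := mul_le_mul_of_nonneg_right (min_le_right 1 c) h5
  have h8 := mul_le_mul_of_nonneg_right hω (sq_nonneg ‖toL2 v‖)
  linarith

/-- The commutator with x_k is of first order, hence bounded by the energy. This allows the energy
estimate to be applied to x_k v. -/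
theorem schwOp_mulX (B K : Matrix (Fin N) (Fin N) ℝ) (k : Fin N) (v : 𝓢(Euc N, ℂ)) :
    schwOp B K (mulX k v) = mulX k (schwOp B K v) + (2 : ℂ) • partialD k v
      + ∑ j, (B k j : ℂ) • mulX j v := by
  have h1 : ∀ i, partialD i (partialD i (mulX k v)) = mulX k (partialD i (partialD i v)) +
      if k = i then (2 : ℂ) • partialD i v else 0 := fun i => by
    rw [partialD_mulX, map_add, partialD_mulX]
    split_ifs
    · rw [two_smul]; abel
    · simp
  have h2 : ∀ i j, (B i j : ℂ) • mulX j (partialD i (mulX k v)) =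
      mulX k ((B i j : ℂ) • mulX j (partialD i v)) +
        if k = i then (B i j : ℂ) • mulX j v else 0 := fun i j => by
    rw [partialD_mulX, map_add, mulX_comm j k, smul_add, map_smul]
    split_ifs <;> simp
  have h3 : ∀ i j, (K i j : ℂ) • mulX i (mulX j (mulX k v)) =
      mulX k ((K i j : ℂ) • mulX i (mulX j v)) := fun i j => by
    rw [mulX_comm j k, mulX_comm i k, map_smul]
  simp only [schwOp_apply, h1, h2, h3, map_add, map_sub, map_sum, Finset.sum_add_distrib,
    Finset.sum_ite_eq, Finset.mem_univ, if_true]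
  have h4 : (∑ i, ∑ j, if k = i then (B i j : ℂ) • mulX j v else 0) =
      ∑ j, (B k j : ℂ) • mulX j v := by
    rw [Finset.sum_comm]
    simp
  rw [h4]
  abel

end Energy

/-! ### A priori estimates for the full domain norm -/

section Apriori

variable {N : ℕ}

theorem norm_sum_sum_smul_le {E : Type*} [SeminormedAddCommGroup E] [NormedSpace ℂ E]
    (A : Matrix (Fin N) (Fin N) ℝ) (w : Fin N → Fin N → E) {C : ℝ} (hw : ∀ i j, ‖w i j‖ ≤ C) :
    ‖∑ i, ∑ j, (A i j : ℂ) • w i j‖ ≤ (∑ i, ∑ j, |A i j|) * C := by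
  refine (norm_sum_le _ _).trans ?_
  rw [Finset.sum_mul]
  refine Finset.sum_le_sum fun i _ => (norm_sum_le _ _).trans ?_
  rw [Finset.sum_mul]
  refine Finset.sum_le_sum fun j _ => ?_
  rw [norm_smul, Complex.norm_real, Real.norm_eq_abs]
  exact mul_le_mul_of_nonneg_left (hw i j) (abs_nonneg _)

/-- The squares of the norms that are controlled by the graph norm of `ω - L`. -/
theorem exists_energy_le_norm_sq {B K : Matrix (Fin N) (Fin N) ℝ} (hK : K.PosDef) :
    ∃ ω₀ : ℝ, ∀ ω ≥ ω₀, ∃ C : ℝ, 0 ≤ C ∧ ∀ v : 𝓢(Euc N, ℂ),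
      energy v ≤ C * ‖toL2 ((ω : ℂ) • v - schwOp B K v)‖ ^ 2 ∧
      ∀ k, energy (mulX k v) ≤ C * ‖toL2 ((ω : ℂ) • v - schwOp B K v)‖ ^ 2 := by
  obtain ⟨κ, hκ, ω₀, h⟩ := exists_energy_le (B := B) hK
  refine ⟨ω₀, fun ω hω => ?_⟩
  set β := ∑ i, ∑ j, |B i j| with hβ
  have hβ0 : 0 ≤ β := Finset.sum_nonneg fun _ _ => Finset.sum_nonneg fun _ _ => abs_nonneg _
  refine ⟨1 / κ ^ 2 + (2 / κ) * (1 / (2 * κ) + (2 + β) * (1 / κ ^ 2)), by positivity,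
    fun v => ?_⟩
  set f := (ω : ℂ) • v - schwOp B K v with hf
  set F := ‖toL2 f‖ with hF
  have hF0 : 0 ≤ F := norm_nonneg _
  have h1 : energy v ≤ 1 / κ ^ 2 * F ^ 2 := by
    have h2 := h ω hω v
    have h3 : (⟪toL2 v, toL2 f⟫_ℂ).re ≤ ‖toL2 v‖ * F :=
      (Complex.re_le_norm _).trans (norm_inner_le_norm _ _)
    have h4 := norm_le_energy v
    have h5 : ‖toL2 v‖ * F ≤ κ / 2 * ‖toL2 v‖ ^ 2 + 1 / (2 * κ) * F ^ 2 := by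
      have : κ / 2 * ‖toL2 v‖ ^ 2 + 1 / (2 * κ) * F ^ 2 - ‖toL2 v‖ * F =
          1 / (2 * κ) * (κ * ‖toL2 v‖ - F) ^ 2 := by field_simp; ring
      have h6 : 0 ≤ 1 / (2 * κ) * (κ * ‖toL2 v‖ - F) ^ 2 := by positivity
      linarith
    have h7 : κ / 2 * energy v ≤ 1 / (2 * κ) * F ^ 2 := by
      have := mul_le_mul_of_nonneg_left h4 (half_pos hκ).le
      linarith
    have h8 := mul_le_mul_of_nonneg_left h7 (by positivity : 0 ≤ 2 / κ)
    calc energy v = 2 / κ * (κ / 2 * energy v) := by field_simp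
      _ ≤ _ := h8
      _ = _ := by field_simp
  have hb : 0 ≤ (2 / κ) * (1 / (2 * κ) + (2 + β) * (1 / κ ^ 2)) := by positivity
  refine ⟨h1.trans (mul_le_mul_of_nonneg_right (by linarith) (sq_nonneg F)), fun k => ?_⟩
  have h2 := h ω hω (mulX k v)
  have h3 : (ω : ℂ) • mulX k v - schwOp B K (mulX k v) =
      mulX k f - ((2 : ℂ) • partialD k v + ∑ j, (B k j : ℂ) • mulX j v) := by
    rw [schwOp_mulX, hf, map_sub, map_smul]
    abel
  set s := Real.sqrt (energy v) with hs
  have hs2 : s ^ 2 = energy v := Real.sq_sqrt (energy_nonneg v)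
  have hX : ∀ i, ‖toL2 (mulX i v)‖ ≤ s := fun i => Real.le_sqrt_of_sq_le (norm_mulX_le_energy i v)
  have hD : ∀ i, ‖toL2 (partialD i v)‖ ≤ s :=
    fun i => Real.le_sqrt_of_sq_le (norm_partialD_le_energy i v)
  have h4 : ‖toL2 ((2 : ℂ) • partialD k v + ∑ j, (B k j : ℂ) • mulX j v)‖ ≤ (2 + β) * s := by
    rw [map_add, map_sum, toL2_smul]
    refine (norm_add_le _ _).trans ?_
    rw [norm_smul, Complex.norm_ofNat, add_mul]
    refine add_le_add (mul_le_mul_of_nonneg_left (hD k) zero_le_two) ?_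
    refine (norm_sum_le _ _).trans ?_
    have h5 : ∑ j, |B k j| ≤ β := Finset.single_le_sum (f := fun i => ∑ j, |B i j|)
      (fun _ _ => Finset.sum_nonneg fun _ _ => abs_nonneg _) (Finset.mem_univ k)
    refine le_trans ?_ (mul_le_mul_of_nonneg_right h5 (Real.sqrt_nonneg _))
    rw [Finset.sum_mul]
    refine Finset.sum_le_sum fun j _ => ?_
    rw [toL2_smul, norm_smul, Complex.norm_real, Real.norm_eq_abs]
    exact mul_le_mul_of_nonneg_left (hX j) (abs_nonneg _)
  -- Moving x_k across the inner product turns ⟨x_k v, x_k f⟩ into ⟨x_k² v, f⟩, so no weighted norm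
  -- of f appears; the factor x_k² v is absorbed by the energy of x_k v.
  have h5 : (⟪toL2 (mulX k v), toL2 ((ω : ℂ) • mulX k v - schwOp B K (mulX k v))⟫_ℂ).re ≤
      ‖toL2 (mulX k (mulX k v))‖ * F + s * ((2 + β) * s) := by
    rw [h3, map_sub, inner_sub_right, ← inner_mulX_left, Complex.sub_re, sub_eq_add_neg]
    refine add_le_add ((Complex.re_le_norm _).trans (norm_inner_le_norm _ _)) ?_
    refine (neg_le_abs _).trans ((Complex.abs_re_le_norm _).trans
      ((norm_inner_le_norm _ _).trans ?_))
    exact mul_le_mul (hX k) h4 (norm_nonneg _) (Real.sqrt_nonneg _)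
  set y := ‖toL2 (mulX k (mulX k v))‖ with hy
  have h6 : y ^ 2 ≤ energy (mulX k v) := norm_mulX_le_energy k (mulX k v)
  have h7 : y * F ≤ κ / 2 * y ^ 2 + 1 / (2 * κ) * F ^ 2 := by
    have : κ / 2 * y ^ 2 + 1 / (2 * κ) * F ^ 2 - y * F =
        1 / (2 * κ) * (κ * y - F) ^ 2 := by field_simp; ring
    have h6 : 0 ≤ 1 / (2 * κ) * (κ * y - F) ^ 2 := by positivity
    linarith
  have h8 : κ / 2 * energy (mulX k v) ≤ (1 / (2 * κ) + (2 + β) * (1 / κ ^ 2)) * F ^ 2 := by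
    have h9 := mul_le_mul_of_nonneg_left h6 (half_pos hκ).le
    have h10 : s * ((2 + β) * s) ≤ (2 + β) * (1 / κ ^ 2 * F ^ 2) := by
      rw [← hs2] at h1
      calc s * ((2 + β) * s) = (2 + β) * s ^ 2 := by ring
        _ ≤ _ := mul_le_mul_of_nonneg_left h1 (by positivity)
    linarith
  have h11 := mul_le_mul_of_nonneg_left h8 (by positivity : 0 ≤ 2 / κ)
  have h12 : 2 / κ * (κ / 2 * energy (mulX k v)) = energy (mulX k v) := by field_simp
  have h13 : 0 ≤ 1 / κ ^ 2 * F ^ 2 := by positivity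
  rw [h12] at h11
  linarith

/-- The sum of the second derivatives of a Schwartz function. -/
noncomputable def schwLaplacian : 𝓢(Euc N, ℂ) →L[ℂ] 𝓢(Euc N, ℂ) :=
  ∑ i, (partialD i).comp (partialD i)

theorem schwLaplacian_apply (v : 𝓢(Euc N, ℂ)) :
    schwLaplacian v = ∑ i, partialD i (partialD i v) := by
  simp [schwLaplacian]

/-- The energy of xⱼv bounds xᵢxⱼv and, up to a commutator, xⱼ∂ᵢv. The equation then expresses Δv
through terms already bounded. -/
theorem exists_norm_le {B K : Matrix (Fin N) (Fin N) ℝ} (hK : K.PosDef) :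
    ∃ ω₀ : ℝ, ∀ ω ≥ ω₀, ∃ C : ℝ, 0 ≤ C ∧ ∀ v : 𝓢(Euc N, ℂ),
      energy v ≤ C * ‖toL2 ((ω : ℂ) • v - schwOp B K v)‖ ^ 2 ∧
      ‖toL2 v‖ ≤ C * ‖toL2 ((ω : ℂ) • v - schwOp B K v)‖ ∧
      (∀ i j, ‖toL2 (mulX i (mulX j v))‖ ≤ C * ‖toL2 ((ω : ℂ) • v - schwOp B K v)‖) ∧
      ‖toL2 (schwLaplacian v)‖ ≤ C * ‖toL2 ((ω : ℂ) • v - schwOp B K v)‖ := by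
  obtain ⟨ω₀, h⟩ := exists_energy_le_norm_sq (B := B) hK
  refine ⟨ω₀, fun ω hω => ?_⟩
  obtain ⟨C, hC, h⟩ := h ω hω
  set β := ∑ i, ∑ j, |B i j| with hβ
  have hβ0 : 0 ≤ β := Finset.sum_nonneg fun _ _ => Finset.sum_nonneg fun _ _ => abs_nonneg _
  set γ := ∑ i, ∑ j, |K i j| with hγ
  have hγ0 : 0 ≤ γ := Finset.sum_nonneg fun _ _ => Finset.sum_nonneg fun _ _ => abs_nonneg _
  set D := Real.sqrt C with hD
  have hD0 : 0 ≤ D := Real.sqrt_nonneg _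
  have hR : 0 ≤ |ω| * D + 1 + β * (2 * D) + γ * D := by positivity
  refine ⟨C + D + (|ω| * D + 1 + β * (2 * D) + γ * D), by positivity, fun v => ?_⟩
  obtain ⟨h1, h2⟩ := h v
  set f := (ω : ℂ) • v - schwOp B K v with hf
  set F := ‖toL2 f‖ with hF
  have hF0 : 0 ≤ F := norm_nonneg _
  have key : ∀ {a e : ℝ}, a ^ 2 ≤ e → e ≤ C * F ^ 2 → a ≤ D * F := fun {a e} ha he => by
    have h3 : D * F = Real.sqrt (C * F ^ 2) := by rw [Real.sqrt_mul hC, Real.sqrt_sq hF0]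
    rw [h3]
    exact Real.le_sqrt_of_sq_le (ha.trans he)
  have hv := key (norm_le_energy v) h1
  have hXX : ∀ i j, ‖toL2 (mulX i (mulX j v))‖ ≤ D * F :=
    fun i j => key (norm_mulX_le_energy i (mulX j v)) (h2 j)
  have hXD : ∀ i j, ‖toL2 (mulX j (partialD i v))‖ ≤ 2 * D * F := fun i j => by
    have h3 : mulX j (partialD i v) = partialD i (mulX j v) - if j = i then v else 0 := by
      rw [partialD_mulX, add_sub_cancel_right]
    have h4 := key (norm_partialD_le_energy i (mulX j v)) (h2 j)
    have h5 : ‖toL2 (if j = i then v else 0)‖ ≤ D * F := by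
      split_ifs
      · exact hv
      · rw [map_zero, norm_zero]; positivity
    rw [h3, map_sub]
    refine (norm_sub_le _ _).trans ?_
    linarith
  have hL : schwLaplacian v = (ω : ℂ) • v - f - (∑ i, ∑ j, (B i j : ℂ) • mulX j (partialD i v))
      + ∑ i, ∑ j, (K i j : ℂ) • mulX i (mulX j v) := by
    rw [hf, schwLaplacian_apply, schwOp_apply]
    abel
  have hΔ : ‖toL2 (schwLaplacian v)‖ ≤ (|ω| * D + 1 + β * (2 * D) + γ * D) * F := by
    have h3 : ‖toL2 (∑ i, ∑ j, (B i j : ℂ) • mulX j (partialD i v))‖ ≤ β * (2 * D * F) := by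
      simp only [map_sum, toL2_smul]
      exact norm_sum_sum_smul_le B _ hXD
    have h4 : ‖toL2 (∑ i, ∑ j, (K i j : ℂ) • mulX i (mulX j v))‖ ≤ γ * (D * F) := by
      simp only [map_sum, toL2_smul]
      exact norm_sum_sum_smul_le K _ hXX
    have h5 : ‖toL2 ((ω : ℂ) • v)‖ ≤ |ω| * (D * F) := by
      rw [toL2_smul, norm_smul, Complex.norm_real, Real.norm_eq_abs]
      exact mul_le_mul_of_nonneg_left hv (abs_nonneg _)
    rw [hL, map_add, map_sub, map_sub]
    refine (norm_add_le _ _).trans ((add_le_add_left ((norm_sub_le _ _).trans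
      (add_le_add_left (norm_sub_le _ _) _)) _).trans ?_)
    rw [← hF]
    linarith
  have hCF : 0 ≤ C * F := by positivity
  have hCF2 : 0 ≤ C * F ^ 2 := by positivity
  have hDF : 0 ≤ D * F := by positivity
  have hRF : 0 ≤ (|ω| * D + 1 + β * (2 * D) + γ * D) * F := by positivity
  have hDF2 : 0 ≤ D * F ^ 2 := by positivity
  have hRF2 : 0 ≤ (|ω| * D + 1 + β * (2 * D) + γ * D) * F ^ 2 := by positivity
  refine ⟨?_, ?_, fun i j => (hXX i j).trans ?_, hΔ.trans ?_⟩
  · linarith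
  · linarith
  · linarith
  · linarith

end Apriori

/-! ### Density of polynomials times a Gaussian -/

section Density

variable {N : ℕ}

theorem integrable_schwartz_mul (φ : 𝓢(Euc N, ℂ)) {u : Euc N → ℂ} (hu : MemLp u 2 volume) :
    Integrable (fun x => φ x * u x) volume :=
  MemLp.integrable_mul (φ.memLp 2 volume) hu

/-- Expand the exponential in its power series: each term is a polynomial times the Gaussian and
integrates to zero, and dominated convergence allows termwise integration. -/
theorem integral_cexp_mul_gaussian_eq_zero {S : Matrix (Fin N) (Fin N) ℝ} (hS : S.PosDef)
    {u : Euc N → ℂ} (hu : MemLp u 2 volume) (h : ∀ p, ∫ x, polyGauss S p x * u x = 0)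
    (w : Euc N) :
    ∫ x, Complex.exp (((-2 * Real.pi * ⟪x, w⟫_ℝ : ℝ) : ℂ) * Complex.I) * (gaussian S x * u x)
      = 0 := by
  set w' : Euc N := (2 * Real.pi) • w with hw'
  have hinner : ∀ x : Euc N, ⟪x, w'⟫_ℝ = 2 * Real.pi * ⟪x, w⟫_ℝ := fun x => by
    rw [hw', real_inner_smul_right]
  let q : MvPolynomial (Fin N) ℂ :=
    ∑ i, MvPolynomial.C (-Complex.I * ((w' i : ℝ) : ℂ)) * MvPolynomial.X i
  have hq : ∀ x, polyFun q x = ((-2 * Real.pi * ⟪x, w⟫_ℝ : ℝ) : ℂ) * Complex.I := fun x => by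
    have h1 : -2 * Real.pi * ⟪x, w⟫_ℝ = -⟪x, w'⟫_ℝ := by rw [hinner]; ring
    rw [h1, PiLp.inner_apply]
    simp only [q, polyFun, map_sum, map_mul, MvPolynomial.eval_C, MvPolynomial.eval_X,
      RCLike.inner_apply, conj_trivial, Complex.ofReal_neg, Complex.ofReal_sum, Complex.ofReal_mul,
      neg_mul, Finset.sum_neg_distrib, Finset.sum_mul]
    exact congrArg Neg.neg (Finset.sum_congr rfl fun i _ => by ring)
  let p : ℕ → MvPolynomial (Fin N) ℂ := fun k => MvPolynomial.C ((k.factorial : ℂ)⁻¹) * q ^ k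
  have hp : ∀ k x, polyFun (p k) x = polyFun q x ^ k / (k.factorial : ℂ) := fun k x => by
    simp only [p, polyFun, map_mul, MvPolynomial.eval_C, map_pow]
    rw [div_eq_inv_mul]
  have hl : (fun x : Euc N => ⟪x, w'⟫_ℝ).HasTemperateGrowth := by
    have : (fun x : Euc N => ⟪x, w'⟫_ℝ) = innerSL ℝ w' := by
      funext x
      rw [innerSL_apply_apply, real_inner_comm]
    rw [this]
    exact (innerSL ℝ w').hasTemperateGrowth
  -- The partial sums are dominated through e^{|l|} ≤ e^l + e^{-l}; each summand times the Gaussian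
  -- is Schwartz, so it is integrable against u.
  obtain ⟨γ₁, hγ₁⟩ := exists_gaussian_mul_exp hS hl (a := ‖w'‖) fun x => by
    rw [mul_comm]; exact real_inner_le_norm _ _
  obtain ⟨γ₂, hγ₂⟩ := exists_gaussian_mul_exp hS (l := fun x : Euc N => -⟪x, w'⟫_ℝ) (by fun_prop)
    (a := ‖w'‖) fun x => by
      rw [mul_comm]; exact (neg_le_abs _).trans (abs_real_inner_le_norm _ _)
  have hsum : HasSum (fun k => ∫ x, polyGauss S (p k) x * u x)
      (∫ x, Complex.exp (((-2 * Real.pi * ⟪x, w⟫_ℝ : ℝ) : ℂ) * Complex.I) *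
        (gaussian S x * u x)) := by
    have hbs : ∀ x : Euc N, HasSum (fun k : ℕ => |⟪x, w'⟫_ℝ| ^ k / k.factorial *
        ‖gaussian S x * u x‖) (Real.exp |⟪x, w'⟫_ℝ| * ‖gaussian S x * u x‖) := fun x => by
      refine HasSum.mul_right _ ?_
      rw [Real.exp_eq_exp_ℝ]
      exact NormedSpace.expSeries_div_hasSum_exp |⟪x, w'⟫_ℝ|
    refine hasSum_integral_of_dominated_convergence
      (fun k x => |⟪x, w'⟫_ℝ| ^ k / k.factorial * ‖gaussian S x * u x‖) (fun k => ?_) (fun k => ?_)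
      (Eventually.of_forall fun x => (hbs x).summable) ?_ (Eventually.of_forall fun x => ?_)
    · exact (integrable_schwartz_mul _ hu).aestronglyMeasurable
    · refine Eventually.of_forall fun x => ?_
      rw [polyGauss_apply, mul_assoc, norm_mul, hp, hq, norm_div, norm_pow, norm_mul,
        Complex.norm_I, mul_one, Complex.norm_real, Real.norm_eq_abs, Complex.norm_natCast, hinner,
        mul_assoc (-2 : ℝ), neg_mul, abs_neg, mul_assoc]
    · simp only [(hbs _).tsum_eq]
      refine Integrable.mono' ((integrable_schwartz_mul γ₁ hu).norm.add
        (integrable_schwartz_mul γ₂ hu).norm) ?_ (Eventually.of_forall fun x => ?_)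
      · have h1 := (integrable_schwartz_mul (gaussian S) hu).aestronglyMeasurable.norm
        have h2 : Continuous fun x : Euc N => Real.exp |⟪x, w'⟫_ℝ| := by fun_prop
        exact h2.aestronglyMeasurable.mul h1
      · simp only [Pi.add_apply]
        rw [norm_mul, norm_norm, Real.norm_of_nonneg (Real.exp_pos _).le, norm_mul, norm_mul,
          norm_mul, hγ₁, hγ₂, gaussian_apply hS, Complex.norm_real, Complex.norm_real,
          Complex.norm_real, Real.norm_of_nonneg (Real.exp_pos _).le,
          Real.norm_of_nonneg (Real.exp_pos _).le, Real.norm_of_nonneg (Real.exp_pos _).le,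
          Real.exp_add, Real.exp_add, ← mul_assoc, ← add_mul, ← mul_add, mul_comm (Real.exp |_|)]
        gcongr
        rcases abs_cases ⟪x, w'⟫_ℝ with ⟨h1, _⟩ | ⟨h1, _⟩ <;> rw [h1]
        · linarith [Real.exp_pos (-⟪x, w'⟫_ℝ)]
        · linarith [Real.exp_pos ⟪x, w'⟫_ℝ]
    · have h1 : ∀ k, polyGauss S (p k) x * u x =
          polyFun (p k) x * (gaussian S x * u x) := fun k => by rw [polyGauss_apply, mul_assoc]
      simp only [h1]
      refine HasSum.mul_right _ ?_
      simp only [hp, hq]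
      rw [Complex.exp_eq_exp_ℂ]
      exact NormedSpace.expSeries_div_hasSum_exp _
  simp only [h] at hsum
  exact hsum.unique hasSum_zero

/-- The Gaussian times u is integrable with vanishing Fourier transform, hence zero almost
everywhere; the Gaussian itself has no zeros. -/
theorem ae_eq_zero_of_forall_integral_polyGauss {S : Matrix (Fin N) (Fin N) ℝ} (hS : S.PosDef)
    {u : Euc N → ℂ} (hu : MemLp u 2 volume) (h : ∀ p, ∫ x, polyGauss S p x * u x = 0) :
    u =ᵐ[volume] 0 := by
  set g : Euc N → ℂ := fun x => gaussian S x * u x with hg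
  have hgi : Integrable g volume := integrable_schwartz_mul _ hu
  have hF : ∀ w, FourierTransform.fourier g w = 0 := fun w => by
    rw [Real.fourier_eq']
    exact integral_cexp_mul_gaussian_eq_zero hS hu h w
  -- Write ψ as the transform of its inverse transform and move the Fourier transform onto g.
  have h1 : ∀ ψ : 𝓢(Euc N, ℂ), ∫ x, ψ x * g x = 0 := fun ψ => by
    have h2 := VectorFourier.integral_fourierIntegral_smul_eq_flip (e := Real.fourierChar)
      (μ := volume) (ν := volume) (L := innerₗ (Euc N)) (f := g)
      (g := fun x => (FourierTransformInv.fourierInv ψ) x)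
      Real.continuous_fourierChar continuous_inner hgi (SchwartzMap.integrable _)
    have h3 : ∀ x, VectorFourier.fourierIntegral Real.fourierChar volume (innerₗ (Euc N)).flip
        (fun x => (FourierTransformInv.fourierInv ψ) x) x = ψ x := fun x => by
      have h4 : FourierTransform.fourier (FourierTransformInv.fourierInv ψ) = ψ :=
        FourierTransform.fourier_fourierInv_eq ψ
      rw [flip_innerₗ]
      conv_rhs => rw [← h4]
      rfl
    have h5 : ∀ x, VectorFourier.fourierIntegral Real.fourierChar volume (innerₗ (Euc N)) g x = 0 :=
      hF
    simp only [h3, h5, smul_eq_mul, zero_mul, integral_zero] at h2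
    rw [h2]
    simp only [mul_comm]
  have h6 : g =ᵐ[volume] 0 := by
    have hm : MemLp g 1 volume := memLp_one_iff_integrable.2 hgi
    have h7 : Lp.toTemperedDistributionCLM ℂ (volume : Measure (Euc N)) 1 hm.toLp = 0 := by
      ext ψ
      rw [Lp.toTemperedDistributionCLM_apply, Lp.toTemperedDistribution_apply]
      refine Eq.trans (integral_congr_ae ?_) (h1 ψ)
      filter_upwards [hm.coeFn_toLp] with x hx
      rw [hx, smul_eq_mul]
    have h8 : hm.toLp = 0 := by
      have hker := Lp.ker_toTemperedDistributionCLM_eq_bot (E := Euc N) (F := ℂ)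
        (μ := (volume : Measure (Euc N))) (p := 1)
      exact LinearMap.ker_eq_bot'.1 hker _ h7
    exact hm.coeFn_toLp.symm.trans (by rw [h8]; exact Lp.coeFn_zero _ _ _)
  filter_upwards [h6] with x hx
  have h9 : gaussian S x ≠ 0 := by
    rw [gaussian_apply hS]
    exact_mod_cast (Real.exp_pos _).ne'
  exact (mul_eq_zero.1 hx).resolve_left h9

/-- Polynomials times a Gaussian are dense in `L²`. -/
theorem denseRange_polyGauss {S : Matrix (Fin N) (Fin N) ℝ} (hS : S.PosDef) :
    DenseRange fun p => toL2 (polyGauss S p) := by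
  let f : MvPolynomial (Fin N) ℂ →ₗ[ℂ] L2 N := toL2.toLinearMap ∘ₗ polyGauss S
  have h1 : (LinearMap.range f).topologicalClosure = ⊤ := by
    rw [Submodule.topologicalClosure_eq_top_iff, Submodule.eq_bot_iff]
    intro u hu
    have hu0 : ∀ p, ⟪toL2 (polyGauss S p), u⟫_ℂ = 0 := fun p => hu _ ⟨p, rfl⟩
    rw [Lp.eq_zero_iff_ae_eq_zero]
    refine ae_eq_zero_of_forall_integral_polyGauss hS (Lp.memLp u) fun p => ?_
    -- Coefficients are conjugated because the inner product is conjugate linear in its first slot,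
    -- whereas the criterion uses the bilinear pairing.
    rw [← hu0 (MvPolynomial.map (starRingEnd ℂ) p), L2.inner_def]
    refine integral_congr_ae ?_
    filter_upwards [(polyGauss S (MvPolynomial.map (starRingEnd ℂ) p)).coeFn_toLp 2 volume]
      with x hx
    rw [toL2_apply, hx, RCLike.inner_apply, polyGauss_apply, polyGauss_apply, gaussian_apply hS,
      map_mul, Complex.conj_ofReal, mul_comm (u x)]
    congr 2
    rw [polyFun, polyFun, MvPolynomial.eval_map, ← MvPolynomial.eval₂_id]
    rw [← MvPolynomial.coe_eval₂Hom, ← MvPolynomial.coe_eval₂Hom, ← RingHom.comp_apply]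
    congr 1
    refine MvPolynomial.ringHom_ext (fun a => ?_) fun i => ?_
    · simp
    · simp
  intro x
  have h2 : x ∈ (LinearMap.range f).topologicalClosure := by rw [h1]; trivial
  exact h2

end Density

/-! ### The operator on tempered distributions -/

section Distributions

variable {N : ℕ}

theorem hasTemperateGrowth_linearField_ofReal (B : Matrix (Fin N) (Fin N) ℝ) (i : Fin N) :
    (fun x : Euc N => ((linearField B x i : ℝ) : ℂ)).HasTemperateGrowth :=
  hasTemperateGrowth_ofReal_comp (hasTemperateGrowth_linearField B i)

theorem hasTemperateGrowth_quadForm_ofReal (K : Matrix (Fin N) (Fin N) ℝ) :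
    (fun x : Euc N => ((quadForm K x : ℝ) : ℂ)).HasTemperateGrowth :=
  hasTemperateGrowth_ofReal_comp (hasTemperateGrowth_quadForm K)

theorem smulLeftCLM_linearField (B : Matrix (Fin N) (Fin N) ℝ) (i : Fin N) (φ : 𝓢(Euc N, ℂ)) :
    SchwartzMap.smulLeftCLM ℂ (fun x : Euc N => ((linearField B x i : ℝ) : ℂ)) φ =
      ∑ j, (B i j : ℂ) • mulX j φ := by
  ext x
  rw [SchwartzMap.smulLeftCLM_apply_apply (hasTemperateGrowth_linearField_ofReal B i),
    linearField_apply]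
  simp [Finset.sum_mul, mul_assoc]

theorem smulLeftCLM_quadForm (K : Matrix (Fin N) (Fin N) ℝ) (φ : 𝓢(Euc N, ℂ)) :
    SchwartzMap.smulLeftCLM ℂ (fun x : Euc N => ((quadForm K x : ℝ) : ℂ)) φ =
      ∑ i, ∑ j, (K i j : ℂ) • mulX i (mulX j φ) := by
  ext x
  rw [SchwartzMap.smulLeftCLM_apply_apply (hasTemperateGrowth_quadForm_ofReal K), quadForm_eq]
  simp [Finset.sum_mul, mul_assoc]

theorem laplacian_eq_schwLaplacian (φ : 𝓢(Euc N, ℂ)) : Δ φ = schwLaplacian φ := by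
  rw [schwLaplacian_apply, SchwartzMap.laplacian_eq_sum (EuclideanSpace.basisFun (Fin N) ℝ)]
  simp [partialD]

theorem smulLeftCLM_linearField_partialD_sum (B : Matrix (Fin N) (Fin N) ℝ) (φ : 𝓢(Euc N, ℂ)) :
    ∑ i, partialD i (∑ j, (B i j : ℂ) • mulX j φ) =
      ∑ i, ∑ j, (B i j : ℂ) • mulX j (partialD i φ) + (B.trace : ℂ) • φ := by
  have h : ∀ i, partialD i (∑ j, (B i j : ℂ) • mulX j φ) =
      ∑ j, (B i j : ℂ) • mulX j (partialD i φ) + (B i i : ℂ) • φ := fun i => by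
    simp only [map_sum, map_smul, partialD_mulX, smul_add, Finset.sum_add_distrib, smul_ite,
      smul_zero, Finset.sum_ite_eq', Finset.mem_univ, if_true]
  simp only [h, Finset.sum_add_distrib, trace, diag_apply, Complex.ofReal_sum, Finset.sum_smul]

/-- The quadratic operator on distributions is the transpose of `schwOp (-B) K - tr B + c`. -/
theorem quadOpDist_apply_apply (B K : Matrix (Fin N) (Fin N) ℝ) (c : ℝ) (T : 𝓢'(Euc N, ℂ))
    (φ : 𝓢(Euc N, ℂ)) :
    quadOpDist B K c T φ = T (schwOp (-B) K φ + ((c - B.trace : ℝ) : ℂ) • φ) := by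
  have h1 : quadOpDist B K c T φ = T (schwLaplacian φ) -
      ∑ i, T (partialD i (∑ j, (B i j : ℂ) • mulX j φ)) -
      T (∑ i, ∑ j, (K i j : ℂ) • mulX i (mulX j φ)) + (c : ℂ) • T φ := by
    rw [← laplacian_eq_schwLaplacian, ← laplacian_apply_apply, ← smulLeftCLM_quadForm,
      ← smulLeftCLM_apply_apply]
    have h2 : ∀ i, T (partialD i (∑ j, (B i j : ℂ) • mulX j φ)) =
        -(smulLeftCLM ℂ (fun x : Euc N => ((linearField B x i : ℝ) : ℂ))
          (∂_{(EuclideanSpace.single i (1 : ℝ) : Euc N)} T)) φ := fun i => by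
      rw [smulLeftCLM_apply_apply, TemperedDistribution.lineDerivOp_apply_apply,
        smulLeftCLM_linearField, map_neg, neg_neg]
      rfl
    simp only [h2, Finset.sum_neg_distrib, sub_neg_eq_add]
    simp [quadOpDist]
  rw [h1, ← map_sum, smulLeftCLM_linearField_partialD_sum, schwOp_apply, ← map_sub, ← map_sub,
    ← map_smul, ← map_add]
  congr 1
  simp only [schwLaplacian_apply, Matrix.neg_apply, Complex.ofReal_neg, neg_smul,
    Finset.sum_neg_distrib, Complex.ofReal_sub, sub_smul]
  abel

theorem toTemperedDistribution_toL2 (v : 𝓢(Euc N, ℂ)) :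
    (toL2 v : 𝓢'(Euc N, ℂ)) = (v : 𝓢'(Euc N, ℂ)) :=
  Lp.toTemperedDistribution_toLp_eq v

theorem smulLeftCLM_toTemperedDistributionCLM {g : Euc N → ℂ} (hg : g.HasTemperateGrowth)
    (v : 𝓢(Euc N, ℂ)) :
    smulLeftCLM ℂ g (v : 𝓢'(Euc N, ℂ)) = (SchwartzMap.smulLeftCLM ℂ g v : 𝓢'(Euc N, ℂ)) := by
  ext φ
  simp only [smulLeftCLM_apply_apply, SchwartzMap.toTemperedDistributionCLM_apply_apply,
    SchwartzMap.smulLeftCLM_apply_apply hg, smul_eq_mul]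
  exact integral_congr_ae (Eventually.of_forall fun x => by ring)

theorem quadOpDist_toL2 (B K : Matrix (Fin N) (Fin N) ℝ) (c : ℝ) (v : 𝓢(Euc N, ℂ)) :
    quadOpDist B K c (toL2 v : 𝓢'(Euc N, ℂ)) = (toL2 (schwOp B K v + (c : ℂ) • v) : L2 N) := by
  rw [toTemperedDistribution_toL2, toTemperedDistribution_toL2, quadOpDist,
    laplacian_toTemperedDistributionCLM_eq, laplacian_eq_schwLaplacian,
    smulLeftCLM_toTemperedDistributionCLM (hasTemperateGrowth_quadForm_ofReal K),
    smulLeftCLM_quadForm]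
  have h : ∀ i, smulLeftCLM ℂ (fun x : Euc N => ((linearField B x i : ℝ) : ℂ))
      (∂_{(EuclideanSpace.single i (1 : ℝ) : Euc N)} (v : 𝓢'(Euc N, ℂ))) =
        ((∑ j, (B i j : ℂ) • mulX j (partialD i v) : 𝓢(Euc N, ℂ)) : 𝓢'(Euc N, ℂ)) := fun i => by
    rw [lineDerivOp_toTemperedDistributionCLM_eq,
      smulLeftCLM_toTemperedDistributionCLM (hasTemperateGrowth_linearField_ofReal B i),
      smulLeftCLM_linearField]
    rfl
  simp only [h]
  rw [← map_sum, ← map_add, ← map_sub, ← map_smul, ← map_add, schwOp_apply, schwLaplacian_apply]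

theorem continuous_quadOpDist (B K : Matrix (Fin N) (Fin N) ℝ) (c : ℝ) :
    Continuous (quadOpDist B K c) := by
  have h1 : Continuous fun u : 𝓢'(Euc N, ℂ) => Δ u := by
    simp only [← laplacianCLM_apply]
    exact ContinuousLinearMap.continuous _
  have h2 : ∀ m : Euc N, Continuous fun u : 𝓢'(Euc N, ℂ) => ∂_{m} u :=
    fun m => (LineDeriv.lineDerivOpCLM ℂ 𝓢'(Euc N, ℂ) m).continuous
  unfold quadOpDist
  refine ((h1.add (continuous_finsetSum _ fun i _ => ?_)).sub
    (ContinuousLinearMap.continuous _)).add (continuous_const_smul _)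
  exact (ContinuousLinearMap.continuous _).comp (h2 _)

theorem continuous_toTemperedDistribution :
    Continuous fun f : L2 N => (f : 𝓢'(Euc N, ℂ)) :=
  (Lp.toTemperedDistributionCLM ℂ (volume : Measure (Euc N)) 2).continuous

/-- The symbol 1 + |ξ|² is that of 1 - Δ/(2π)², so W^{2,2} membership reduces to a square-integrable
Laplacian. -/
theorem besselPotential_two_eq (u : 𝓢'(Euc N, ℂ)) :
    besselPotential (Euc N) ℂ 2 u = u - ((((2 * Real.pi) ^ 2)⁻¹ : ℝ) : ℂ) • Δ u := by
  have h : (fun x : Euc N => (((1 + ‖x‖ ^ 2) ^ ((2 : ℝ) / 2) : ℝ) : ℂ)) =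
      (fun _ => (1 : ℂ)) + fun x => Complex.ofReal (‖x‖ ^ 2) := by
    funext x
    simp
  rw [laplacian_eq_fourierMultiplierCLM, besselPotential, h, fourierMultiplierCLM_apply,
    smulLeftCLM_add (by fun_prop) (by fun_prop), fourierMultiplierCLM_apply]
  have h1 : (smulLeftCLM ℂ (fun _ : Euc N => (1 : ℂ)) + smulLeftCLM ℂ fun x : Euc N =>
      Complex.ofReal (‖x‖ ^ 2)) (FourierTransform.fourier u) = FourierTransform.fourier u +
        smulLeftCLM ℂ (fun x : Euc N => Complex.ofReal (‖x‖ ^ 2)) (FourierTransform.fourier u) := by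
    rw [_root_.add_apply, smulLeftCLM_const, one_smul]
  have h2 : ∀ T : 𝓢'(Euc N, ℂ),
      ((((2 * Real.pi) ^ 2)⁻¹ : ℝ) : ℂ) • (-(2 * Real.pi) ^ 2 • T) = -T := fun T => by
    ext φ
    simp
  rw [h1, FourierTransform.fourierInv_add, FourierTransform.fourierInv_fourier_eq,
    h2, sub_neg_eq_add]

theorem memSobolev_two_of_laplacian {u w : L2 N} (h : Δ (u : 𝓢'(Euc N, ℂ)) = (w : 𝓢'(Euc N, ℂ))) :
    MemSobolev 2 2 (u : 𝓢'(Euc N, ℂ)) := by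
  refine ⟨u - ((((2 * Real.pi) ^ 2)⁻¹ : ℝ) : ℂ) • w, ?_⟩
  rw [besselPotential_two_eq, h]
  rw [← toTemperedDistribution_smul]
  exact ((Lp.toTemperedDistributionCLM ℂ (volume : Measure (Euc N)) 2).map_sub _ _).symm

/-- The product is a priori only locally integrable; testing against compactly supported smooth
functions identifies it with w. -/
theorem memLp_smul_of_smulLeftCLM {g : Euc N → ℂ} (hg : g.HasTemperateGrowth) {u w : L2 N}
    (h : smulLeftCLM ℂ g (u : 𝓢'(Euc N, ℂ)) = (w : 𝓢'(Euc N, ℂ))) :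
    MemLp (fun x => g x * u x) 2 volume := by
  refine (Lp.memLp w).ae_eq ?_
  have hu : LocallyIntegrable u volume := (Lp.memLp u).locallyIntegrable one_le_two
  have hgu : LocallyIntegrable (fun x => g x * u x) volume := by
    have := hu.locallyIntegrableOn Set.univ
    rw [← locallyIntegrableOn_univ]
    exact this.continuousOn_mul hg.1.continuous.continuousOn isOpen_univ.isLocallyClosed
  refine Filter.EventuallyEq.symm (ae_eq_of_integral_contDiff_smul_eq hgu
    ((Lp.memLp w).locallyIntegrable one_le_two) fun ψ hψ hψc => ?_)
  have h1 : HasCompactSupport (Complex.ofRealCLM ∘ ψ) := hψc.comp_left rfl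
  have h2 : ContDiff ℝ ((⊤ : ℕ∞) : WithTop ℕ∞) (Complex.ofRealCLM ∘ ψ) := by fun_prop
  have h3 := congrArg (fun T : 𝓢'(Euc N, ℂ) => T (h1.toSchwartzMap h2)) h
  simp only [smulLeftCLM_apply_apply, Lp.toTemperedDistribution_apply,
    SchwartzMap.smulLeftCLM_apply_apply hg] at h3
  refine Eq.trans (integral_congr_ae (Eventually.of_forall fun x => ?_)) (h3.trans
    (integral_congr_ae (Eventually.of_forall fun x => ?_)))
  · simp [mul_left_comm, mul_assoc]
  · simp

end Distributions

/-! ### The resolvent at large real points -/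

section Resolvent

variable {N : ℕ} {B K X : Matrix (Fin N) (Fin N) ℝ}

/-- `p ↦ (z - L) (p e^{-⟨x, X x⟩ / 2})` on polynomials. -/
noncomputable def graphMap (B K X : Matrix (Fin N) (Fin N) ℝ) (z : ℂ) :
    MvPolynomial (Fin N) ℂ →ₗ[ℂ] L2 N :=
  toL2.toLinearMap ∘ₗ (z • LinearMap.id - schwOp B K) ∘ₗ polyGauss X

theorem graphMap_apply (z : ℂ) (p : MvPolynomial (Fin N) ℂ) :
    graphMap B K X z p = toL2 (z • polyGauss X p - schwOp B K (polyGauss X p)) := rfl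

theorem exists_polyGauss_eq [NeZero N] (hK : K.PosDef) (hX : X.PosDef) (hF : riccati B K X = 0)
    {z : ℂ} (hz : -X.trace < z.re) (r : MvPolynomial (Fin N) ℂ) :
    ∃ p, z • polyGauss X p - schwOp B K (polyGauss X p) = polyGauss X r := by
  obtain ⟨p, hp⟩ := exists_ornsteinUhlenbeck hX (posDef_lyapunov_of_riccati_eq_zero hK hX hF)
    (w := z + X.trace) (by rw [Complex.add_re, Complex.ofReal_re]; linarith) r
  refine ⟨p, ?_⟩
  rw [schwOp_polyGauss hX hF, ← map_smul, ← map_sub, ← hp, add_smul]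
  congr 1
  abel

theorem denseRange_graphMap [NeZero N] (hK : K.PosDef) (hX : X.PosDef) (hF : riccati B K X = 0)
    {z : ℂ} (hz : -X.trace < z.re) : DenseRange (graphMap B K X z) := by
  refine (denseRange_polyGauss hX).mono ?_
  rintro _ ⟨r, rfl⟩
  obtain ⟨p, hp⟩ := exists_polyGauss_eq hK hX hF hz r
  exact ⟨p, by rw [graphMap_apply, hp]⟩

/-- Used with T the identity, the Laplacian and multiplication by |H x|², to produce R and the two
operators that certify the domain conditions. -/
theorem exists_extension_graphMap {z : ℂ} (h : DenseRange (graphMap B K X z))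
    (T : 𝓢(Euc N, ℂ) →L[ℂ] 𝓢(Euc N, ℂ)) {C : ℝ}
    (hT : ∀ v, ‖toL2 (T v)‖ ≤ C * ‖toL2 (z • v - schwOp B K v)‖) :
    ∃ R : L2 N →L[ℂ] L2 N, ∀ p, R (graphMap B K X z p) = toL2 (T (polyGauss X p)) :=
  ⟨LinearMap.extendOfNorm (toL2.toLinearMap ∘ₗ T.toLinearMap ∘ₗ polyGauss X) (graphMap B K X z),
    fun p => LinearMap.extendOfNorm_eq h ⟨C, fun p => hT (polyGauss X p)⟩ p⟩

theorem norm_linearField_sq (H : Matrix (Fin N) (Fin N) ℝ) (x : Euc N) :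
    ‖linearField H x‖ ^ 2 = quadForm (Hᵀ * H) x := by
  rw [norm_sq_eq_dotProduct, quadForm_eq_dotProduct, ← mulVec_mulVec, dotProduct_mulVec,
    vecMul_transpose]
  rfl

/-- On the dense range of the graph map every identity is explicit. Both sides are continuous into
tempered distributions, so the identities hold on all of L². -/
theorem exists_resolvent [NeZero N] (H : Matrix (Fin N) (Fin N) ℝ) (hK : K.PosDef)
    (hX : X.PosDef) (hF : riccati B K X = 0) :
    ∃ ω₀ : ℝ, ∀ ω ≥ ω₀, ∃ R : L2 N →L[ℂ] L2 N, ∃ C : ℝ, 0 ≤ C ∧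
      DenseRange (graphMap B K X ω) ∧
      (∀ p, R (graphMap B K X ω p) = toL2 (polyGauss X p)) ∧
      (∀ p, energy (polyGauss X p) ≤ C * ‖graphMap B K X ω p‖ ^ 2) ∧
      ∀ h, MemSobolev 2 2 (R h : 𝓢'(Euc N, ℂ)) ∧
        MemLp (fun x : Euc N => ((‖linearField H x‖ ^ 2 : ℝ) : ℂ) * R h x) 2 volume ∧
        ∀ c : ℝ, quadOpDist B K c (R h : 𝓢'(Euc N, ℂ)) =
          ((((ω + c : ℝ) : ℂ) • R h - h : L2 N) : 𝓢'(Euc N, ℂ)) := by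
  obtain ⟨ω₀, h⟩ := exists_norm_le (B := B) hK
  -- Since tr X > 0, any ω ≥ 0 lies to the right of -tr X, as density of the range requires.
  refine ⟨max ω₀ 0, fun ω hω => ?_⟩
  obtain ⟨C, hC, hb⟩ := h ω ((le_max_left _ _).trans hω)
  have htr : 0 < X.trace := hX.trace_pos
  have hd : DenseRange (graphMap B K X ω) := denseRange_graphMap hK hX hF (by
    rw [Complex.ofReal_re]
    linarith [(le_max_right ω₀ 0).trans hω])
  obtain ⟨R, hR⟩ := exists_extension_graphMap hd (ContinuousLinearMap.id ℂ _)
    fun v => (hb v).2.1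
  obtain ⟨D, hD⟩ := exists_extension_graphMap hd schwLaplacian fun v => (hb v).2.2.2
  obtain ⟨W, hW⟩ := exists_extension_graphMap hd
    (SchwartzMap.smulLeftCLM ℂ (fun x : Euc N => ((quadForm (Hᵀ * H) x : ℝ) : ℂ)))
    (C := (∑ i, ∑ j, |(Hᵀ * H) i j|) * C) fun v => by
      rw [smulLeftCLM_quadForm]
      simp only [map_sum, toL2_smul, mul_assoc]
      exact norm_sum_sum_smul_le _ _ (hb v).2.2.1
  refine ⟨R, C, hC, hd, hR, fun p => (hb _).1, fun u => ⟨?_, ?_, fun c => ?_⟩⟩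
  · refine memSobolev_two_of_laplacian (w := D u) ?_
    have hc1 : Continuous fun u => Δ (R u : 𝓢'(Euc N, ℂ)) := by
      simp only [← laplacianCLM_apply]
      exact (ContinuousLinearMap.continuous _).comp
        (continuous_toTemperedDistribution.comp R.continuous)
    refine congrFun (hd.equalizer hc1
      (continuous_toTemperedDistribution.comp D.continuous) (funext fun p => ?_)) u
    simp only [Function.comp_apply, hR, hD, ContinuousLinearMap.id_apply,
      toTemperedDistribution_toL2, laplacian_toTemperedDistributionCLM_eq,
      laplacian_eq_schwLaplacian]
  · simp only [norm_linearField_sq]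
    refine memLp_smul_of_smulLeftCLM (hasTemperateGrowth_quadForm_ofReal _) (w := W u) ?_
    refine congrFun (hd.equalizer ((ContinuousLinearMap.continuous _).comp
      (continuous_toTemperedDistribution.comp R.continuous))
      (continuous_toTemperedDistribution.comp W.continuous) (funext fun p => ?_)) u
    simp only [Function.comp_apply, hR, hW, ContinuousLinearMap.id_apply,
      toTemperedDistribution_toL2,
      smulLeftCLM_toTemperedDistributionCLM (hasTemperateGrowth_quadForm_ofReal _)]
  · have hc1 : Continuous fun u => ((ω + c : ℝ) : ℂ) • R u - u :=
      (R.continuous.const_smul ((ω + c : ℝ) : ℂ)).sub continuous_id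
    have hc2 : Continuous fun u => ((((ω + c : ℝ) : ℂ) • R u - u : L2 N) : 𝓢'(Euc N, ℂ)) :=
      continuous_toTemperedDistribution.comp hc1
    refine congrFun (hd.equalizer ((continuous_quadOpDist B K c).comp
      (continuous_toTemperedDistribution.comp R.continuous)) hc2 (funext fun p => ?_)) u
    simp only [Function.comp_apply, hR, ContinuousLinearMap.id_apply, quadOpDist_toL2]
    congr 1
    rw [graphMap_apply, ← toL2_smul, ← map_sub]
    congr 1
    rw [Complex.ofReal_add, add_smul]
    abel

end Resolvent

/-! ### A min-max estimate for symmetric operators -/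

section Rayleigh

theorem mul_norm_sq_le_re_inner_of_isSymmetric {U : Type*} [NormedAddCommGroup U]
    [InnerProductSpace ℂ U] [FiniteDimensional ℂ U] {T : U →ₗ[ℂ] U} (hT : T.IsSymmetric) {a : ℝ}
    (h : ∀ u ≠ 0, ∀ μ : ℝ, T u = (μ : ℂ) • u → a ≤ μ) (u : U) :
    a * ‖u‖ ^ 2 ≤ (⟪u, T u⟫_ℂ).re := by
  let b := hT.eigenvectorBasis rfl
  rw [← b.repr.norm_map u, ← b.repr.inner_map_map u (T u), EuclideanSpace.norm_sq_eq,
    PiLp.inner_apply, Complex.re_sum, Finset.mul_sum]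
  refine Finset.sum_le_sum fun i _ => ?_
  have h1 : a ≤ hT.eigenvalues rfl i :=
    h _ (b.orthonormal.ne_zero i) _ (hT.apply_eigenvectorBasis rfl i)
  have h2 : (⟪b.repr u i, b.repr (T u) i⟫_ℂ).re = hT.eigenvalues rfl i * ‖b.repr u i‖ ^ 2 := by
    have h3 := hT.eigenvectorBasis_apply_self_apply rfl u i
    change b.repr (T u) i = (hT.eigenvalues rfl i : ℂ) * b.repr u i at h3
    rw [h3, ← smul_eq_mul, inner_smul_right, Complex.re_ofReal_mul]
    congr 1
    exact inner_self_eq_norm_sq (𝕜 := ℂ) (E := ℂ) _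
  rw [h2]
  exact mul_le_mul_of_nonneg_right h1 (sq_nonneg _)

/-- Take q to be the orthogonal projection onto V in the inner product pulled back by f. T preserves
the complement of V in W, and all its eigenvalues there are at least a. -/
theorem exists_mul_norm_sub_sq_le {P F : Type*} [AddCommGroup P] [Module ℂ P]
    [NormedAddCommGroup F] [InnerProductSpace ℂ F] {f : P →ₗ[ℂ] F} (hf : Function.Injective f)
    {T : P →ₗ[ℂ] P} (hT : ∀ p q, ⟪f (T p), f q⟫_ℂ = ⟪f p, f (T q)⟫_ℂ) {V W : Submodule ℂ P}
    [FiniteDimensional ℂ V] [FiniteDimensional ℂ W] (hVW : V ≤ W) (hTV : ∀ p ∈ V, T p ∈ V)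
    (hTW : ∀ p ∈ W, T p ∈ W) {a : ℝ} (hpos : ∀ p ∈ V, 0 ≤ (⟪f p, f (T p)⟫_ℂ).re)
    (ha : ∀ p ∉ V, ∀ μ : ℝ, T p = (μ : ℂ) • p → a ≤ μ) {p : P} (hp : p ∈ W) :
    ∃ q ∈ V, a * ‖f p - f q‖ ^ 2 ≤ (⟪f p, f (T p)⟫_ℂ).re := by
  let e : P ≃ₗ[ℂ] LinearMap.range f := LinearEquiv.ofInjective f hf
  have he : ∀ x y : P, ⟪e x, e y⟫_ℂ = ⟪f x, f y⟫_ℂ := fun _ _ => rfl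
  let O : LinearMap.range f →ₗ[ℂ] LinearMap.range f := e.conj T
  have hO : ∀ x, O (e x) = e (T x) := fun x => by simp [O, LinearEquiv.conj_apply]
  have hOs : O.IsSymmetric := fun x y => by
    obtain ⟨x, rfl⟩ := e.surjective x
    obtain ⟨y, rfl⟩ := e.surjective y
    rw [hO, hO, he, he, hT]
  let V' : Submodule ℂ (LinearMap.range f) := V.map e.toLinearMap
  let W' : Submodule ℂ (LinearMap.range f) := W.map e.toLinearMap
  have hV' : ∀ x ∈ V', O x ∈ V' := by
    rintro _ ⟨x, hx, rfl⟩
    exact ⟨T x, hTV x hx, (hO x).symm⟩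
  have hVp : ∀ x ∈ V'ᗮ, O x ∈ V'ᗮ := fun x hx y hy => by
    rw [← hOs y x]
    exact hx _ (hV' y hy)
  let U : Submodule ℂ (LinearMap.range f) := W' ⊓ V'ᗮ
  have hU : ∀ x ∈ U, O x ∈ U := by
    rintro _ ⟨⟨x, hx, rfl⟩, hx2⟩
    exact ⟨⟨T x, hTW x hx, (hO x).symm⟩, hVp _ hx2⟩
  have hUs := hOs.restrict_invariant hU
  have hUa : ∀ u : U, a * ‖u‖ ^ 2 ≤ (⟪u, O.restrict hU u⟫_ℂ).re := by
    refine mul_norm_sq_le_re_inner_of_isSymmetric hUs ?_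
    rintro ⟨u, hu⟩ hu0 μ hμ
    obtain ⟨x, rfl⟩ := e.surjective u
    have hμ' : O (e x) = (μ : ℂ) • e x := congrArg Subtype.val hμ
    rw [hO, ← map_smul] at hμ'
    -- An eigenvector orthogonal to V lies outside V; otherwise it would be orthogonal to itself.
    refine ha x (fun hx => hu0 ?_) μ (e.injective hμ')
    have h1 : ⟪e x, e x⟫_ℂ = 0 := hu.2 _ ⟨x, hx, rfl⟩
    exact Subtype.ext (inner_self_eq_zero.1 h1)
  set x := e p with hx
  set y := V'.starProjection x with hy
  have hyV : y ∈ V' := V'.starProjection_apply_mem x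
  have hwV : x - y ∈ V'ᗮ := V'.sub_starProjection_mem_orthogonal x
  have hwW : x - y ∈ W' :=
    W'.sub_mem ⟨p, hp, rfl⟩ (Submodule.map_mono hVW hyV)
  have h1 := hUa ⟨x - y, hwW, hwV⟩
  change a * ‖x - y‖ ^ 2 ≤ (⟪x - y, O (x - y)⟫_ℂ).re at h1
  obtain ⟨q, hq, hqy⟩ := hyV
  refine ⟨q, hq, ?_⟩
  have h2 : ⟪x - y, O y⟫_ℂ = 0 := by
    rw [← inner_conj_symm, hwV _ (hV' y ⟨q, hq, hqy⟩), map_zero]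
  have h3 : ⟪y, O (x - y)⟫_ℂ = 0 := hVp _ hwV _ ⟨q, hq, hqy⟩
  have h4 : ⟪x, O x⟫_ℂ = ⟪y, O y⟫_ℂ + ⟪x - y, O (x - y)⟫_ℂ := by
    have h5 : ⟪x, O x⟫_ℂ = ⟪y + (x - y), O y + O (x - y)⟫_ℂ := by
      rw [← map_add, add_sub_cancel]
    rw [h5, inner_add_left, inner_add_right, inner_add_right, h2, h3]
    ring
  have h6 : 0 ≤ (⟪y, O y⟫_ℂ).re := by
    have hqy' : e q = y := hqy
    rw [← hqy', hO, he]
    exact hpos q hq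
  have h7 : ⟪f p, f (T p)⟫_ℂ = ⟪x, O x⟫_ℂ := by rw [hx, hO, he]
  have h8 : ‖f p - f q‖ = ‖x - y‖ := by
    have hqy' : e q = y := hqy
    rw [← hqy', hx]
    rfl
  rw [h7, h4, h8, Complex.add_re]
  linarith

end Rayleigh

/-! ### Compactness of the resolvent -/

section Compactness

variable {N : ℕ} {B K X : Matrix (Fin N) (Fin N) ℝ}

theorem injective_toL2_polyGauss (hX : X.PosDef) :
    Function.Injective (toL2.toLinearMap ∘ₗ polyGauss X) := by
  refine toL2_injective.comp ((injective_iff_map_eq_zero _).2 fun p hp => ?_)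
  by_contra h
  obtain ⟨x, hx⟩ := exists_polyFun_ne_zero h
  have h1 : polyGauss X p x = 0 := by rw [hp]; rfl
  rw [polyGauss_apply, gaussian_apply hX] at h1
  refine (mul_eq_zero.1 h1).elim hx ?_
  exact_mod_cast (Real.exp_pos _).ne'

theorem inner_schwOp_zero (hK : K.IsSymm) (u v : 𝓢(Euc N, ℂ)) :
    ⟪toL2 (schwOp 0 K u), toL2 v⟫_ℂ = ⟪toL2 u, toL2 (schwOp 0 K v)⟫_ℂ := by
  have h1 : ∀ i, ⟪toL2 (partialD i (partialD i u)), toL2 v⟫_ℂ =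
      ⟪toL2 u, toL2 (partialD i (partialD i v))⟫_ℂ := fun i => by
    rw [inner_partialD_left, inner_partialD_left, neg_neg]
  have h2 : ∀ i j, ⟪toL2 (mulX i (mulX j u)), toL2 v⟫_ℂ =
      ⟪toL2 u, toL2 (mulX j (mulX i v))⟫_ℂ := fun i j => by
    rw [inner_mulX_left, inner_mulX_left]
  simp only [schwOp_apply, Matrix.zero_apply, Complex.ofReal_zero, zero_smul,
    Finset.sum_const_zero, add_zero, map_sub, map_sum, toL2_smul, inner_sub_left, inner_sub_right,
    sum_inner, inner_sum, inner_smul_left, inner_smul_right, Complex.conj_ofReal, h1, h2]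
  congr 1
  rw [Finset.sum_comm]
  exact Finset.sum_congr rfl fun i _ => Finset.sum_congr rfl fun j _ => by rw [hK.apply]

theorem re_inner_neg_schwOp_zero_nonneg (hK : K.PosSemidef) (v : 𝓢(Euc N, ℂ)) :
    0 ≤ (⟪toL2 v, toL2 (-schwOp 0 K v)⟫_ℂ).re := by
  rw [map_neg, inner_neg_right, Complex.neg_re, re_inner_schwOp, trace_zero]
  have h1 := re_sum_inner_nonneg hK fun i => toL2 (mulX i v)
  have h2 : 0 ≤ ∑ i, ‖toL2 (partialD i v)‖ ^ 2 := Finset.sum_nonneg fun _ _ => sq_nonneg _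
  linarith

theorem exists_re_inner_neg_schwOp_zero_le (K : Matrix (Fin N) (Fin N) ℝ) :
    ∃ C, 0 ≤ C ∧ ∀ v, (⟪toL2 v, toL2 (-schwOp 0 K v)⟫_ℂ).re ≤ C * energy v := by
  have hβ : 0 ≤ ∑ i, ∑ j, |K i j| :=
    Finset.sum_nonneg fun _ _ => Finset.sum_nonneg fun _ _ => abs_nonneg _
  refine ⟨1 + ∑ i, ∑ j, |K i j|, by positivity, fun v => ?_⟩
  rw [map_neg, inner_neg_right, Complex.neg_re, re_inner_schwOp, trace_zero, add_mul, one_mul]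
  have h1 : ∑ i, ∑ j, K i j * (⟪toL2 (mulX i v), toL2 (mulX j v)⟫_ℂ).re ≤
      (∑ i, ∑ j, |K i j|) * energy v := by
    rw [Finset.sum_mul]
    refine Finset.sum_le_sum fun i _ => ?_
    rw [Finset.sum_mul]
    refine Finset.sum_le_sum fun j _ => (le_abs_self _).trans ?_
    rw [abs_mul]
    refine mul_le_mul_of_nonneg_left ((Complex.abs_re_le_norm _).trans
      ((norm_inner_le_norm _ _).trans ?_)) (abs_nonneg _)
    nlinarith [norm_mulX_le_energy i v, norm_mulX_le_energy j v,
      sq_nonneg (‖toL2 (mulX i v)‖ - ‖toL2 (mulX j v)‖)]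
  have h2 : ∑ i, ‖toL2 (partialD i v)‖ ^ 2 ≤ energy v := by
    have h3 : 0 ≤ ∑ i, ‖toL2 (mulX i v)‖ ^ 2 := Finset.sum_nonneg fun _ _ => sq_nonneg _
    have h4 := sq_nonneg ‖toL2 v‖
    rw [energy]
    linarith
  linarith

/-- The polynomial part of the harmonic oscillator with ground state `e^{-⟨x, X x⟩ / 2}`. -/
noncomputable def polyOscillator (X : Matrix (Fin N) (Fin N) ℝ) :
    MvPolynomial (Fin N) ℂ →ₗ[ℂ] MvPolynomial (Fin N) ℂ :=
  (2 : ℂ) • polyDrift X - polyLaplacian + (X.trace : ℂ) • LinearMap.id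

theorem polyOscillator_apply (p : MvPolynomial (Fin N) ℂ) :
    polyOscillator X p = (2 : ℂ) • polyDrift X p - polyLaplacian p + (X.trace : ℂ) • p := rfl

theorem polyGauss_polyOscillator (hX : X.PosDef) (p : MvPolynomial (Fin N) ℂ) :
    polyGauss X (polyOscillator X p) = -schwOp 0 (X * X) (polyGauss X p) := by
  have h1 : riccati 0 (X * X) X = 0 := by simp [riccati, sq]
  have h2 : closedLoop 0 X = X := by simp [closedLoop]
  rw [schwOp_polyGauss hX h1, h2, ← map_neg, polyOscillator_apply]
  congr 1
  abel

theorem polyOscillator_mem_restrictTotalDegree {n : ℕ} {p : MvPolynomial (Fin N) ℂ}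
    (hp : p ∈ MvPolynomial.restrictTotalDegree (Fin N) ℂ n) :
    polyOscillator X p ∈ MvPolynomial.restrictTotalDegree (Fin N) ℂ n := by
  rw [polyOscillator_apply]
  refine Submodule.add_mem _ (Submodule.sub_mem _ (Submodule.smul_mem _ _ ?_) ?_)
    (Submodule.smul_mem _ _ hp)
  · rw [MvPolynomial.mem_restrictTotalDegree] at hp ⊢
    exact (totalDegree_polyDrift_le X p).trans hp
  · rw [MvPolynomial.mem_restrictTotalDegree] at hp ⊢
    exact (totalDegree_polyLaplacian_le p).trans ((Nat.sub_le _ _).trans hp)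

/-- Compare with the symmetric oscillator -Δ + |X x|², which has the same ground state and preserves
polynomial degree. With X² ≥ δX, its eigenvectors of degree above n have eigenvalues at least 2δn,
while its form is bounded by the energy. -/
theorem exists_approx_polyGauss [NeZero N] (hX : X.PosDef) :
    ∃ C, 0 ≤ C ∧ ∀ n : ℕ, ∀ p, ∃ q ∈ MvPolynomial.restrictTotalDegree (Fin N) ℂ n,
      n * ‖toL2 (polyGauss X p) - toL2 (polyGauss X q)‖ ^ 2 ≤ C * energy (polyGauss X p) := by
  have hXs := hX.posSemidef.isSymm
  have hXX : ∀ v : Fin N → ℝ, v ⬝ᵥ (X * X) *ᵥ v = (X *ᵥ v) ⬝ᵥ (X *ᵥ v) := fun v => by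
    rw [← mulVec_mulVec, dotProduct_mulVec, ← mulVec_transpose, hXs.eq]
  have hXXs : (X * X).IsSymm := by
    rw [IsSymm, transpose_mul, hXs.eq]
  have hXXp : (X * X).PosDef := by
    refine posDef_of_isSymm hXXs fun v hv => ?_
    rw [hXX]
    have h1 := hX.quadratic_pos hv
    have h2 : X *ᵥ v ≠ 0 := fun h => by rw [h, dotProduct_zero] at h1; exact h1.false
    exact (Finset.sum_nonneg fun _ _ => mul_self_nonneg _).lt_of_ne
      (fun h => h2 (dotProduct_self_eq_zero.1 h.symm))
  obtain ⟨δ, hδ, hδX⟩ := hX.exists_coercive hXXp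
  simp only [hXX] at hδX
  obtain ⟨C, hC, hCX⟩ := exists_re_inner_neg_schwOp_zero_le (X * X)
  refine ⟨C / (2 * δ), by positivity, fun n p => ?_⟩
  have hT : ∀ p q : MvPolynomial (Fin N) ℂ,
      ⟪(toL2.toLinearMap ∘ₗ polyGauss X) (polyOscillator X p),
        (toL2.toLinearMap ∘ₗ polyGauss X) q⟫_ℂ =
      ⟪(toL2.toLinearMap ∘ₗ polyGauss X) p,
        (toL2.toLinearMap ∘ₗ polyGauss X) (polyOscillator X q)⟫_ℂ := fun p q => by
    change ⟪toL2 (polyGauss X (polyOscillator X p)), toL2 (polyGauss X q)⟫_ℂ =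
      ⟪toL2 (polyGauss X p), toL2 (polyGauss X (polyOscillator X q))⟫_ℂ
    rw [polyGauss_polyOscillator hX, polyGauss_polyOscillator hX, map_neg, map_neg,
      inner_neg_left, inner_neg_right, inner_schwOp_zero hXXs]
  have hTe : ∀ p, ⟪(toL2.toLinearMap ∘ₗ polyGauss X) p,
      (toL2.toLinearMap ∘ₗ polyGauss X) (polyOscillator X p)⟫_ℂ =
      ⟪toL2 (polyGauss X p), toL2 (-schwOp 0 (X * X) (polyGauss X p))⟫_ℂ := fun p => by
    rw [← polyGauss_polyOscillator hX]
    rfl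
  obtain ⟨q, hq, h⟩ := exists_mul_norm_sub_sq_le (injective_toL2_polyGauss hX) hT
    (V := MvPolynomial.restrictTotalDegree (Fin N) ℂ n)
    (W := MvPolynomial.restrictTotalDegree (Fin N) ℂ (max n p.totalDegree)) (a := 2 * δ * n)
    (fun q hq => by
      rw [MvPolynomial.mem_restrictTotalDegree] at hq ⊢
      exact hq.trans (le_max_left _ _))
    (fun q hq => polyOscillator_mem_restrictTotalDegree hq)
    (fun q hq => polyOscillator_mem_restrictTotalDegree hq)
    (fun q _ => by rw [hTe]; exact re_inner_neg_schwOp_zero_nonneg hXXp.posSemidef _)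
    (fun q hq μ hμ => by
      rw [MvPolynomial.mem_restrictTotalDegree, not_le] at hq
      have hq0 : q ≠ 0 := by
        rintro rfl
        simp at hq
      have h1 := le_re_of_ornsteinUhlenbeck hX hδX hq0 (w := (μ : ℂ) - X.trace) (by
        rw [sub_smul, ← hμ, polyOscillator_apply, add_sub_cancel_right])
      rw [Complex.sub_re, Complex.ofReal_re, Complex.ofReal_re] at h1
      have h2 : (n : ℝ) ≤ q.totalDegree := by exact_mod_cast hq.le
      have h3 := hX.trace_pos
      have h4 := mul_le_mul_of_nonneg_right h2 hδ.le
      linarith)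
    (p := p) (by
      rw [MvPolynomial.mem_restrictTotalDegree]
      exact le_max_right _ _)
  refine ⟨q, hq, ?_⟩
  rw [hTe] at h
  have h1 := h.trans (hCX _)
  change 2 * δ * n * ‖toL2 (polyGauss X p) - toL2 (polyGauss X q)‖ ^ 2 ≤ _ at h1
  rw [div_mul_eq_mul_div, le_div_iff₀ (by positivity)]
  linarith

/-- Projecting R onto polynomials of degree at most n times the Gaussian gives finite-rank operators
with norm error O(n^{-1/2}). -/
theorem isCompactOperator_of_graphMap [NeZero N] (hX : X.PosDef) {ω : ℂ}
    (hd : DenseRange (graphMap B K X ω)) {R : L2 N →L[ℂ] L2 N}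
    (hR : ∀ p, R (graphMap B K X ω p) = toL2 (polyGauss X p)) {C : ℝ} (hC : 0 ≤ C)
    (hE : ∀ p, energy (polyGauss X p) ≤ C * ‖graphMap B K X ω p‖ ^ 2) : IsCompactOperator R := by
  obtain ⟨D, hD, hDX⟩ := exists_approx_polyGauss hX
  let V : ℕ → Submodule ℂ (L2 N) := fun n =>
    (MvPolynomial.restrictTotalDegree (Fin N) ℂ n).map (toL2.toLinearMap ∘ₗ polyGauss X)
  have hVf : ∀ n, FiniteDimensional ℂ (V n) := fun n => inferInstance
  have hdist : ∀ n : ℕ, 0 < n → ∀ h : L2 N,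
      ‖R h - (V n).starProjection (R h)‖ ≤ Real.sqrt (D * C / n) * ‖h‖ := fun n hn => by
    refine hd.induction ?_ (isClosed_le (by fun_prop) (by fun_prop))
    rintro _ ⟨p, rfl⟩
    rw [hR]
    obtain ⟨q, hq, h⟩ := hDX n p
    have h1 : ‖toL2 (polyGauss X p) - (V n).starProjection (toL2 (polyGauss X p))‖ ≤
        ‖toL2 (polyGauss X p) - toL2 (polyGauss X q)‖ := by
      rw [Submodule.starProjection_minimal]
      exact ciInf_le ⟨0, by rintro _ ⟨w, rfl⟩; exact norm_nonneg _⟩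
        (⟨toL2 (polyGauss X q), q, hq, rfl⟩ : V n)
    refine h1.trans ?_
    have hn' : (0 : ℝ) < n := by exact_mod_cast hn
    rw [← Real.sqrt_sq (norm_nonneg (graphMap B K X ω p)), ← Real.sqrt_mul (by positivity)]
    refine Real.le_sqrt_of_sq_le ?_
    rw [div_mul_eq_mul_div, le_div_iff₀ hn', mul_comm]
    refine h.trans ?_
    rw [mul_assoc]
    exact mul_le_mul_of_nonneg_left (hE p) hD
  have hlim : Tendsto (fun n => (V n).starProjection ∘L R) atTop (𝓝 R) := by
    rw [tendsto_iff_norm_sub_tendsto_zero]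
    have h1 : Tendsto (fun n : ℕ => Real.sqrt (D * C / n)) atTop (𝓝 0) := by
      rw [← Real.sqrt_zero]
      exact (Real.continuous_sqrt.tendsto 0).comp (tendsto_const_div_atTop_nhds_zero_nat _)
    refine squeeze_zero' (Eventually.of_forall fun _ => norm_nonneg _)
      ((eventually_gt_atTop 0).mono fun n hn => ?_) h1
    refine ContinuousLinearMap.opNorm_le_bound _ (Real.sqrt_nonneg _) fun h => ?_
    change ‖(V n).starProjection (R h) - R h‖ ≤ _
    rw [norm_sub_rev]
    exact hdist n hn h
  refine isCompactOperator_of_tendsto hlim (Eventually.of_forall fun n => ?_)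
  have : IsCompactOperator ((V n).subtypeL ∘L ((V n).orthogonalProjectionOnto ∘L R)) :=
    (isCompactOperator_of_locallyCompactSpace_dom ((V n).orthogonalProjectionOnto ∘L R)).clm_comp
      (V n).subtypeL
  exact this

end Compactness

/-! ### Spectrum and ground state -/

section SpectralBound

variable {N : ℕ} {B K X : Matrix (Fin N) (Fin N) ℝ}

theorem quadOp_toTemperedDistribution {H : Matrix (Fin N) (Fin N) ℝ} {c : ℝ}
    (f : (quadOp H B K c).domain) :
    ((quadOp H B K c f : L2 N) : 𝓢'(Euc N, ℂ)) = quadOpDist B K c ((f : L2 N) : 𝓢'(Euc N, ℂ)) :=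
  f.2.2.2.choose_spec.symm

/-- Duality: u annihilates the range of the transposed operator, which contains every polynomial
times the Gaussian of the solution Y for -B. -/
theorem eq_zero_of_quadOpDist_eq_smul [NeZero N] (hK : K.PosDef) (hX : X.PosDef)
    (hF : riccati B K X = 0) {c : ℝ} {z : ℂ} (hz : c - X.trace < z.re) {u : L2 N}
    (hu : quadOpDist B K c (u : 𝓢'(Euc N, ℂ)) = z • (u : 𝓢'(Euc N, ℂ))) : u = 0 := by
  obtain ⟨Y, hY, hFY⟩ := exists_posDef_riccati (B := -B) hK
  have htr := trace_riccati_neg hX hF hY hFY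
  rw [Lp.eq_zero_iff_ae_eq_zero]
  refine ae_eq_zero_of_forall_integral_polyGauss hY (Lp.memLp u) fun r => ?_
  -- The transpose has constant term c - tr B, and tr Y = tr X - tr B, so the threshold for z is the
  -- same c - tr X.
  obtain ⟨p, hp⟩ := exists_polyGauss_eq hK hY hFY (z := z - ((c - B.trace : ℝ) : ℂ))
    (by rw [Complex.sub_re, Complex.ofReal_re]; linarith) r
  have h1 := congrArg (fun T : 𝓢'(Euc N, ℂ) => T (polyGauss Y p)) hu
  have h2 : (z • (u : 𝓢'(Euc N, ℂ))) (polyGauss Y p) =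
      (u : 𝓢'(Euc N, ℂ)) (z • polyGauss Y p) := by
    rw [map_smul]
    rfl
  simp only [quadOpDist_apply_apply, h2] at h1
  have h3 : (u : 𝓢'(Euc N, ℂ)) (polyGauss Y r) = 0 := by
    rw [← hp, sub_smul, sub_sub, map_sub, add_comm, h1, sub_self]
  rw [← h3, Lp.toTemperedDistribution_apply]
  rfl

/-- With s = ω + c - z one has (z - Q)R = 1 - sR. Compactness of R reduces invertibility to
excluding eigenfunctions. -/
theorem mem_resolventSetOf_quadOp [NeZero N] (H : Matrix (Fin N) (Fin N) ℝ) (hK : K.PosDef)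
    (hX : X.PosDef) (hF : riccati B K X = 0) {c : ℝ} {z : ℂ} (hz : c - X.trace < z.re) :
    z ∈ resolventSetOf (quadOp H B K c) := by
  obtain ⟨ω₀, h⟩ := exists_resolvent (B := B) H hK hX hF
  -- This choice of ω gives Re s ≥ 1, so s is invertible.
  obtain ⟨R, C, hC, hd, hR, hE, hdom⟩ := h (max ω₀ (z.re - c + 1)) (le_max_left _ _)
  set ω := max ω₀ (z.re - c + 1) with hω
  have hcomp : IsCompactOperator R := isCompactOperator_of_graphMap hX hd hR hC hE
  set s : ℂ := ((ω + c : ℝ) : ℂ) - z with hs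
  have hs0 : s ≠ 0 := fun h0 => by
    have h1 := congrArg Complex.re h0
    rw [hs, Complex.sub_re, Complex.ofReal_re, Complex.zero_re] at h1
    linarith [le_max_right ω₀ (z.re - c + 1)]
  have hQ : ∀ u, quadOpDist B K c (R u : 𝓢'(Euc N, ℂ)) =
      ((((ω + c : ℝ) : ℂ) • R u - u : L2 N) : 𝓢'(Euc N, ℂ)) := fun u => (hdom u).2.2 c
  have hmem : ∀ u, R u ∈ (quadOp H B K c).domain := fun u =>
    ⟨(hdom u).1, (hdom u).2.1, _, hQ u⟩
  have hQR : ∀ u, quadOp H B K c ⟨R u, hmem u⟩ = ((ω + c : ℝ) : ℂ) • R u - u := fun u =>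
    eq_of_toTemperedDistribution_eq ((quadOp_toTemperedDistribution _).trans (hQ u))
  -- If Ru = s⁻¹u, then u solves Qu = zu and vanishes. Otherwise s⁻¹ - R has an inverse S, and s⁻¹RS
  -- is the resolvent at z.
  rcases hcomp.hasEigenvalue_or_mem_resolventSet (inv_ne_zero hs0) with hev | hres
  · exfalso
    obtain ⟨u, hu⟩ := hev.exists_hasEigenvector
    have h1 : R u = s⁻¹ • u := hu.apply_eq_smul
    have h2 : R (s • u) = u := by rw [map_smul, h1, smul_inv_smul₀ hs0]
    refine hu.2 (eq_zero_of_quadOpDist_eq_smul hK hX hF hz ?_)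
    have h3 := hQ (s • u)
    rw [h2] at h3
    rw [h3, ← toTemperedDistribution_smul, ← sub_smul, hs, sub_sub_cancel]
  · rw [spectrum.mem_resolventSet_iff] at hres
    obtain ⟨S, hS⟩ := hres.exists_right_inv
    have hS' : ∀ u, s⁻¹ • S u - R (S u) = u := fun u => by
      have := congrArg (fun T : L2 N →L[ℂ] L2 N => T u) hS
      simpa [Algebra.algebraMap_eq_smul_one] using this
    have hinv : ∀ u, z • R (s⁻¹ • S u) - quadOp H B K c ⟨R (s⁻¹ • S u), hmem _⟩ = u :=
      fun u => by
        have h1 : z = ((ω + c : ℝ) : ℂ) - s := by rw [hs, sub_sub_cancel]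
        rw [hQR, h1, sub_smul, map_smul, smul_inv_smul₀ hs0, sub_sub_sub_cancel_left]
        exact hS' u
    refine ⟨s⁻¹ • (R ∘L S), fun u => ?_, fun f => ?_⟩
    · have h1 : (s⁻¹ • (R ∘L S)) u = R (s⁻¹ • S u) := by rw [map_smul]; rfl
      simp only [h1]
      exact ⟨hmem _, hinv u⟩
    · set g := z • (f : L2 N) - quadOp H B K c f with hg
      have h1 : (s⁻¹ • (R ∘L S)) g = R (s⁻¹ • S g) := by rw [map_smul]; rfl
      rw [h1]
      have h2 := hinv g
      -- The right inverse is also a left inverse, because d lies in the trivial kernel of z - Q.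
      set d : (quadOp H B K c).domain := ⟨R (s⁻¹ • S g), hmem _⟩ - f with hd
      have h3 : quadOp H B K c d = z • (d : L2 N) := by
        rw [hd, LinearPMap.map_sub]
        have h4 : z • R (s⁻¹ • S g) - quadOp H B K c ⟨R (s⁻¹ • S g), hmem _⟩ =
          z • (f : L2 N) - quadOp H B K c f := h2
        rw [Submodule.coe_sub, smul_sub]
        rw [sub_eq_sub_iff_add_eq_add] at h4 ⊢
        rw [h4, add_comm]
      have h5 : (d : L2 N) = 0 := by
        refine eq_zero_of_quadOpDist_eq_smul hK hX hF hz ?_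
        rw [← quadOp_toTemperedDistribution, h3, toTemperedDistribution_smul]
      exact sub_eq_zero.1 h5

theorem toL2_mem_quadOpDomain (H B K : Matrix (Fin N) (Fin N) ℝ) (c : ℝ) (v : 𝓢(Euc N, ℂ)) :
    toL2 v ∈ quadOpDomain H B K c := by
  refine ⟨?_, ?_, _, quadOpDist_toL2 B K c v⟩
  · rw [toTemperedDistribution_toL2]
    exact v.memSobolev
  · simp only [norm_linearField_sq]
    refine memLp_smul_of_smulLeftCLM (hasTemperateGrowth_quadForm_ofReal _)
      (w := toL2 (SchwartzMap.smulLeftCLM ℂ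
        (fun x : Euc N => ((quadForm (Hᵀ * H) x : ℝ) : ℂ)) v)) ?_
    rw [toTemperedDistribution_toL2, toTemperedDistribution_toL2,
      smulLeftCLM_toTemperedDistributionCLM (hasTemperateGrowth_quadForm_ofReal _)]

/-- The Gaussian lies in the domain and is an eigenfunction, so a left inverse would send 0 to it;
its value 1 at the origin shows that it is nonzero. -/
theorem mem_spectrumOf_quadOp (H : Matrix (Fin N) (Fin N) ℝ) (hX : X.PosDef)
    (hF : riccati B K X = 0) (c : ℝ) :
    ((c - X.trace : ℝ) : ℂ) ∈ spectrumOf (quadOp H B K c) := by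
  rintro ⟨R, -, hR⟩
  set v := polyGauss X 1 with hv
  let f : (quadOp H B K c).domain := ⟨toL2 v, toL2_mem_quadOpDomain H B K c v⟩
  have h1 : quadOp H B K c f = ((c - X.trace : ℝ) : ℂ) • (f : L2 N) := by
    refine eq_of_toTemperedDistribution_eq ((quadOp_toTemperedDistribution f).trans ?_)
    change quadOpDist B K c (toL2 v : 𝓢'(Euc N, ℂ)) = _
    have h2 : schwOp B K v + (c : ℂ) • v = ((c - X.trace : ℝ) : ℂ) • v := by
      have h3 : polyLaplacian (1 : MvPolynomial (Fin N) ℂ) = 0 := by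
        simp [polyLaplacian_apply, Derivation.map_one_eq_zero]
      have h4 : polyDrift (closedLoop B X) (1 : MvPolynomial (Fin N) ℂ) = 0 := by
        simp [polyDrift_apply, Derivation.map_one_eq_zero]
      rw [hv, schwOp_polyGauss hX hF, h3, h4, smul_zero, sub_zero, zero_sub, map_neg, map_smul,
        Complex.ofReal_sub, sub_smul]
      abel
    rw [quadOpDist_toL2, h2, toL2_smul]
  have h2 := hR f
  rw [h1, sub_self, map_zero] at h2
  have h3 : toL2 v = toL2 0 := by rw [map_zero]; exact h2.symm
  have h4 := congrArg (fun φ : 𝓢(Euc N, ℂ) => φ 0) (toL2_injective h3)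
  have h5 : v 0 = Real.exp (-(1 / 2) * quadForm X 0) := by
    rw [hv, polyGauss_apply, gaussian_apply hX]
    simp [polyFun]
  have h6 : v 0 = 0 := h4
  rw [h5] at h6
  exact (Real.exp_pos _).ne' (by exact_mod_cast h6)

/-- The spectral bound of the quadratic operator is the eigenvalue of its ground state. -/
theorem spectralBound_quadOp [NeZero N] (H : Matrix (Fin N) (Fin N) ℝ) (hK : K.PosDef)
    (hX : X.PosDef) (hF : riccati B K X = 0) (c : ℝ) :
    spectralBound (quadOp H B K c) = ((c - X.trace : ℝ) : EReal) := by
  refine le_antisymm (iSup₂_le fun z hz => ?_) ?_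
  · rw [EReal.coe_le_coe_iff]
    by_contra! h
    exact hz (mem_resolventSetOf_quadOp H hK hX hF h)
  · refine le_iSup₂_of_le _ (mem_spectrumOf_quadOp H hX hF c) ?_
    rw [Complex.ofReal_re]

end SpectralBound

/-! ### Admissible parameters and the main theorem -/

section Admissible

variable {N : ℕ} {H M : Matrix (Fin N) (Fin N) ℝ}

theorem gradient_quadPotential (hH : H.IsSymm) (x : Euc N) :
    ∇ (quadPotential H) x = linearField H x := by
  let T : Euc N →L[ℝ] Euc N := (Matrix.toEuclideanLin H).toContinuousLinearMap
  have hT : ∀ y z : Euc N, ⟪y, T z⟫_ℝ = ⟪T y, z⟫_ℝ := fun y z => by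
    change ⟪y, linearField H z⟫_ℝ = ⟪linearField H y, z⟫_ℝ
    simp only [PiLp.inner_apply, linearField_apply, RCLike.inner_apply, conj_trivial,
      Finset.sum_mul, Finset.mul_sum]
    rw [Finset.sum_comm]
    refine Finset.sum_congr rfl fun i _ => Finset.sum_congr rfl fun j _ => ?_
    rw [hH.apply]
    ring
  have h1 : HasFDerivAt (fun y : Euc N => (1 / 2 : ℝ) * ⟪y, T y⟫_ℝ)
      (InnerProductSpace.toDual ℝ (Euc N) (T x)) x := by
    refine (((hasFDerivAt_id x).inner ℝ T.hasFDerivAt).const_mul (1 / 2 : ℝ)).congr_fderiv ?_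
    ext y
    simp only [_root_.smul_apply, ContinuousLinearMap.comp_apply,
      ContinuousLinearMap.prod_apply, fderivInnerCLM_apply, InnerProductSpace.toDual_apply_apply,
      id_eq, ContinuousLinearMap.id_apply, smul_eq_mul, hT, real_inner_comm y (T x)]
    ring
  have h2 : HasGradientAt (quadPotential H) (linearField H x) x := h1
  exact h2.gradient

/-- The form of K is the admissibility expression with ℓ replaced by 1; the gain ¼ (1 - ℓ)|H v|² is
strictly positive because H is injective. -/
theorem posDef_matK_of_mem_admissibleSet (hH : H.PosDef) {α : ℝ}
    (hα : α ∈ admissibleSet (quadPotential H) (linearField M)) : (matK H M α).PosDef := by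
  have hHs := hH.posSemidef.isSymm
  simp only [admissibleSet, Set.mem_iUnion] at hα
  obtain ⟨l, ⟨-, hl⟩, hα⟩ := hα
  have h := interior_subset hα
  refine posDef_of_isSymm (isSymm_matK hHs M α) fun v hv => ?_
  have h1 := h (WithLp.toLp 2 v)
  have h2 : ∀ A : Matrix (Fin N) (Fin N) ℝ, linearField A (WithLp.toLp 2 v) =
    WithLp.toLp 2 (A *ᵥ v) := fun A => rfl
  rw [gradient_quadPotential hHs, h2, h2, norm_sq_eq_dotProduct, norm_sq_eq_dotProduct] at h1
  have h3 : ⟪(WithLp.toLp 2 (M *ᵥ v) : Euc N), WithLp.toLp 2 (H *ᵥ v)⟫_ℝ =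
      (M *ᵥ v) ⬝ᵥ (H *ᵥ v) := by
    rw [EuclideanSpace.inner_toLp_toLp, dotProduct_comm]
    rfl
  rw [h3] at h1
  have h4 : v ⬝ᵥ matK H M α *ᵥ v = (1 / 4) * ((H *ᵥ v) ⬝ᵥ (H *ᵥ v))
      - (1 / 2) * ((M *ᵥ v) ⬝ᵥ (H *ᵥ v)) + α * (1 - α) * ((M *ᵥ v) ⬝ᵥ (M *ᵥ v)) := by
    have h5 : v ⬝ᵥ (H ^ 2) *ᵥ v = (H *ᵥ v) ⬝ᵥ (H *ᵥ v) := by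
      rw [sq, ← mulVec_mulVec, dotProduct_mulVec, ← mulVec_transpose, hHs.eq]
    have h6 : v ⬝ᵥ (Mᵀ * M) *ᵥ v = (M *ᵥ v) ⬝ᵥ (M *ᵥ v) := by
      rw [← mulVec_mulVec, dotProduct_mulVec, vecMul_transpose]
    rw [matK, add_mulVec, sub_mulVec, smul_mulVec, smul_mulVec, smul_mulVec, dotProduct_add,
      dotProduct_sub, dotProduct_smul, dotProduct_smul, dotProduct_smul, h5, h6,
      dotProduct_lyapunov hHs]
    simp only [smul_eq_mul]
    ring
  have h5 : 0 < (H *ᵥ v) ⬝ᵥ (H *ᵥ v) := by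
    refine (Finset.sum_nonneg fun _ _ => mul_self_nonneg _).lt_of_ne fun h6 => ?_
    have h7 := hH.quadratic_pos hv
    rw [dotProduct_self_eq_zero.1 h6.symm, dotProduct_zero] at h7
    exact h7.false
  rw [h4]
  nlinarith

theorem isOpen_admissibleSet (V : Euc N → ℝ) (b : Euc N → Euc N) : IsOpen (admissibleSet V b) :=
  isOpen_biUnion fun _ _ => isOpen_interior

open Classical in
/-- The positive definite solution of the Riccati equation at the parameter `α`. -/
noncomputable def riccatiSolution (H M : Matrix (Fin N) (Fin N) ℝ) (α : ℝ) :
    Matrix (Fin N) (Fin N) ℝ :=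
  if h : (matK H M α).PosDef then (exists_posDef_riccati (B := matB M α) h).choose else 0

theorem riccatiSolution_spec {α : ℝ} (h : (matK H M α).PosDef) :
    (riccatiSolution H M α).PosDef ∧
      riccati (matB M α) (matK H M α) (riccatiSolution H M α) = 0 := by
  rw [riccatiSolution, dif_pos h]
  exact (exists_posDef_riccati (B := matB M α) h).choose_spec

end Admissible

end LinearDiffusion

theorem mainTheorem6 (N : ℕ) (hN : 2 ≤ N) (H M : Matrix (Fin N) (Fin N) ℝ) (hH : H.PosDef) :
    ∃ X : ℝ → Matrix (Fin N) (Fin N) ℝ,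
      (∀ α ∈ admissibleSet (quadPotential H) (linearField M),
        IsMaximalRiccatiSolution (matB M α) (matK H M α) (X α) ∧
        spectralBound (deformedOp H M α) =
          ((-(X α).trace + (1 / 2) * H.trace - α * M.trace : ℝ) : EReal) ∧
        (X α).trace = (1 / 2) *
          ((matB M α).trace +
            sumAbsReEigenvalues (hamiltonianMatrix (matB M α) (matK H M α)))) ∧
      AnalyticOnNhd ℝ (fun α => (X α).trace)
        (admissibleSet (quadPotential H) (linearField M)) := by
  have : NeZero N := ⟨by omega⟩
  have hpos : ∀ α ∈ admissibleSet (quadPotential H) (linearField M), (matK H M α).PosDef :=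
    fun α hα => posDef_matK_of_mem_admissibleSet hH hα
  refine ⟨riccatiSolution H M, fun α hα => ?_, fun α hα => ?_⟩
  · obtain ⟨hX, hF⟩ := riccatiSolution_spec (hpos α hα)
    refine ⟨isMaximalRiccatiSolution_of_posDef (hpos α hα) hX hF, ?_,
      sumAbsReEigenvalues_hamiltonianMatrix (hpos α hα) hX hF⟩
    rw [deformedOp, spectralBound_quadOp H (hpos α hα) hX hF]
    congr 1
    ring
  -- The interiors in the definition of 𝒜 matter here: analyticity at α needs K > 0 on a whole
  -- neighbourhood.
  · have hev := (isOpen_admissibleSet (quadPotential H) (linearField M)).mem_nhds hα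
    exact analyticAt_trace_riccati hH.posSemidef.isSymm
      (Filter.Eventually.mono hev fun β hβ => hpos β hβ)
      (Filter.Eventually.mono hev fun β hβ => riccatiSolution_spec (hpos β hβ))
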